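/- **Model.** A 3-d mesh of edge length $s$ has the processors $\{0,\dots,s-1\}^3$, each connected to its (at most 6) neighbors at distance 1. All processors synchronously run one fixed program. Each processor has a fixed number of words: natural numbers of $\Theta(\log p)$ bits, where $p=s^3$ is the number of processors, and weights in $\mathbb{R}\cup\{\pm\infty\}$. In one time step each processor replaces each of its words by the value of a fixed finite expression in its own words and those of its neighbors, built from the constants, from $+,-,\cdot,\lfloor\cdot/\cdot\rfloor,\bmod$ on numbers (with subtraction truncated at $0$), from $+,\min,\max$ on weights, and from case distinctions by comparing two numbers or two weights. Initially each processor knows $n$, $s$ and its coordinates. An $n\times n$ input matrix is stored one entry per processor in row-major order in a corner subcube of edge length $\lceil n^{2/3}\rceil$. The computation ends when all processors have raised a halting flag; the output is then stored in the same places. A mesh of size $n^\alpha$ means one of edge length $\lceil n^{\alpha/3}\rceil$. **Problems.** Let $G$ be a directed graph on $n$ vertices with real edge weights; paths may repeat vertices. The length of a path is the sum of its edge weights, and its width is the smallest of them ($+\infty$ for the path without edges). *All-pairs shortest paths (APSP)*, for $G$ without cycles of negative length: for all $i,j$, determine the least length of a path from $i$ to $j$ ($+\infty$ if there is no path), and a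 shortest path. *All-pairs bottleneck paths (APBP)*: for all $i,j$, determine the largest width of a path from $i$ to $j$ ($-\infty$ if there is no path), and a widest path. The paths are given by a table: for $i\ne j$ such that $j$ can be reached from $i$, it records either that the path is the edge from $i$ to $j$, or a vertex $k$ such that the path consists of the recorded path from $i$ to $k$ followed by the recorded path from $k$ to $j$; the recorded path from a vertex to itself is the one without edges. The input is either the weight matrix (with $+\infty$ for missing edges for APSP, and $-\infty$ for APBP) or, for graphs all of whose edges have weight 1, the $0/1$ adjacency matrix. **Corollary 1.** For every real $\alpha$ with $2\le\alpha\le 9/4$, each of APSP and APBP on $n$-vertex directed graphs, given by the weight matrix or by the adjacency matrix, can be solved on a 3-d mesh of size $n^\alpha$ in $\Theta(n^{3-\alpha}\log n)$ time: there are a program and a function $T(n)=\Theta(n^{3-\alpha}\log n)$, with implied constants that may depend on $\alpha$, such that for every $n$ the program solves the problem on every $n$-vertex input in exactly $T(n)$ steps. In particular, for $\alpha=9/4$ the time is $\Theta(n^{3/4}\log n)$. -/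

import Mathlib

noncomputable section

/-! ### The three-dimensional mesh-connected computer -/

/-- The processors of a cubical mesh of edge length `s`: points of the grid `{0, …, s-1}³`. -/
abbrev Proc (s : ℕ) : Type := Fin 3 → Fin s

/-- One of the six directions: an axis, and `true` for increasing, `false` for decreasing. -/
abbrev Dir : Type := Fin 3 × Bool

/-- The adjacent processor in a given direction, `none` at the boundary of the mesh. -/
def neighbor {s : ℕ} (p : Proc s) (d : Dir) : Option (Proc s) :=
  if d.2 then
    if h : (p d.1 : ℕ) + 1 < s then some (Function.update p d.1 ⟨(p d.1 : ℕ) + 1, h⟩) else none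
  else
    if 0 < (p d.1 : ℕ) then some (Function.update p d.1 ⟨(p d.1 : ℕ) - 1, by omega⟩) else none

/-- The two kinds of words: bounded natural numbers (indices, coordinates, counters) and
weights (real numbers or `±∞`). -/
inductive Kind : Type
  | num
  | wt

/-- The values of a word of a given kind. -/
def Kind.Val : Kind → Type
  | .num => ℕ
  | .wt => EReal

/-- Elementary operations on natural-number words. -/
inductive NumOp : Type
  | add
  | sub
  | mul
  | div
  | mod

/-- Elementary operations on natural-number words; `sub` is truncated at `0`. -/
def NumOp.eval : NumOp → ℕ → ℕ → ℕ
  | .add, x, y => x + y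
  | .sub, x, y => x - y
  | .mul, x, y => x * y
  | .div, x, y => x / y
  | .mod, x, y => x % y

/-- Elementary operations on weights. -/
inductive WtOp : Type
  | add
  | min
  | max

/-- Elementary operations on weights. -/
def WtOp.eval : WtOp → EReal → EReal → EReal
  | .add, x, y => x + y
  | .min, x, y => x ⊓ y
  | .max, x, y => x ⊔ y

/-- The constants available for weights. -/
inductive WtConst : Type
  | zero
  | top
  | bot

/-- The constants available for weights. -/
def WtConst.eval : WtConst → EReal
  | .zero => 0
  | .top => ⊤
  | .bot => ⊥

/-- The memory of one processor: `a` natural-number words and `b` weights. -/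
structure LocalState (a b : ℕ) : Type where
  num : Fin a → ℕ
  wt : Fin b → EReal

/-- The memory all of whose words are `0`. -/
def LocalState.blank (a b : ℕ) : LocalState a b := ⟨fun _ => 0, fun _ => 0⟩

/-- Finite expressions in the registers of a processor (source `none`) and of its six neighbors
(source `some d`). `ifNum x y u v` is `u` if `x ≤ y` and `v` otherwise, and `ifWt` is the same
for a comparison of weights. There is no conversion between weights and numbers. -/
inductive Expr (a b : ℕ) : Kind → Type
  | numConst (c : ℕ) : Expr a b .num
  | numReg (src : Option Dir) (r : Fin a) : Expr a b .num
  | numOp (op : NumOp) (x y : Expr a b .num) : Expr a b .num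
  | wtConst (c : WtConst) : Expr a b .wt
  | wtReg (src : Option Dir) (r : Fin b) : Expr a b .wt
  | wtOp (op : WtOp) (x y : Expr a b .wt) : Expr a b .wt
  | ifNum {k : Kind} (x y : Expr a b .num) (u v : Expr a b k) : Expr a b k
  | ifWt {k : Kind} (x y : Expr a b .wt) (u v : Expr a b k) : Expr a b k

open Classical in
/-- The value of an expression, given the memories that a processor sees. -/
def Expr.eval {a b : ℕ} (view : Option Dir → LocalState a b) :
    {k : Kind} → Expr a b k → k.Val
  | _, .numConst c => c
  | _, .numReg src r => (view src).num r
  | _, .numOp op x y => op.eval (x.eval view) (y.eval view)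
  | _, .wtConst c => c.eval
  | _, .wtReg src r => (view src).wt r
  | _, .wtOp op x y => op.eval (x.eval view) (y.eval view)
  | _, .ifNum x y u v =>
      if (show ℕ from x.eval view) ≤ (show ℕ from y.eval view) then u.eval view else v.eval view
  | _, .ifWt x y u v =>
      if (show EReal from x.eval view) ≤ (show EReal from y.eval view)
        then u.eval view else v.eval view

/-- A program, the same for all processors and for all meshes: a fixed number of words per
processor, a word length factor, and for each register the expression by which it is replaced in
one time step. As the program is fixed, a time step consists of a bounded number of word
transfers between adjacent processors and of elementary operations.

Natural-number registers: `0` the order `n` of the input matrix, `1` the edge length of the mesh,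
`2`, `3`, `4` the coordinates of the processor, `5` the halting flag, `6` the intermediate vertex
in the output. Weight register `0` holds the matrix entry, both at input and at output. -/
structure MeshProgram : Type where
  numExtra : ℕ
  wtExtra : ℕ
  wordLen : ℕ
  numNext : Fin (numExtra + 7) → Expr (numExtra + 7) (wtExtra + 1) .num
  wtNext : Fin (wtExtra + 1) → Expr (numExtra + 7) (wtExtra + 1) .wt

/-- The memory of one processor of a mesh that runs `P`. -/
abbrev MeshProgram.State (P : MeshProgram) : Type :=
  LocalState (P.numExtra + 7) (P.wtExtra + 1)

/-- The number of values of a natural-number word on a mesh with `s³` processors: words have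
`wordLen * (⌊log₂ s³⌋ + 1)` bits. -/
def MeshProgram.wordSize (P : MeshProgram) (s : ℕ) : ℕ :=
  2 ^ (P.wordLen * (Nat.log 2 (s ^ 3) + 1))

/-- The memories that processor `p` sees: its own and those of its neighbors (blank where the
neighbor is missing). -/
def MeshProgram.view (P : MeshProgram) {s : ℕ} (σ : Proc s → P.State) (p : Proc s) :
    Option Dir → P.State
  | none => σ p
  | some d =>
    match neighbor p d with
    | none => LocalState.blank _ _
    | some q => σ q

/-- One synchronous time step of the whole mesh. -/
def MeshProgram.step (P : MeshProgram) {s : ℕ} (σ : Proc s → P.State) : Proc s → P.State :=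
  fun p =>
    { num := fun r => (show ℕ from (P.numNext r).eval (P.view σ p)) % P.wordSize s
      wt := fun r => (P.wtNext r).eval (P.view σ p) }

/-- The entry of an `n × n` matrix that is stored at a processor, if any. The matrix occupies a
corner subcube of edge length `m = ⌈n^(2/3)⌉`, one entry per processor, in row-major order. -/
def entryAt (n : ℕ) {s : ℕ} (p : Proc s) : Option (Fin n × Fin n) :=
  let m := ⌈(n : ℝ) ^ (2 / 3 : ℝ)⌉₊
  let q := ((p 0 : ℕ) * m + (p 1 : ℕ)) * m + (p 2 : ℕ)
  if h : ((p 0 : ℕ) < m ∧ (p 1 : ℕ) < m ∧ (p 2 : ℕ) < m) ∧ q < n * n then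
    some (⟨q / n, Nat.div_lt_of_lt_mul h.2⟩,
      ⟨q % n, Nat.mod_lt _ (Nat.pos_of_mul_pos_left (Nat.zero_lt_of_lt h.2))⟩)
  else none

/-- The initial memories, for the input matrix `A`. -/
def MeshProgram.init (P : MeshProgram) (s : ℕ) {n : ℕ} (A : Fin n → Fin n → EReal) :
    Proc s → P.State :=
  fun p =>
    { num := fun r =>
        match (r : ℕ) with
        | 0 => n
        | 1 => s
        | 2 => p 0
        | 3 => p 1
        | 4 => p 2
        | _ => 0
      wt := fun r =>
        if r = 0 then
          match entryAt n p with
          | some (i, j) => A i j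
          | none => 0
        else 0 }

/-- The memories after `t` time steps on input `A`, on a mesh of edge length `s`. -/
def MeshProgram.run (P : MeshProgram) (s : ℕ) {n : ℕ} (A : Fin n → Fin n → EReal) (t : ℕ) :
    Proc s → P.State :=
  P.step^[t] (P.init s A)

/-- All processors have raised their halting flag. -/
def MeshProgram.Halted (P : MeshProgram) {s : ℕ} (σ : Proc s → P.State) : Prop :=
  ∀ p, (σ p).num 5 ≠ 0

/-- The running time of `P` on input `A` is exactly `t`. -/
def MeshProgram.HaltsAt (P : MeshProgram) (s : ℕ) {n : ℕ} (A : Fin n → Fin n → EReal)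
    (t : ℕ) : Prop :=
  P.Halted (P.run s A t) ∧ ∀ t' < t, ¬ P.Halted (P.run s A t')

/-- On input `A` the program runs for exactly `t` time steps, and then the matrices `D` and `mid`
are stored in the mesh, in the same places as the entries of the input. -/
def MeshProgram.Outputs (P : MeshProgram) (s : ℕ) {n : ℕ} (A : Fin n → Fin n → EReal) (t : ℕ)
    (D : Fin n → Fin n → EReal) (mid : Fin n → Fin n → ℕ) : Prop :=
  P.HaltsAt s A t ∧
    ∀ i j, ∃ p : Proc s, entryAt n p = some (i, j) ∧
      (P.run s A t p).wt 0 = D i j ∧ (P.run s A t p).num 6 = mid i j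

/-- The edge length of a cubical mesh of size `n ^ α`, rounded up to an integer. -/
def meshSide (α : ℝ) (n : ℕ) : ℕ := ⌈(n : ℝ) ^ (α / 3)⌉₊

/-! ### Path problems on directed graphs -/

/-- A directed graph with vertices `0, …, n-1` and real edge weights: `G i j = some c` if there
is an edge from `i` to `j`, of weight `c`, and `none` if there is no such edge. -/
abbrev WDigraph (n : ℕ) : Type := Fin n → Fin n → Option ℝ

open Classical in
/-- An unweighted directed graph, with all edges of weight `1`. -/
def WDigraph.ofDigraph {n : ℕ} (G : Digraph (Fin n)) : WDigraph n :=
  fun i j => if G.Adj i j then some 1 else none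

/-- Directed paths (vertices may repeat) from one vertex to another. -/
inductive DiPath {n : ℕ} (G : WDigraph n) : Fin n → Fin n → Type
  | nil (i : Fin n) : DiPath G i i
  | cons {i k j : Fin n} (c : ℝ) (h : G i k = some c) (p : DiPath G k j) : DiPath G i j

namespace DiPath

variable {n : ℕ} {G : WDigraph n}

/-- The length of a path: the sum of the weights of its edges. -/
def length : {i j : Fin n} → DiPath G i j → ℝ
  | _, _, nil _ => 0
  | _, _, cons c _ p => c + p.length

/-- The width of a path: the smallest weight of an edge on it (`⊤` for the path without
edges). -/
def width : {i j : Fin n} → DiPath G i j → EReal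
  | _, _, nil _ => ⊤
  | _, _, cons c _ p => (c : EReal) ⊓ p.width

/-- Concatenation of paths. -/
def append : {i k j : Fin n} → DiPath G i k → DiPath G k j → DiPath G i j
  | _, _, _, nil _, q => q
  | _, _, _, cons c h p, q => cons c h (p.append q)

/-- `FromTable mid p` says that `p` is the path which the table `mid` describes. For `i ≠ j`, the
value `mid i j = 0` stands for the edge from `i` to `j`, and `mid i j = k + 1` for the path from
`i` to `k` followed by the path from `k` to `j`. -/
inductive FromTable (mid : Fin n → Fin n → ℕ) : {i j : Fin n} → DiPath G i j → Prop
  | nil (i : Fin n) : FromTable mid (DiPath.nil i)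
  | edge {i j : Fin n} (c : ℝ) (h : G i j = some c) (hij : i ≠ j) (hm : mid i j = 0) :
      FromTable mid (DiPath.cons c h (DiPath.nil j))
  | split {i k j : Fin n} {p : DiPath G i k} {q : DiPath G k j} (hij : i ≠ j)
      (hm : mid i j = (k : ℕ) + 1) (hp : FromTable mid p) (hq : FromTable mid q) :
      FromTable mid (p.append q)

end DiPath

/-- There is no closed path of negative length. -/
def WDigraph.NoNegativeCycle {n : ℕ} (G : WDigraph n) : Prop :=
  ∀ (i : Fin n) (p : DiPath G i i), 0 ≤ p.length

/-- `D` and `mid` solve the all-pairs shortest path problem: where there is a path from `i` to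
`j`, the table `mid` describes a shortest one and `D i j` is its length; otherwise `D i j = ⊤`. -/
def IsAPSP {n : ℕ} (G : WDigraph n) (D : Fin n → Fin n → EReal) (mid : Fin n → Fin n → ℕ) :
    Prop :=
  ∀ i j,
    (∃ p : DiPath G i j, DiPath.FromTable mid p ∧ (∀ q : DiPath G i j, p.length ≤ q.length) ∧
      D i j = (p.length : EReal)) ∨
    (IsEmpty (DiPath G i j) ∧ D i j = ⊤)

/-- `D` and `mid` solve the all-pairs bottleneck path problem: where there is a path from `i` to
`j`, the table `mid` describes a widest one and `D i j` is its width; otherwise `D i j = ⊥`. -/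
def IsAPBP {n : ℕ} (G : WDigraph n) (D : Fin n → Fin n → EReal) (mid : Fin n → Fin n → ℕ) :
    Prop :=
  ∀ i j,
    (∃ p : DiPath G i j, DiPath.FromTable mid p ∧ (∀ q : DiPath G i j, q.width ≤ p.width) ∧
      D i j = p.width) ∨
    (IsEmpty (DiPath G i j) ∧ D i j = ⊥)

/-- The weight matrix, with the entry `e` where there is no edge. -/
def WDigraph.weightMatrix {n : ℕ} (G : WDigraph n) (e : EReal) : Fin n → Fin n → EReal :=
  fun i j => (G i j).elim e (fun c => (c : EReal))

open Classical in
/-- The adjacency matrix, with entries `1` (edge) and `0` (no edge). -/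
def adjacencyMatrix {n : ℕ} (G : Digraph (Fin n)) : Fin n → Fin n → EReal :=
  fun i j => if G.Adj i j then 1 else 0

/-! ### Solving the path problems on meshes of size `n ^ α` -/

/-- Given the weight matrix (with `⊤` for missing edges) of a directed graph without negative
cycles, `P` solves the all-pairs shortest path problem in time `T n`. -/
def SolvesWeightedAPSP (α : ℝ) (P : MeshProgram) (T : ℕ → ℕ) : Prop :=
  ∀ (n : ℕ) (G : WDigraph n), G.NoNegativeCycle →
    ∃ D mid, P.Outputs (meshSide α n) (G.weightMatrix ⊤) (T n) D mid ∧ IsAPSP G D mid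

/-- Given the adjacency matrix of a directed graph, `P` solves the all-pairs shortest path
problem (for edges of weight `1`) in time `T n`. -/
def SolvesUnweightedAPSP (α : ℝ) (P : MeshProgram) (T : ℕ → ℕ) : Prop :=
  ∀ (n : ℕ) (G : Digraph (Fin n)),
    ∃ D mid, P.Outputs (meshSide α n) (adjacencyMatrix G) (T n) D mid ∧
      IsAPSP (WDigraph.ofDigraph G) D mid

/-- Given the weight matrix (with `⊥` for missing edges) of a directed graph, `P` solves the
all-pairs bottleneck path problem in time `T n`. -/
def SolvesWeightedAPBP (α : ℝ) (P : MeshProgram) (T : ℕ → ℕ) : Prop :=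
  ∀ (n : ℕ) (G : WDigraph n),
    ∃ D mid, P.Outputs (meshSide α n) (G.weightMatrix ⊥) (T n) D mid ∧ IsAPBP G D mid

/-- Given the adjacency matrix of a directed graph, `P` solves the all-pairs bottleneck path
problem (for edges of weight `1`) in time `T n`. -/
def SolvesUnweightedAPBP (α : ℝ) (P : MeshProgram) (T : ℕ → ℕ) : Prop :=
  ∀ (n : ℕ) (G : Digraph (Fin n)),
    ∃ D mid, P.Outputs (meshSide α n) (adjacencyMatrix G) (T n) D mid ∧
      IsAPBP (WDigraph.ofDigraph G) D mid

/-- Some program solves the problem in time of exact order `f`. -/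
def SolvableInTheta (Solves : MeshProgram → (ℕ → ℕ) → Prop) (f : ℕ → ℝ) : Prop :=
  ∃ (P : MeshProgram) (T : ℕ → ℕ), Solves P T ∧
    Asymptotics.IsTheta Filter.atTop (fun n => (T n : ℝ)) f

/-- Both path problems, from weight matrices and from adjacency matrices, can be solved on a mesh
of size `n ^ α` in time of exact order `f`. -/
def PathProblemsSolvableInTheta (α : ℝ) (f : ℕ → ℝ) : Prop :=
  SolvableInTheta (SolvesWeightedAPSP α) f ∧
  SolvableInTheta (SolvesUnweightedAPSP α) f ∧
  SolvableInTheta (SolvesWeightedAPBP α) f ∧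
  SolvableInTheta (SolvesUnweightedAPBP α) f

end

/-! Both problems ask for the closure of a matrix: over (min, +) for shortest paths, over (max, min)
for widest ones. With the empty path on the diagonal, ⌈log₂ n⌉ squarings, each combined with the
previous matrix, cover all paths with fewer than n edges. Longer paths are superfluous because
cutting out a closed part never makes a path worse (`PathAlg.Suits.exists_edges_lt`,
`IsClosure.asGood_path`, `IsClosure.optimal`).

Each processor simulates 8³ cells, so that the cells form a cube of side S = 8s. All communication
is by sweeps of 4S steps. On every line parallel to an axis the words move to coordinate 0, are
reflected and move out again. Loading is delayed by the sum of the other two coordinates, and this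
makes the k-th words of the three lines through a cell arrive there at the same step (`sweep_right`,
`sweep_loc`).

For a product let u = ⌈n/s⌉. Splitting rows and columns by residue mod u gives u² blocks of side at
most s, each kept in one layer of the cube. As u² ≤ 4s, the cube has room for `width` ≥ 2 copies of
this system of layers, and the u³ block products take E = ⌈u/`width`⌉ rounds: one sweep fetches the
factors, one multiplies. A last sweep combines the layers (`IsRun.entry_succ`). Since s·E is u³ up
to constants and a term of order s, a product takes time of order u³ + s. Here u³ is comparable to
n³/s³, that is to n^(3-α), as long as s ≤ n up to constants, and s is at most of the order of
n^(3-α) exactly when α ≤ 9/4. The condition α ≥ 2 lets the input fit.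

The input reaches its layers along routes with five axis-parallel moves. At most six entries share a
position, and they are told apart by a slot; six passes of five sweeps bring the matrix home, and
six more bring the result back (`Geo.Valid.decI_pos`, `Geo.Valid.decJ_pos`, `IsRun.in_d`,
`IsRun.out_x`).

For the table of paths, an entry changes only when it strictly improves, and it then records the
intermediate vertex. The recorded halves may themselves be replaced later, so one has to show that
unfolding the final table terminates at an optimal path (`IsClosure.exists_fromTable`). Lengths are
cancellative, hence the halves of a shortest path were already shortest. For widths a half that
improves later is strictly wider than the whole, and the number of pairs of larger width decreases.
-/

noncomputable section

/-! ### Functions of the view that are given by expressions -/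

/-- What a processor sees: its own memory and those of its neighbors. -/
abbrev View (a b : ℕ) : Type := Option Dir → LocalState a b

section Expressible

variable {a b : ℕ}

/-- The value of a number-valued expression, as a function of the view. -/
def Expr.numFun (e : Expr a b .num) (v : View a b) : ℕ := e.eval v

/-- The value of a weight-valued expression, as a function of the view. -/
def Expr.wtFun (e : Expr a b .wt) (v : View a b) : EReal := e.eval v

/-- A number-valued function of the view that is the value of an expression. -/
def IsNum (f : View a b → ℕ) : Prop := ∃ e : Expr a b .num, e.numFun = f

/-- A weight-valued function of the view that is the value of an expression. -/
def IsWt (f : View a b → EReal) : Prop := ∃ e : Expr a b .wt, e.wtFun = f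

/-- A condition on the view that expressions can test. -/
def IsCond (p : View a b → Prop) : Prop :=
  (∀ f g : View a b → ℕ, IsNum f → IsNum g →
    ∃ h, IsNum h ∧ ∀ v, (p v → h v = f v) ∧ (¬ p v → h v = g v)) ∧
  (∀ f g : View a b → EReal, IsWt f → IsWt g →
    ∃ h, IsWt h ∧ ∀ v, (p v → h v = f v) ∧ (¬ p v → h v = g v))

theorem IsNum.const (c : ℕ) : IsNum (fun _ : View a b => c) := ⟨.numConst c, rfl⟩

theorem IsNum.reg (src : Option Dir) (r : Fin a) : IsNum (fun v : View a b => (v src).num r) :=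
  ⟨.numReg src r, rfl⟩

theorem IsNum.op (o : NumOp) {f g : View a b → ℕ} (hf : IsNum f) (hg : IsNum g) :
    IsNum (fun v => o.eval (f v) (g v)) := by
  obtain ⟨e, rfl⟩ := hf
  obtain ⟨e', rfl⟩ := hg
  exact ⟨.numOp o e e', rfl⟩

theorem IsNum.add {f g : View a b → ℕ} (hf : IsNum f) (hg : IsNum g) :
    IsNum (fun v => f v + g v) := IsNum.op .add hf hg

theorem IsNum.sub {f g : View a b → ℕ} (hf : IsNum f) (hg : IsNum g) :
    IsNum (fun v => f v - g v) := IsNum.op .sub hf hg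

theorem IsNum.mul {f g : View a b → ℕ} (hf : IsNum f) (hg : IsNum g) :
    IsNum (fun v => f v * g v) := IsNum.op .mul hf hg

theorem IsNum.div {f g : View a b → ℕ} (hf : IsNum f) (hg : IsNum g) :
    IsNum (fun v => f v / g v) := IsNum.op .div hf hg

theorem IsNum.mod {f g : View a b → ℕ} (hf : IsNum f) (hg : IsNum g) :
    IsNum (fun v => f v % g v) := IsNum.op .mod hf hg

theorem IsWt.const (c : WtConst) : IsWt (fun _ : View a b => c.eval) := ⟨.wtConst c, rfl⟩

theorem IsWt.zero : IsWt (fun _ : View a b => (0 : EReal)) := IsWt.const .zero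

theorem IsWt.reg (src : Option Dir) (r : Fin b) : IsWt (fun v : View a b => (v src).wt r) :=
  ⟨.wtReg src r, rfl⟩

theorem IsWt.op (o : WtOp) {f g : View a b → EReal} (hf : IsWt f) (hg : IsWt g) :
    IsWt (fun v => o.eval (f v) (g v)) := by
  obtain ⟨e, rfl⟩ := hf
  obtain ⟨e', rfl⟩ := hg
  exact ⟨.wtOp o e e', rfl⟩

theorem IsNum.ite {p : View a b → Prop} [∀ v, Decidable (p v)] {f g : View a b → ℕ}
    (hp : IsCond p) (hf : IsNum f) (hg : IsNum g) : IsNum (fun v => if p v then f v else g v) := by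
  obtain ⟨h, ⟨e, he⟩, hv⟩ := hp.1 f g hf hg
  refine ⟨e, he.trans (funext fun v => ?_)⟩
  split_ifs with hc
  · exact (hv v).1 hc
  · exact (hv v).2 hc

theorem IsWt.ite {p : View a b → Prop} [∀ v, Decidable (p v)] {f g : View a b → EReal}
    (hp : IsCond p) (hf : IsWt f) (hg : IsWt g) : IsWt (fun v => if p v then f v else g v) := by
  obtain ⟨h, ⟨e, he⟩, hv⟩ := hp.2 f g hf hg
  refine ⟨e, he.trans (funext fun v => ?_)⟩
  split_ifs with hc
  · exact (hv v).1 hc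
  · exact (hv v).2 hc

/-- Expressions have no truth values, so conditions are described by the branchings they permit. The
two comparison constructors are the only primitive tests; negation swaps the branches and
conjunction nests them. -/
theorem IsCond.le {x y : View a b → ℕ} (hx : IsNum x) (hy : IsNum y) :
    IsCond (fun v => x v ≤ y v) := by
  obtain ⟨ex, rfl⟩ := hx
  obtain ⟨ey, rfl⟩ := hy
  refine ⟨fun f g ⟨ef, hf⟩ ⟨eg, hg⟩ => ⟨_, ⟨.ifNum ex ey ef eg, rfl⟩, fun v => ?_⟩,
    fun f g ⟨ef, hf⟩ ⟨eg, hg⟩ => ⟨_, ⟨.ifNum ex ey ef eg, rfl⟩, fun v => ?_⟩⟩ <;>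
  · subst hf hg
    exact ⟨fun h => if_pos h, fun h => if_neg h⟩

theorem IsCond.wtLe {x y : View a b → EReal} (hx : IsWt x) (hy : IsWt y) :
    IsCond (fun v => x v ≤ y v) := by
  obtain ⟨ex, rfl⟩ := hx
  obtain ⟨ey, rfl⟩ := hy
  refine ⟨fun f g ⟨ef, hf⟩ ⟨eg, hg⟩ => ⟨_, ⟨.ifWt ex ey ef eg, rfl⟩, fun v => ?_⟩,
    fun f g ⟨ef, hf⟩ ⟨eg, hg⟩ => ⟨_, ⟨.ifWt ex ey ef eg, rfl⟩, fun v => ?_⟩⟩ <;>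
  · subst hf hg
    exact ⟨fun h => if_pos h, fun h => if_neg h⟩

theorem IsCond.not {p : View a b → Prop} (hp : IsCond p) : IsCond (fun v => ¬ p v) := by
  refine ⟨fun f g hf hg => ?_, fun f g hf hg => ?_⟩
  · obtain ⟨h, hh, hv⟩ := hp.1 g f hg hf
    exact ⟨h, hh, fun v => ⟨(hv v).2, fun hc => (hv v).1 (not_not.1 hc)⟩⟩
  · obtain ⟨h, hh, hv⟩ := hp.2 g f hg hf
    exact ⟨h, hh, fun v => ⟨(hv v).2, fun hc => (hv v).1 (not_not.1 hc)⟩⟩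

theorem IsCond.and {p q : View a b → Prop} (hp : IsCond p) (hq : IsCond q) :
    IsCond (fun v => p v ∧ q v) := by
  refine ⟨fun f g hf hg => ?_, fun f g hf hg => ?_⟩
  · obtain ⟨h, hh, hv⟩ := hq.1 f g hf hg
    obtain ⟨h', hh', hv'⟩ := hp.1 h g hh hg
    refine ⟨h', hh', fun v => ⟨fun hc => ((hv' v).1 hc.1).trans ((hv v).1 hc.2), fun hc => ?_⟩⟩
    by_cases h1 : p v
    · exact ((hv' v).1 h1).trans ((hv v).2 fun h2 => hc ⟨h1, h2⟩)
    · exact (hv' v).2 h1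
  · obtain ⟨h, hh, hv⟩ := hq.2 f g hf hg
    obtain ⟨h', hh', hv'⟩ := hp.2 h g hh hg
    refine ⟨h', hh', fun v => ⟨fun hc => ((hv' v).1 hc.1).trans ((hv v).1 hc.2), fun hc => ?_⟩⟩
    by_cases h1 : p v
    · exact ((hv' v).1 h1).trans ((hv v).2 fun h2 => hc ⟨h1, h2⟩)
    · exact (hv' v).2 h1

theorem IsCond.congr {p q : View a b → Prop} (hp : IsCond p) (h : ∀ v, q v ↔ p v) : IsCond q := by
  have : q = p := funext fun v => propext (h v)
  exact this ▸ hp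

theorem IsCond.lt {x y : View a b → ℕ} (hx : IsNum x) (hy : IsNum y) :
    IsCond (fun v => x v < y v) := (IsCond.le hy hx).not.congr fun _ => not_le.symm

theorem IsCond.eq {x y : View a b → ℕ} (hx : IsNum x) (hy : IsNum y) :
    IsCond (fun v => x v = y v) := ((IsCond.le hx hy).and (IsCond.le hy hx)).congr fun _ =>
  le_antisymm_iff

theorem IsCond.wtLt {x y : View a b → EReal} (hx : IsWt x) (hy : IsWt y) :
    IsCond (fun v => x v < y v) := (IsCond.wtLe hy hx).not.congr fun _ => not_le.symm

theorem IsCond.const (p : Prop) : IsCond (fun _ : View a b => p) := by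
  by_cases hp : p
  · exact ⟨fun f g hf _ => ⟨f, hf, fun _ => ⟨fun _ => rfl, fun h => (h hp).elim⟩⟩,
      fun f g hf _ => ⟨f, hf, fun _ => ⟨fun _ => rfl, fun h => (h hp).elim⟩⟩⟩
  · exact ⟨fun f g _ hg => ⟨g, hg, fun _ => ⟨fun h => (hp h).elim, fun _ => rfl⟩⟩,
      fun f g _ hg => ⟨g, hg, fun _ => ⟨fun h => (hp h).elim, fun _ => rfl⟩⟩⟩

end Expressible

/-- The program that replaces each register by the given function of the view. -/
def programOf (ne we wl : ℕ) (F : Fin (ne + 7) → View (ne + 7) (we + 1) → ℕ)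
    (G : Fin (we + 1) → View (ne + 7) (we + 1) → EReal) (hF : ∀ r, IsNum (F r))
    (hG : ∀ r, IsWt (G r)) : MeshProgram where
  numExtra := ne
  wtExtra := we
  wordLen := wl
  numNext r := (hF r).choose
  wtNext r := (hG r).choose

theorem programOf_step_num {ne we wl : ℕ} {F : Fin (ne + 7) → View (ne + 7) (we + 1) → ℕ}
    {G : Fin (we + 1) → View (ne + 7) (we + 1) → EReal} (hF : ∀ r, IsNum (F r))
    (hG : ∀ r, IsWt (G r)) {s : ℕ} (σ : Proc s → LocalState (ne + 7) (we + 1)) (p : Proc s)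
    (r : Fin (ne + 7)) :
    ((programOf ne we wl F G hF hG).step σ p).num r =
      F r ((programOf ne we wl F G hF hG).view σ p) %
        (programOf ne we wl F G hF hG).wordSize s := by
  exact congrArg (· % _) (congrFun (hF r).choose_spec _)

theorem programOf_step_wt {ne we wl : ℕ} {F : Fin (ne + 7) → View (ne + 7) (we + 1) → ℕ}
    {G : Fin (we + 1) → View (ne + 7) (we + 1) → EReal} (hF : ∀ r, IsNum (F r))
    (hG : ∀ r, IsWt (G r)) {s : ℕ} (σ : Proc s → LocalState (ne + 7) (we + 1)) (p : Proc s)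
    (r : Fin (we + 1)) :
    ((programOf ne we wl F G hF hG).step σ p).wt r =
      G r ((programOf ne we wl F G hF hG).view σ p) :=
  congrFun (hG r).choose_spec _

end


noncomputable section

/-! ### Sweeps

A sweep lets every cell `p` of a cubical grid of side `S` read, one after the other, the words
that are loaded at the cells `p[a := k]` for `k = 0, …, S - 1`, and this for the three axes `a` at
the same time. The words move towards coordinate `0` in the streams `left`, are reflected there,
and move back in the streams `right`. -/

/-- A weight together with a number. -/
@[ext]
structure Word : Type where
  w : EReal
  k : ℕ

/-- The word `0`. -/
def Word.blank : Word := ⟨0, 0⟩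

/-- The words of a cell other than its streams: `x` for input and output, `v` for words under
way, `d` for the matrix, `a` and `b` for the factors and `c` for the result of a product. -/
structure Loc : Type where
  x : Word
  v : Word
  d : Word
  a : Word
  b : Word
  c : Word

/-- The memory of a cell. -/
structure Cell : Type where
  loc : Loc
  left : Fin 3 → Word
  right : Fin 3 → Word

/-- Positions of cells. -/
abbrev Pos : Type := Fin 3 → ℕ

/-- The sum of the coordinates. -/
def Pos.sum (p : Pos) : ℕ := p 0 + p 1 + p 2

theorem Pos.sum_update (p : Pos) (a : Fin 3) (k : ℕ) :
    Pos.sum (Function.update p a k) + p a = Pos.sum p + k := by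
  fin_cases a <;> simp [Pos.sum, Function.update] <;> omega

theorem Pos.le_sum (p : Pos) (a : Fin 3) : p a ≤ Pos.sum p := by
  fin_cases a <;> simp [Pos.sum] <;> omega

/-- The new memory of the cell `p` after the `τ`-th step of a sweep, given its memory `c`, the
words `up a` that come from the next higher cells and `dn a` that come from the next lower ones. -/
def sweepCell (S τ : ℕ) (load : Fin 3 → Loc → Word) (con : ℕ → (Fin 3 → Word) → Loc → Loc)
    (p : Pos) (c : Cell) (up dn : Fin 3 → Word) : Cell where
  loc := if p.sum + 2 ≤ τ ∧ τ < p.sum + 2 + S then con (τ - (p.sum + 2)) c.right c.loc else c.loc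
  left a := if τ + p a = p.sum then load a c.loc else up a
  right a := if p a = 0 then c.left a else dn a

/-- The word that comes from the next higher cell. -/
def upWord (S : ℕ) (σ : Pos → Cell) (p : Pos) (a : Fin 3) : Word :=
  if p a + 1 < S then (σ (Function.update p a (p a + 1))).left a else Word.blank

/-- The word that comes from the next lower cell. -/
def downWord (σ : Pos → Cell) (p : Pos) (a : Fin 3) : Word :=
  if 0 < p a then (σ (Function.update p a (p a - 1))).right a else Word.blank

/-- The `τ`-th step of a sweep. -/
def sweepStep (S τ : ℕ) (load : Fin 3 → Loc → Word)
    (con : Pos → ℕ → (Fin 3 → Word) → Loc → Loc) (σ : Pos → Cell) (p : Pos) : Cell :=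
  sweepCell S τ load (con p) p (σ p) (upWord S σ p) (downWord σ p)

/-- Applying `f 0`, …, `f (k - 1)`, in this order. -/
def iter {β : Type*} (f : ℕ → β → β) : ℕ → β → β
  | 0, l => l
  | k + 1, l => f k (iter f k l)

section Sweep

variable {S : ℕ} {load : Fin 3 → Loc → Word} {con : Pos → ℕ → (Fin 3 → Word) → Loc → Loc}
  {σ : ℕ → Pos → Cell}

/-- A cell first consumes at step `p.sum + 2`, after it has loaded all its streams. Hence the words
that circulate are those from the start of the sweep, although cells change their memories during
it. -/
theorem sweep_loc_start
    (h : ∀ τ < 4 * S, ∀ p, (∀ a, p a < S) → σ (τ + 1) p = sweepStep S τ load con (σ τ) p)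
    {p : Pos} (hp : ∀ a, p a < S) (τ : ℕ) (hτ : τ ≤ p.sum + 2) (hτ' : τ ≤ 4 * S) :
    (σ τ p).loc = (σ 0 p).loc := by
  induction τ with
  | zero => rfl
  | succ τ ih =>
    rw [h τ (by omega) p hp, ← ih (by omega) (by omega)]
    simp only [sweepStep, sweepCell]
    rw [if_neg (by omega)]

/-- The cells of a line along `a` agree in `p.sum - p a`, so they load at the same step; from then
on the stream moves by one cell per step. -/
theorem sweep_left
    (h : ∀ τ < 4 * S, ∀ p, (∀ a, p a < S) → σ (τ + 1) p = sweepStep S τ load con (σ τ) p)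
    (a : Fin 3) (d : ℕ) {p : Pos} (hp : ∀ a, p a < S) (hd : p a + d < S) (τ : ℕ)
    (hτ : τ + p a = p.sum + d + 1) (hτ' : τ ≤ 4 * S) :
    (σ τ p).left a = load a (σ 0 (Function.update p a (p a + d))).loc := by
  induction d generalizing p τ with
  | zero =>
    have := Pos.le_sum p a
    obtain ⟨τ, rfl⟩ : ∃ t, τ = t + 1 := ⟨τ - 1, by omega⟩
    rw [h τ (by omega) p hp]
    simp only [sweepStep, sweepCell, add_zero, Function.update_eq_self]
    rw [if_pos (by omega), sweep_loc_start h hp τ (by omega) (by omega)]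
  | succ d ih =>
    have := Pos.le_sum p a
    obtain ⟨τ, rfl⟩ : ∃ t, τ = t + 1 := ⟨τ - 1, by omega⟩
    rw [h τ (by omega) p hp]
    simp only [sweepStep, sweepCell, upWord]
    have hs := Pos.sum_update p a (p a + 1)
    rw [if_neg (by omega), if_pos (by omega), ih (p := Function.update p a (p a + 1))]
    · simp only [Function.update_self, Function.update_idem]
      congr 4
      omega
    · intro b
      by_cases hb : b = a
      · subst hb; simp; omega
      · simpa [hb] using hp b
    · simp; omega
    · simp; omega
    · omega

/-- Starting at `p.sum - p a`, a word takes one step to be loaded, `k` to reach coordinate `0`, one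
to be reflected and `p a` to return. The total `p.sum + 2 + k` does not depend on the axis, so the
three streams deliver the index `k` together. -/
theorem sweep_right
    (h : ∀ τ < 4 * S, ∀ p, (∀ a, p a < S) → σ (τ + 1) p = sweepStep S τ load con (σ τ) p)
    (a : Fin 3) (k : ℕ) (hk : k < S) {p : Pos} (hp : ∀ a, p a < S) (τ : ℕ)
    (hτ : τ = p.sum + 2 + k) (hτ' : τ ≤ 4 * S) :
    (σ τ p).right a = load a (σ 0 (Function.update p a k)).loc := by
  obtain ⟨c, hc⟩ : ∃ c, p a = c := ⟨_, rfl⟩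
  induction c generalizing p τ with
  | zero =>
    obtain ⟨τ, rfl⟩ : ∃ t, τ = t + 1 := ⟨τ - 1, by omega⟩
    rw [h τ (by omega) p hp]
    simp only [sweepStep, sweepCell, hc, if_true]
    rw [sweep_left h a k hp (by omega) τ (by omega) (by omega), hc, zero_add]
  | succ c ih =>
    obtain ⟨τ, rfl⟩ : ∃ t, τ = t + 1 := ⟨τ - 1, by omega⟩
    rw [h τ (by omega) p hp]
    have hs := Pos.sum_update p a (p a - 1)
    have := Pos.le_sum p a
    simp only [sweepStep, sweepCell, downWord]
    rw [if_neg (by omega), if_pos (by omega), ih (p := Function.update p a (p a - 1))]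
    · simp
    · intro b
      by_cases hb : b = a
      · subst hb; simp; have := hp b; omega
      · simpa [hb] using hp b
    · omega
    · omega
    · simp; omega

/-- After `4 * S` steps each cell has consumed, in order, the words on the three lines through
it. -/
theorem sweep_loc
    (h : ∀ τ < 4 * S, ∀ p, (∀ a, p a < S) → σ (τ + 1) p = sweepStep S τ load con (σ τ) p)
    {p : Pos} (hp : ∀ a, p a < S) :
    (σ (4 * S) p).loc =
      iter (fun k => con p k fun a => load a (σ 0 (Function.update p a k)).loc) S (σ 0 p).loc := by
  have h0 := hp 0
  have h1 := hp 1
  have h2 := hp 2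
  -- The last word is consumed in step `p.sum + 1 + S`, which is why `4 * S` steps suffice.
  have hsum : p.sum + 3 ≤ 3 * S := by simp only [Pos.sum]; omega
  have key : ∀ k ≤ S, (σ (p.sum + 2 + k) p).loc =
      iter (fun k => con p k fun a => load a (σ 0 (Function.update p a k)).loc) k (σ 0 p).loc := by
    intro k
    induction k with
    | zero => intro _; exact sweep_loc_start h hp _ le_rfl (by omega)
    | succ k ih =>
      intro hk
      rw [← add_assoc, h _ (by omega) p hp]
      simp only [sweepStep, sweepCell, iter]
      rw [if_pos (by omega), ih (by omega)]
      congr 1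
      · omega
      · funext a
        exact sweep_right h a k (by omega) hp _ rfl (by omega)
  have tail : ∀ d, p.sum + 2 + S + d ≤ 4 * S →
      (σ (p.sum + 2 + S + d) p).loc = (σ (p.sum + 2 + S) p).loc := by
    intro d
    induction d with
    | zero => intro _; rfl
    | succ d ih =>
      intro hd
      rw [← add_assoc, h _ (by omega) p hp, ← ih (by omega)]
      simp only [sweepStep, sweepCell]
      rw [if_neg (by omega)]
  have := tail (4 * S - (p.sum + 2 + S)) (by omega)
  rw [show p.sum + 2 + S + (4 * S - (p.sum + 2 + S)) = 4 * S by omega] at this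
  rw [this, key S le_rfl]

end Sweep

/-- If only the step `c` changes the state, then so does the whole iteration. -/
theorem iter_single {β : Type*} {f : ℕ → β → β} (c : ℕ) (h : ∀ k l, k ≠ c → f k l = l) (S : ℕ)
    (l : β) : iter f S l = if c < S then f c l else l := by
  induction S with
  | zero => simp [iter]
  | succ S ih =>
    simp only [iter, ih]
    rcases lt_trichotomy c S with hc | hc | hc
    · rw [if_pos hc, if_pos (by omega), h _ _ (by omega)]
    · subst hc; simp
    · rw [if_neg (by omega), if_neg (by omega), h _ _ (by omega)]

theorem iter_induction {β : Type*} {f : ℕ → β → β} {C : ℕ → β → Prop} {S : ℕ} {l : β} (h0 : C 0 l)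
    (h : ∀ k < S, ∀ l, C k l → C (k + 1) (f k l)) : C S (iter f S l) := by
  induction S with
  | zero => exact h0
  | succ S ih => exact h S (by omega) _ (ih fun k hk => h k (by omega))

end


noncomputable section

theorem mul_add_div_of_lt {a b c : ℕ} (hc : c < b) : (a * b + c) / b = a := by
  rw [mul_comm, Nat.mul_add_div (by omega), Nat.div_eq_of_lt hc, add_zero]

/-! ### The layout of the matrices and the routes between input and home positions -/

/-- The parameters on which the layout depends: the order `n` of the matrix, the side `s` of the
mesh, and the side `m` of the subcube that holds the input. -/
structure Geo : Type where
  n : ℕ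
  s : ℕ
  m : ℕ

namespace Geo

variable (G : Geo)

/-- The number of residue classes into which rows and columns are divided. -/
def u : ℕ := (G.n + G.s - 1) / G.s

/-- The least multiple of `u` that is at least `m`. -/
def M : ℕ := G.u * ((G.m + G.u - 1) / G.u)

/-- The number of layers used for each residue class of rows while routing. -/
def H : ℕ := (G.n + G.M - 1) / G.M + G.u

/-- The number of block products that are computed simultaneously for each block. -/
def width : ℕ := 8 * G.s / (G.u * G.u)

/-- The number of multiplication rounds of a matrix product. -/
def E : ℕ := (G.u + G.width - 1) / G.width

/-- The number of sweeps of a matrix product. -/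
def period : ℕ := 2 * G.E + 1

/-- The first plane of the input that contains a row `i` with `i / u = x`. -/
def lo (x : ℕ) : ℕ := x * G.u * G.n / (G.m * G.m)

/-- The position of the entry `(i, j)` before the stage `st` of the routing, along axis `0`. -/
def coord0 (st i j : ℕ) : ℕ := if st < 2 then 8 * ((i * G.n + j) / (G.m * G.m)) else i / G.u

/-- The position of the entry `(i, j)` before the stage `st` of the routing, along axis `1`. -/
def coord1 (st i j : ℕ) : ℕ :=
  if st < 3 then 8 * ((i * G.n + j) / G.m % G.m)
  else if st < 5 then i % G.u * G.H + (j / G.M + j % G.u)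
  else i % G.u * G.u + j % G.u

/-- The position of the entry `(i, j)` before the stage `st` of the routing, along axis `2`. -/
def coord2 (st i j : ℕ) : ℕ :=
  if st < 1 then 8 * ((i * G.n + j) % G.m) else if st < 4 then j % G.M else j / G.u

/-- The position of the entry `(i, j)` before the stage `st` of the routing. -/
def pos (st i j : ℕ) : Pos := ![G.coord0 st i j, G.coord1 st i j, G.coord2 st i j]

/-- The axis of the moves in the stage `st` of the routing. -/
def axis (st : ℕ) : ℕ := if st = 0 then 2 else if st = 1 then 0 else if st = 3 then 2 else 1

/-- One coordinate of `pos`. -/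
def coord (st i j a : ℕ) : ℕ :=
  if a = 0 then G.coord0 st i j else if a = 1 then G.coord1 st i j else G.coord2 st i j

/-- Up to six entries pass through a position; this tells them apart. -/
def slot (i j : ℕ) : ℕ :=
  2 * ((i * G.n + j) / (G.m * G.m) - G.lo (i / G.u)) +
    (i - (i * G.n + j) / G.m * G.m / G.n)

/-- The line of the input that is met at a position, for the stages `0`, `1` and `2`. -/
def line (st κ : ℕ) (p : Pos) : ℕ :=
  (if st < 2 then p 0 / 8 else G.lo (p 0) + κ / 2) * G.m + p 1 / 8

/-- The row index of the entry with slot `κ` at a position. -/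
def decI (st κ : ℕ) (p : Pos) : ℕ :=
  if st < 1 then (G.line st κ p * G.m + p 2 / 8) / G.n
  else if st < 3 then G.line st κ p * G.m / G.n + κ % 2
  else if st < 5 then p 0 * G.u + p 1 / G.H
  else p 0 * G.u + p 1 / G.u

/-- The column index of the entry with slot `κ` at a position. -/
def decJ (st κ : ℕ) (p : Pos) : ℕ :=
  if st < 1 then (G.line st κ p * G.m + p 2 / 8) % G.n
  else if st < 3 then
    G.line st κ p * G.m + (p 2 + G.decI st κ p * G.n + (G.M - 1) * (G.line st κ p * G.m)) % G.M
      - G.decI st κ p * G.n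
  else if st < 4 then (p 1 % G.H - p 2 % G.u) * G.M + p 2
  else if st < 5 then p 2 * G.u + (p 1 % G.H - p 2 / (G.M / G.u))
  else p 2 * G.u + p 1 % G.u

/-- What the layout requires of the parameters. -/
structure Valid : Prop where
  one_le : 1 ≤ G.n
  sq_le : G.n * G.n ≤ G.m * G.m * G.m
  le_n : G.m ≤ G.n
  le_s : G.m ≤ G.s

variable {G}

/-! ### Inequalities between the parameters of the layout -/

namespace Valid

theorem m_pos (h : G.Valid) : 1 ≤ G.m := by
  by_contra hm
  have h0 : G.m = 0 := by omega
  have := h.sq_le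
  have := h.one_le
  rw [h0] at *
  nlinarith

theorem s_pos (h : G.Valid) : 1 ≤ G.s := h.m_pos.trans h.le_s

/-- Otherwise m⁴ < n² ≤ m³. -/
theorem n_le (h : G.Valid) : G.n ≤ G.m * G.m := by
  have h1 := h.sq_le
  have h2 := h.m_pos
  by_contra hc
  push Not at hc
  have : G.m * G.m * (G.m * G.m) < G.n * G.n := Nat.mul_lt_mul_of_lt_of_lt hc hc
  nlinarith [Nat.mul_le_mul_left (G.m * G.m * G.m) h2]

theorem n_le_u (h : G.Valid) : G.n ≤ G.u * G.s := by
  have hs := h.s_pos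
  have := Nat.div_add_mod (G.n + G.s - 1) G.s
  have h2 := Nat.mod_lt (G.n + G.s - 1) hs
  rw [u, mul_comm]
  omega

theorem u_lt (h : G.Valid) : G.u * G.s < G.n + G.s := by
  have := Nat.div_mul_le_self (G.n + G.s - 1) G.s
  have := h.s_pos
  have := h.one_le
  rw [u]
  omega

theorem u_pos (h : G.Valid) : 1 ≤ G.u := by
  have := h.n_le_u
  have := h.one_le
  by_contra hc
  have : G.u = 0 := by omega
  simp_all

theorem m_le_M (h : G.Valid) : G.m ≤ G.M := by
  have hs := h.u_pos
  have := Nat.div_add_mod (G.m + G.u - 1) G.u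
  have h2 := Nat.mod_lt (G.m + G.u - 1) hs
  rw [M]
  omega

theorem M_lt (h : G.Valid) : G.M < G.m + G.u := by
  have := Nat.mul_div_le (G.m + G.u - 1) G.u
  have := h.u_pos
  rw [M]
  omega

theorem M_pos (h : G.Valid) : 1 ≤ G.M := h.m_pos.trans h.m_le_M

theorem u_dvd_M : G.u ∣ G.M := Dvd.intro _ rfl

theorem M_div_mul : G.M / G.u * G.u = G.M := Nat.div_mul_cancel u_dvd_M

/-- If u > m, then (m + 1)s ≤ us < n + s ≤ m² + s, against m ≤ s. -/
theorem u_le_m (h : G.Valid) : G.u ≤ G.m := by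
  have h1 := h.u_lt
  have h2 := h.n_le
  have h3 := h.le_s
  by_contra hc
  have : (G.m + 1) * G.s ≤ G.u * G.s := Nat.mul_le_mul_right _ (by omega)
  nlinarith

theorem M_le (h : G.Valid) : G.M ≤ 2 * G.s := by
  have := h.M_lt
  have := h.u_le_m
  have := h.le_s
  omega

/-- The entries of u consecutive rows fill at most two planes of the input, so they meet at most
three; this bounds the number of slots. -/
theorem u_mul_n_le (h : G.Valid) : G.u * G.n ≤ 2 * (G.m * G.m) := by
  have h1 := h.u_lt
  have h2 := h.n_le
  have h3 := h.le_s
  have h4 := h.sq_le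
  have h5 := h.s_pos
  have h6 : G.u * G.n * G.s ≤ 2 * (G.m * G.m) * G.s := by
    calc G.u * G.n * G.s = G.u * G.s * G.n := by ring
      _ ≤ (G.n + G.s) * G.n := Nat.mul_le_mul_right _ h1.le
      _ = G.n * G.n + G.s * G.n := by ring
      _ ≤ G.m * G.m * G.s + G.s * (G.m * G.m) :=
        Nat.add_le_add (h4.trans (Nat.mul_le_mul_left _ h3)) (Nat.mul_le_mul_left _ h2)
      _ = _ := by ring
  exact Nat.le_of_mul_le_mul_right h6 h5

theorem n_le_h (h : G.Valid) : G.n ≤ (G.H - G.u) * G.M := by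
  have hs := h.M_pos
  have := Nat.div_add_mod (G.n + G.M - 1) G.M
  have h2 := Nat.mod_lt (G.n + G.M - 1) hs
  rw [H, Nat.add_sub_cancel, mul_comm]
  omega

/-- Here (u - 1)m ≤ (u - 1)s < n, and the remaining m is at most n. -/
theorem u_mul_m_le (h : G.Valid) : G.u * G.m ≤ 2 * G.n := by
  have h1 := h.u_lt
  have h2 := h.le_s
  have h3 := h.le_n
  have h4 := h.u_pos
  obtain ⟨d, hd⟩ := Nat.exists_eq_add_of_le h4
  obtain ⟨t, ht⟩ := Nat.exists_eq_add_of_le h2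
  rw [hd, ht] at h1
  rw [hd]
  nlinarith [Nat.zero_le (d * t)]

theorem h_mul_m_le (h : G.Valid) : (G.H - G.u) * G.m ≤ 2 * G.n := by
  have h1 := Nat.div_mul_le_self (G.n + G.M - 1) G.M
  have h2 := h.m_le_M
  have h3 := h.le_n
  have h4 := h.one_le
  have h5 : G.H - G.u = (G.n + G.M - 1) / G.M := by rw [H, Nat.add_sub_cancel]
  rw [← h5] at h1
  have h6 := h.M_pos
  rcases Nat.eq_zero_or_pos (G.H - G.u) with h0 | h0
  · rw [h0]; omega
  · obtain ⟨d, hd⟩ := Nat.exists_eq_add_of_le h0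
    obtain ⟨t, ht⟩ := Nat.exists_eq_add_of_le h2
    rw [hd] at h1 ⊢
    have h7 : (1 + d) * G.M ≤ G.n + G.M := h1.trans (Nat.sub_le _ _)
    rw [ht] at h7
    nlinarith [Nat.zero_le (d * t)]

/-- This is where the factor 8 between the cells and the processors comes from: um ≤ 2n and Hm ≤ 4n
give uHm² ≤ 8n² ≤ 8m³. -/
theorem u_mul_H_le (h : G.Valid) : G.u * G.H ≤ 8 * G.s := by
  have h1 := h.u_mul_m_le
  have h2 := h.h_mul_m_le
  have h3 := h.sq_le
  have h4 := h.m_pos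
  have h5 : G.H * G.m ≤ 4 * G.n := by
    have : G.H = (G.H - G.u) + G.u := by rw [H, Nat.add_sub_cancel]
    rw [this, add_mul]
    omega
  have h6 : G.u * G.H * (G.m * G.m) ≤ 8 * G.m * (G.m * G.m) := by
    calc G.u * G.H * (G.m * G.m) = (G.u * G.m) * (G.H * G.m) := by ring
      _ ≤ (2 * G.n) * (4 * G.n) := Nat.mul_le_mul h1 h5
      _ = 8 * (G.n * G.n) := by ring
      _ ≤ 8 * (G.m * G.m * G.m) := Nat.mul_le_mul_left _ h3
      _ = _ := by ring
  have := Nat.le_of_mul_le_mul_right h6 (Nat.mul_pos h4 h4)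
  have := h.le_s
  omega

/-- The u² home layers fit at least twice into the side 8s. -/
theorem u_sq_le (h : G.Valid) : G.u * G.u ≤ 4 * G.s := by
  have h1 := h.u_mul_m_le
  have h3 := h.sq_le
  have h4 := h.m_pos
  have h6 : G.u * G.u * (G.m * G.m) ≤ 4 * G.m * (G.m * G.m) := by
    calc G.u * G.u * (G.m * G.m) = (G.u * G.m) * (G.u * G.m) := by ring
      _ ≤ (2 * G.n) * (2 * G.n) := Nat.mul_le_mul h1 h1
      _ = 4 * (G.n * G.n) := by ring
      _ ≤ 4 * (G.m * G.m * G.m) := Nat.mul_le_mul_left _ h3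
      _ = _ := by ring
  have := Nat.le_of_mul_le_mul_right h6 (Nat.mul_pos h4 h4)
  have := h.le_s
  omega

theorem two_le_width (h : G.Valid) : 2 ≤ G.width := by
  have h1 := h.u_sq_le
  have h2 := h.u_pos
  rw [width, Nat.le_div_iff_mul_le (Nat.mul_pos h2 h2)]
  omega

theorem u_le_E_mul (h : G.Valid) : G.u ≤ G.E * G.width := by
  have hs := h.two_le_width
  have := Nat.div_add_mod (G.u + G.width - 1) G.width
  have h2 := Nat.mod_lt (G.u + G.width - 1) (show 0 < G.width by omega)
  rw [E, mul_comm]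
  omega

/-! ### Routes stay within the cube of cells and use six slots -/

theorem div_u_lt (h : G.Valid) {i : ℕ} (hi : i < G.n) : i / G.u < G.s := by
  rw [Nat.div_lt_iff_lt_mul h.u_pos, mul_comm]
  exact hi.trans_le h.n_le_u

theorem q_lt (h : G.Valid) {i j : ℕ} (hi : i < G.n) (hj : j < G.n) :
    i * G.n + j < G.m * G.m * G.m := by
  have h1 := h.sq_le
  have : (i + 1) * G.n ≤ G.n * G.n := Nat.mul_le_mul_right _ hi
  nlinarith

theorem coord0_lt (h : G.Valid) (st : ℕ) {i j : ℕ} (hi : i < G.n) (hj : j < G.n) :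
    G.coord0 st i j < 8 * G.s := by
  have h1 := h.le_s
  have h2 := h.m_pos
  have h3 := h.div_u_lt hi
  have : (i * G.n + j) / (G.m * G.m) < G.m := by
    rw [Nat.div_lt_iff_lt_mul (Nat.mul_pos h2 h2)]
    have := h.q_lt hi hj
    nlinarith
  rw [coord0]
  split_ifs <;> omega

theorem layer_lt {I c d : ℕ} (hI : I < G.u) (hc : c < d) (hd : G.u * d ≤ 8 * G.s) :
    I * d + c < 8 * G.s := by
  have : (I + 1) * d ≤ G.u * d := Nat.mul_le_mul_right _ hI
  nlinarith

theorem row_lt (h : G.Valid) {j : ℕ} (hj : j < G.n) : j / G.M + j % G.u < G.H := by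
  have h1 : j / G.M < G.H - G.u := by
    rw [Nat.div_lt_iff_lt_mul h.M_pos]
    exact hj.trans_le h.n_le_h
  have h2 := Nat.mod_lt j h.u_pos
  generalize j / G.M = x at *
  omega

theorem coord1_lt (h : G.Valid) (st : ℕ) {i j : ℕ} (hj : j < G.n) :
    G.coord1 st i j < 8 * G.s := by
  have h1 := h.le_s
  have h2 := h.m_pos
  have h3 : (i * G.n + j) / G.m % G.m < G.m := Nat.mod_lt _ h2
  have h4 := h.u_pos
  have h5 := Nat.mod_lt i h4
  have h6 := Nat.mod_lt j h4
  rw [coord1]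
  split_ifs
  · omega
  · exact layer_lt h5 (h.row_lt hj) h.u_mul_H_le
  · exact layer_lt h5 h6 (by have := h.u_sq_le; omega)

theorem coord2_lt (h : G.Valid) (st : ℕ) {i j : ℕ} (hj : j < G.n) :
    G.coord2 st i j < 8 * G.s := by
  have h1 := h.le_s
  have h2 := h.m_pos
  have h3 := h.div_u_lt hj
  have h4 := h.M_le
  have h5 : (i * G.n + j) % G.m < G.m := Nat.mod_lt _ h2
  have h6 := Nat.mod_lt j h.M_pos
  rw [coord2]
  split_ifs <;> omega

theorem pos_lt (h : G.Valid) (st : ℕ) {i j : ℕ} (hi : i < G.n) (hj : j < G.n) (a : Fin 3) :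
    G.pos st i j a < 8 * G.s := by
  fin_cases a
  · exact h.coord0_lt st hi hj
  · exact h.coord1_lt st hj
  · exact h.coord2_lt st hj

/-- A line of the input has m ≤ n consecutive entries and meets at most two rows of the matrix. -/
theorem slot_snd (h : G.Valid) {i j : ℕ} (hj : j < G.n) :
    (i * G.n + j) / G.m * G.m / G.n ≤ i ∧ i ≤ (i * G.n + j) / G.m * G.m / G.n + 1 := by
  have h1 := Nat.div_mul_le_self (i * G.n + j) G.m
  have h2 := Nat.lt_div_mul_add (a := i * G.n + j) h.m_pos
  have h3 := h.le_n
  have h4 := h.one_le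
  generalize (i * G.n + j) / G.m * G.m = x at *
  constructor
  · rw [← Nat.lt_succ_iff, Nat.div_lt_iff_lt_mul h4, Nat.succ_mul]
    omega
  · rcases Nat.eq_zero_or_pos i with h0 | h0
    · rw [h0]
      exact Nat.zero_le _
    · obtain ⟨i, rfl⟩ : ∃ k, i = k + 1 := ⟨i - 1, by omega⟩
      rw [Nat.add_le_add_iff_right, Nat.le_div_iff_mul_le h4]
      rw [add_mul] at h2
      omega

/-- The rows with a given quotient by u occupy at most three planes. With two rows per line this
makes six slots. -/
theorem slot_fst (h : G.Valid) {i j : ℕ} (hj : j < G.n) :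
    G.lo (i / G.u) ≤ (i * G.n + j) / (G.m * G.m) ∧
      (i * G.n + j) / (G.m * G.m) ≤ G.lo (i / G.u) + 2 := by
  have hm := h.m_pos
  have hmm : 0 < G.m * G.m := Nat.mul_pos hm hm
  have h1 := Nat.div_mul_le_self i G.u
  have h2 := Nat.lt_div_mul_add (a := i) h.u_pos
  have h3 := h.u_mul_n_le
  constructor
  · refine Nat.div_le_div_right ?_
    calc i / G.u * G.u * G.n ≤ i * G.n := Nat.mul_le_mul_right _ h1
      _ ≤ _ := Nat.le_add_right _ _
  · rw [← Nat.lt_succ_iff, Nat.div_lt_iff_lt_mul hmm]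
    have h4 := Nat.lt_div_mul_add (a := i / G.u * G.u * G.n) hmm
    have h5 : (i + 1) * G.n ≤ (i / G.u * G.u + G.u) * G.n := Nat.mul_le_mul_right _ h2
    rw [lo]
    nlinarith

theorem slot_lt (h : G.Valid) {i j : ℕ} (hj : j < G.n) : G.slot i j < 6 := by
  have h1 := h.slot_fst (i := i) hj
  have h2 := h.slot_snd (i := i) hj
  rw [slot]
  omega

/-! ### Recovering an entry from its position and slot -/

theorem line_mul_add {i j : ℕ} :
    (i * G.n + j) / (G.m * G.m) * G.m + (i * G.n + j) / G.m % G.m = (i * G.n + j) / G.m := by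
  rw [← Nat.div_div_eq_div_mul]
  exact Nat.div_add_mod' _ _

theorem line_pos (h : G.Valid) {st i j : ℕ} (hj : j < G.n) (hst : st < 3) :
    G.line st (G.slot i j) (G.pos st i j) = (i * G.n + j) / G.m := by
  have h1 := h.slot_fst (i := i) hj
  have h2 := h.slot_snd (i := i) hj
  rw [← line_mul_add, line, pos]
  simp only [coord0, coord1, hst, if_true, Matrix.cons_val_zero, Matrix.cons_val_one]
  rw [Nat.mul_div_cancel_left _ (by norm_num)]
  congr 2
  split_ifs
  · omega
  · rw [slot]
    omega

/-- Together with `decJ_pos` this says that entries with the same slot never meet on their routes,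
and that a cell can compute which entry it should hold. Up to stage 2 the slot selects the row among
the two on a line, and after stage 0 is over and the plane is lost it also selects the plane; later
the position suffices. -/
theorem decI_pos (h : G.Valid) {st i j : ℕ} (hj : j < G.n) :
    G.decI st (G.slot i j) (G.pos st i j) = i := by
  have h2 := h.slot_snd (i := i) hj
  have hu := h.u_pos
  rw [decI]
  split_ifs with h0 h3 h5
  · rw [h.line_pos hj (by omega)]
    simp only [pos, coord2, h0, if_true, Matrix.cons_val]
    rw [Nat.mul_div_cancel_left _ (by norm_num), Nat.div_add_mod', mul_add_div_of_lt hj]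
  · rw [h.line_pos hj h3, slot]
    omega
  · simp only [pos, coord0, coord1, Matrix.cons_val_zero, Matrix.cons_val_one]
    rw [if_neg (by omega), if_neg h3, if_pos h5, mul_add_div_of_lt (h.row_lt hj),
      Nat.div_add_mod']
  · simp only [pos, coord0, coord1, Matrix.cons_val_zero, Matrix.cons_val_one]
    rw [if_neg (by omega), if_neg h3, if_neg h5, mul_add_div_of_lt (Nat.mod_lt j hu),
      Nat.div_add_mod']

/-- The offset `r` of an entry on its line is `N + j - L`, and it is known modulo `M`. Adding `(M -
1) * L` replaces the subtraction of `L`, which would be truncated. -/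
theorem mod_shift {M L N P j r : ℕ} (hM : 1 ≤ M) (hP : P = j % M) (hr : r < M)
    (e : L + r = N + j) : (P + N + (M - 1) * L) % M = r := by
  subst hP
  have h1 : (j % M + N + (M - 1) * L) % M = (j + N + (M - 1) * L) % M := by
    rw [add_assoc, add_assoc, Nat.mod_add_mod]
  obtain ⟨K, rfl⟩ : ∃ K, M = K + 1 := ⟨M - 1, by omega⟩
  rw [h1, Nat.add_sub_cancel, show j + N + K * L = r + (K + 1) * L by linarith,
    Nat.add_mul_mod_self_left, Nat.mod_eq_of_lt hr]

/-- The intermediate layer `j / M + j % u` is chosen so that `j` can be read off on both sides of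
stage 3. Since u divides M, the coordinate `j % M` determines `j % u` and hence `j / M`; afterwards
the coordinate `j / u` determines `j / M` and hence `j % u`. -/
theorem decJ_pos (h : G.Valid) {st i j : ℕ} (hj : j < G.n) :
    G.decJ st (G.slot i j) (G.pos st i j) = j := by
  have hu := h.u_pos
  rw [decJ]
  split_ifs with h0 h3 h4 h5
  · rw [h.line_pos hj (by omega)]
    simp only [pos, coord2, h0, if_true, Matrix.cons_val]
    rw [Nat.mul_div_cancel_left _ (by norm_num), Nat.div_add_mod', Nat.mul_add_mod_self_right,
      Nat.mod_eq_of_lt hj]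
  · rw [h.line_pos hj h3, h.decI_pos hj]
    simp only [pos, coord2, Matrix.cons_val]
    rw [if_neg h0, if_pos (by omega)]
    -- The at most m ≤ M entries of a line have distinct offsets modulo M, so `j % M` fixes the
    -- offset.
    have e := Nat.div_add_mod' (i * G.n + j) G.m
    rw [mod_shift h.M_pos rfl ((Nat.mod_lt (i * G.n + j) h.m_pos).trans_le h.m_le_M) e, e]
    omega
  · simp only [pos, coord1, coord2, Matrix.cons_val]
    rw [if_neg h0, if_pos h4, if_neg h3, if_pos (by omega), Nat.mul_add_mod_self_right,
      Nat.mod_eq_of_lt (h.row_lt hj), Nat.mod_mod_of_dvd _ u_dvd_M, Nat.add_sub_cancel,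
      Nat.div_add_mod']
  · simp only [pos, coord1, coord2, Matrix.cons_val]
    rw [if_neg h0, if_neg h4, if_neg h3, if_pos h5, Nat.mul_add_mod_self_right,
      Nat.mod_eq_of_lt (h.row_lt hj), Nat.div_div_eq_div_mul, mul_comm G.u (G.M / G.u),
      M_div_mul, Nat.add_sub_cancel_left, Nat.div_add_mod']
  · simp only [pos, coord1, coord2, Matrix.cons_val]
    rw [if_neg h0, if_neg h4, if_neg h3, if_neg h5, Nat.mul_add_mod_self_right, Nat.mod_mod,
      Nat.div_add_mod']

end Valid

theorem axis_lt (st : ℕ) : axis st < 3 := by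
  rw [axis]
  split_ifs <;> omega

/-- Consecutive positions on a route differ only along the axis of the stage. -/
theorem pos_succ {st : ℕ} (hst : st < 5) (i j : ℕ) :
    Function.update (G.pos (st + 1) i j) ⟨axis st, axis_lt st⟩ (G.coord st i j (axis st)) =
      G.pos st i j := by
  interval_cases st <;> funext a <;> fin_cases a <;>
    simp [axis, pos, coord, coord0, coord1, coord2, Function.update]

/-- The output takes the same routes backwards. -/
theorem pos_pred {st : ℕ} (hst : st < 5) (i j : ℕ) :
    Function.update (G.pos st i j) ⟨axis st, axis_lt st⟩ (G.coord (st + 1) i j (axis st)) =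
      G.pos (st + 1) i j := by
  interval_cases st <;> funext a <;> fin_cases a <;>
    simp [axis, pos, coord, coord0, coord1, coord2, Function.update]

theorem coord_eq_pos (st i j : ℕ) {a : ℕ} (ha : a < 3) :
    G.coord st i j a = G.pos st i j ⟨a, ha⟩ := by
  interval_cases a <;> rfl

end Geo

end


noncomputable section

/-! ### The computation of a cell -/

/-- The operations that distinguish the path problems: how the values of consecutive paths are
combined, whether large values are preferred, the values of missing edges and of empty paths, and
whether the input is an adjacency matrix. -/
structure PathAlg : Type where
  mul : WtOp
  rev : Bool
  bad : WtConst
  unit : WtConst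
  adj : Bool

namespace PathAlg

variable (A : PathAlg)

/-- The value `x` is preferred to `y`. -/
def Better (x y : EReal) : Prop := if A.rev then y < x else x < y

/-- The matrix entry at the beginning of the computation, made from an entry of the input. -/
def conv (i j : ℕ) (x : Word) : Word :=
  open Classical in
  if i = j then ⟨A.unit.eval, 0⟩ else if A.adj ∧ x.w ≤ 0 then ⟨A.bad.eval, 0⟩ else x

end PathAlg

/-- The word of the stream along axis `a`. -/
def pick (a : ℕ) (src : Fin 3 → Word) : Word :=
  if a = 0 then src 0 else if a = 1 then src 1 else src 2

section Consume

variable (A : PathAlg) (G : Geo)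

/-- Consuming a word while the input is moved home. -/
def inCon (κ st : ℕ) (p : Pos) (k : ℕ) (src : Fin 3 → Word) (l : Loc) : Loc :=
  if k = G.coord st (G.decI (st + 1) κ p) (G.decJ (st + 1) κ p) (Geo.axis st) then
    if st < 4 then { l with v := pick (Geo.axis st) src }
    else if G.slot (G.decI (st + 1) κ p) (G.decJ (st + 1) κ p) = κ then
      { l with
        d := A.conv (G.decI (st + 1) κ p) (G.decJ (st + 1) κ p) (pick (Geo.axis st) src) }
    else l
  else l

/-- Consuming a word while the output is moved back. -/
def outCon (κ st : ℕ) (p : Pos) (k : ℕ) (src : Fin 3 → Word) (l : Loc) : Loc :=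
  if k = G.coord (st + 1) (G.decI st κ p) (G.decJ st κ p) (Geo.axis st) then
    if 0 < st then { l with v := pick (Geo.axis st) src }
    else if G.slot (G.decI st κ p) (G.decJ st κ p) = κ then { l with x := pick (Geo.axis st) src }
    else l
  else l

/-- The residue class of the intermediate vertices that a layer treats in the round `e`. -/
def midClass (e : ℕ) (p : Pos) : ℕ := e * G.width + p 1 / (G.u * G.u)

/-- Consuming a word while the factors of the block products are brought into position. -/
def fetchCon (e : ℕ) (p : Pos) (k : ℕ) (src : Fin 3 → Word) (l : Loc) : Loc :=
  open Classical in
  { l with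
    a := if k = p 1 % (G.u * G.u) / G.u * G.u + midClass G e p then src 1 else l.a
    b := if k = midClass G e p * G.u + p 1 % G.u then src 1 else l.b
    c := if e = 0 then ⟨A.bad.eval, 0⟩ else l.c }

/-- Consuming a word while the block products are computed. -/
def mulCon (e : ℕ) (p : Pos) (k : ℕ) (src : Fin 3 → Word) (l : Loc) : Loc :=
  open Classical in
  if midClass G e p < G.u ∧ k * G.u + midClass G e p < G.n ∧
      A.Better (A.mul.eval (src 2).w (src 0).w) l.c.w then
    { l with c := ⟨A.mul.eval (src 2).w (src 0).w, k * G.u + midClass G e p + 1⟩ }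
  else l

/-- Consuming a word while the block products are combined. -/
def reduceCon (p : Pos) (k : ℕ) (src : Fin 3 → Word) (l : Loc) : Loc :=
  open Classical in
  if k % (G.u * G.u) = p 1 ∧ A.Better (src 1).w l.d.w then { l with d := src 1 } else l

/-- Consuming a word in the round `f` of a matrix product. -/
def prodCon (f : ℕ) (p : Pos) (k : ℕ) (src : Fin 3 → Word) (l : Loc) : Loc :=
  if f = 2 * G.E then reduceCon A G p k src l
  else if f % 2 = 0 then fetchCon A G (f / 2) p k src l
  else mulCon A G (f / 2) p k src l

/-- The words that are sent in the round `f` of a matrix product. -/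
def prodLoad (f : ℕ) (a : Fin 3) (l : Loc) : Word :=
  if f = 2 * G.E then l.c else if f % 2 = 0 then l.d else if a = 2 then l.a else l.b

/-- Consuming a word in the round `ρ`, if `q` matrix products are to be computed. -/
def roundCon (q ρ : ℕ) (inp : EReal) (p : Pos) (k : ℕ) (src : Fin 3 → Word) (l : Loc) : Loc :=
  if ρ = 0 then { l with x := ⟨inp, 0⟩ }
  else if ρ < 31 then inCon A G ((ρ - 1) / 5) ((ρ - 1) % 5) p k src l
  else if ρ < 31 + q * G.period then prodCon A G ((ρ - 31) % G.period) p k src l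
  else outCon G ((ρ - (31 + q * G.period)) / 5) (4 - (ρ - (31 + q * G.period)) % 5) p k src l

/-- The words that are sent in the round `ρ`, if `q` matrix products are to be computed. -/
def roundLoad (q ρ : ℕ) (a : Fin 3) (l : Loc) : Word :=
  if ρ < 31 then (if (ρ - 1) % 5 = 0 then l.x else l.v)
  else if ρ < 31 + q * G.period then prodLoad G ((ρ - 31) % G.period) a l
  else (if (ρ - (31 + q * G.period)) % 5 = 0 then l.d else l.v)

/-- The number of rounds. -/
def rounds (q : ℕ) : ℕ := 61 + q * G.period

/-- The new memory of a cell after the step `t`. -/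
def cellNext (q t : ℕ) (inp : EReal) (p : Pos) (c : Cell) (up dn : Fin 3 → Word) : Cell :=
  sweepCell (8 * G.s) (t % (32 * G.s)) (roundLoad G q (t / (32 * G.s)))
    (roundCon A G q (t / (32 * G.s)) inp p) p c up dn

end Consume

/-! ### The computation of a cell is given by expressions -/

section Expressible

variable {a b : ℕ}

/-- A word-valued function of the view that is given by expressions. -/
def IsWord (f : View a b → Word) : Prop := IsWt (fun v => (f v).w) ∧ IsNum (fun v => (f v).k)

/-- A function of the view with values in `Loc` that is given by expressions. -/
structure IsLoc (f : View a b → Loc) : Prop where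
  x : IsWord (fun v => (f v).x)
  v : IsWord (fun v => (f v).v)
  d : IsWord (fun v => (f v).d)
  a : IsWord (fun v => (f v).a)
  b : IsWord (fun v => (f v).b)
  c : IsWord (fun v => (f v).c)

theorem IsWord.mk' {f : View a b → EReal} {g : View a b → ℕ} (hf : IsWt f) (hg : IsNum g) :
    IsWord (fun v => ⟨f v, g v⟩) := ⟨hf, hg⟩

theorem IsWord.ite {p : View a b → Prop} [∀ v, Decidable (p v)] {f g : View a b → Word}
    (hp : IsCond p) (hf : IsWord f) (hg : IsWord g) :
    IsWord (fun v => if p v then f v else g v) := by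
  constructor
  · simp only [apply_ite Word.w]
    exact IsWt.ite hp hf.1 hg.1
  · simp only [apply_ite Word.k]
    exact IsNum.ite hp hf.2 hg.2

theorem IsLoc.ite {p : View a b → Prop} [∀ v, Decidable (p v)] {f g : View a b → Loc}
    (hp : IsCond p) (hf : IsLoc f) (hg : IsLoc g) :
    IsLoc (fun v => if p v then f v else g v) := by
  constructor
  · simp only [apply_ite Loc.x]
    exact IsWord.ite hp hf.x hg.x
  · simp only [apply_ite Loc.v]
    exact IsWord.ite hp hf.v hg.v
  · simp only [apply_ite Loc.d]
    exact IsWord.ite hp hf.d hg.d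
  · simp only [apply_ite Loc.a]
    exact IsWord.ite hp hf.a hg.a
  · simp only [apply_ite Loc.b]
    exact IsWord.ite hp hf.b hg.b
  · simp only [apply_ite Loc.c]
    exact IsWord.ite hp hf.c hg.c

/-- A function of the view with values in `Geo` that is given by expressions. -/
structure IsGeo (G : View a b → Geo) : Prop where
  n : IsNum (fun v => (G v).n)
  s : IsNum (fun v => (G v).s)
  m : IsNum (fun v => (G v).m)

/-- A function of the view with values in `Pos` that is given by expressions. -/
def IsPos (p : View a b → Pos) : Prop := ∀ i, IsNum (fun v => p v i)

namespace IsGeo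

variable {G : View a b → Geo} {i j st κ k e f : View a b → ℕ} {p : View a b → Pos}

theorem u (hG : IsGeo G) : IsNum (fun v => (G v).u) :=
  .div (.sub (.add hG.n hG.s) (.const 1)) hG.s

theorem M (hG : IsGeo G) : IsNum (fun v => (G v).M) :=
  .mul hG.u (.div (.sub (.add hG.m hG.u) (.const 1)) hG.u)

theorem H (hG : IsGeo G) : IsNum (fun v => (G v).H) :=
  .add (.div (.sub (.add hG.n hG.M) (.const 1)) hG.M) hG.u

theorem width (hG : IsGeo G) : IsNum (fun v => (G v).width) :=
  .div (.mul (.const 8) hG.s) (.mul hG.u hG.u)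

theorem E (hG : IsGeo G) : IsNum (fun v => (G v).E) :=
  .div (.sub (.add hG.u hG.width) (.const 1)) hG.width

theorem period (hG : IsGeo G) : IsNum (fun v => (G v).period) :=
  .add (.mul (.const 2) hG.E) (.const 1)

theorem lo (hG : IsGeo G) (hi : IsNum i) : IsNum (fun v => (G v).lo (i v)) :=
  .div (.mul (.mul hi hG.u) hG.n) (.mul hG.m hG.m)

theorem idx (hG : IsGeo G) (hi : IsNum i) (hj : IsNum j) :
    IsNum (fun v => i v * (G v).n + j v) := .add (.mul hi hG.n) hj

theorem coord0 (hG : IsGeo G) (hst : IsNum st) (hi : IsNum i) (hj : IsNum j) :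
    IsNum (fun v => (G v).coord0 (st v) (i v) (j v)) :=
  .ite (.lt hst (.const 2)) (.mul (.const 8) (.div (hG.idx hi hj) (.mul hG.m hG.m))) (.div hi hG.u)

theorem coord1 (hG : IsGeo G) (hst : IsNum st) (hi : IsNum i) (hj : IsNum j) :
    IsNum (fun v => (G v).coord1 (st v) (i v) (j v)) :=
  .ite (.lt hst (.const 3)) (.mul (.const 8) (.mod (.div (hG.idx hi hj) hG.m) hG.m))
    (.ite (.lt hst (.const 5))
      (.add (.mul (.mod hi hG.u) hG.H) (.add (.div hj hG.M) (.mod hj hG.u)))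
      (.add (.mul (.mod hi hG.u) hG.u) (.mod hj hG.u)))

theorem coord2 (hG : IsGeo G) (hst : IsNum st) (hi : IsNum i) (hj : IsNum j) :
    IsNum (fun v => (G v).coord2 (st v) (i v) (j v)) :=
  .ite (.lt hst (.const 1)) (.mul (.const 8) (.mod (hG.idx hi hj) hG.m))
    (.ite (.lt hst (.const 4)) (.mod hj hG.M) (.div hj hG.u))

theorem axis (hst : IsNum st) : IsNum (fun v => Geo.axis (st v)) :=
  .ite (.eq hst (.const 0)) (.const 2) (.ite (.eq hst (.const 1)) (.const 0)
    (.ite (.eq hst (.const 3)) (.const 2) (.const 1)))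

theorem coord (hG : IsGeo G) (hst : IsNum st) (hi : IsNum i) (hj : IsNum j) (hk : IsNum k) :
    IsNum (fun v => (G v).coord (st v) (i v) (j v) (k v)) :=
  .ite (.eq hk (.const 0)) (hG.coord0 hst hi hj)
    (.ite (.eq hk (.const 1)) (hG.coord1 hst hi hj) (hG.coord2 hst hi hj))

theorem slot (hG : IsGeo G) (hi : IsNum i) (hj : IsNum j) :
    IsNum (fun v => (G v).slot (i v) (j v)) :=
  .add (.mul (.const 2) (.sub (.div (hG.idx hi hj) (.mul hG.m hG.m)) (hG.lo (.div hi hG.u))))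
    (.sub hi (.div (.mul (.div (hG.idx hi hj) hG.m) hG.m) hG.n))

theorem line (hG : IsGeo G) (hst : IsNum st) (hκ : IsNum κ) (hp : IsPos p) :
    IsNum (fun v => (G v).line (st v) (κ v) (p v)) :=
  .add (.mul (.ite (.lt hst (.const 2)) (.div (hp 0) (.const 8))
    (.add (hG.lo (hp 0)) (.div hκ (.const 2)))) hG.m) (.div (hp 1) (.const 8))

theorem decI (hG : IsGeo G) (hst : IsNum st) (hκ : IsNum κ) (hp : IsPos p) :
    IsNum (fun v => (G v).decI (st v) (κ v) (p v)) :=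
  .ite (.lt hst (.const 1)) (.div (.add (.mul (hG.line hst hκ hp) hG.m)
      (.div (hp 2) (.const 8))) hG.n)
    (.ite (.lt hst (.const 3)) (.add (.div (.mul (hG.line hst hκ hp) hG.m) hG.n)
      (.mod hκ (.const 2)))
    (.ite (.lt hst (.const 5)) (.add (.mul (hp 0) hG.u) (.div (hp 1) hG.H))
      (.add (.mul (hp 0) hG.u) (.div (hp 1) hG.u))))

theorem decJ (hG : IsGeo G) (hst : IsNum st) (hκ : IsNum κ) (hp : IsPos p) :
    IsNum (fun v => (G v).decJ (st v) (κ v) (p v)) :=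
  .ite (.lt hst (.const 1)) (.mod (.add (.mul (hG.line hst hκ hp) hG.m)
      (.div (hp 2) (.const 8))) hG.n)
    (.ite (.lt hst (.const 3)) (.sub (.add (.mul (hG.line hst hκ hp) hG.m)
      (.mod (.add (.add (hp 2) (.mul (hG.decI hst hκ hp) hG.n))
        (.mul (.sub hG.M (.const 1)) (.mul (hG.line hst hκ hp) hG.m))) hG.M))
      (.mul (hG.decI hst hκ hp) hG.n))
    (.ite (.lt hst (.const 4))
      (.add (.mul (.sub (.mod (hp 1) hG.H) (.mod (hp 2) hG.u)) hG.M) (hp 2))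
    (.ite (.lt hst (.const 5)) (.add (.mul (hp 2) hG.u)
      (.sub (.mod (hp 1) hG.H) (.div (hp 2) (.div hG.M hG.u))))
      (.add (.mul (hp 2) hG.u) (.mod (hp 1) hG.u)))))

theorem midClass (hG : IsGeo G) (he : IsNum e) (hp : IsPos p) :
    IsNum (fun v => midClass (G v) (e v) (p v)) :=
  .add (.mul he hG.width) (.div (hp 1) (.mul hG.u hG.u))

theorem rounds (hG : IsGeo G) (hi : IsNum i) : IsNum (fun v => rounds (G v) (i v)) :=
  .add (.const 61) (.mul hi hG.period)

end IsGeo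

theorem IsWord.pick {k : View a b → ℕ} {src : View a b → Fin 3 → Word} (hk : IsNum k)
    (hs : ∀ i, IsWord (fun v => src v i)) : IsWord (fun v => pick (k v) (src v)) := by
  unfold _root_.pick
  exact .ite (.eq hk (.const 0)) (hs 0) (.ite (.eq hk (.const 1)) (hs 1) (hs 2))

theorem IsCond.better (A : PathAlg) {x y : View a b → EReal} (hx : IsWt x) (hy : IsWt y) :
    IsCond (fun v => A.Better (x v) (y v)) := by
  unfold PathAlg.Better
  cases A.rev
  · simpa using IsCond.wtLt hx hy
  · simpa using IsCond.wtLt hy hx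

theorem IsWord.conv (A : PathAlg) {i j : View a b → ℕ} {x : View a b → Word} (hi : IsNum i)
    (hj : IsNum j) (hx : IsWord x) : IsWord (fun v => A.conv (i v) (j v) (x v)) := by
  unfold PathAlg.conv
  classical
  exact .ite (.eq hi hj) (.mk' (.const _) (.const 0))
    (.ite (.and (.const _) (.wtLe hx.1 .zero)) (.mk' (.const _) (.const 0)) hx)

section Consume

variable {G : View a b → Geo} {κ st e f k q ρ : View a b → ℕ} {p : View a b → Pos}
  {src : View a b → Fin 3 → Word} {l : View a b → Loc} {inp : View a b → EReal}

theorem IsLoc.inCon (A : PathAlg) (hG : IsGeo G) (hκ : IsNum κ) (hst : IsNum st) (hp : IsPos p)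
    (hk : IsNum k) (hs : ∀ i, IsWord (fun v => src v i)) (hl : IsLoc l) :
    IsLoc (fun v => inCon A (G v) (κ v) (st v) (p v) (k v) (src v) (l v)) := by
  unfold _root_.inCon
  have h1 : IsNum (fun v => st v + 1) := hst.add (.const 1)
  have hi := hG.decI h1 hκ hp
  have hj := hG.decJ h1 hκ hp
  have hw := IsWord.pick (IsGeo.axis hst) hs
  exact .ite (.eq hk (hG.coord hst hi hj (IsGeo.axis hst)))
    (.ite (.lt hst (.const 4)) ⟨hl.x, hw, hl.d, hl.a, hl.b, hl.c⟩
      (.ite (.eq (hG.slot hi hj) hκ) ⟨hl.x, hl.v, .conv A hi hj hw, hl.a, hl.b, hl.c⟩ hl)) hl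

theorem IsLoc.outCon (hG : IsGeo G) (hκ : IsNum κ) (hst : IsNum st) (hp : IsPos p)
    (hk : IsNum k) (hs : ∀ i, IsWord (fun v => src v i)) (hl : IsLoc l) :
    IsLoc (fun v => outCon (G v) (κ v) (st v) (p v) (k v) (src v) (l v)) := by
  unfold _root_.outCon
  have h1 : IsNum (fun v => st v + 1) := hst.add (.const 1)
  have hi := hG.decI hst hκ hp
  have hj := hG.decJ hst hκ hp
  have hw := IsWord.pick (IsGeo.axis hst) hs
  exact .ite (.eq hk (hG.coord h1 hi hj (IsGeo.axis hst)))
    (.ite (.lt (.const 0) hst) ⟨hl.x, hw, hl.d, hl.a, hl.b, hl.c⟩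
      (.ite (.eq (hG.slot hi hj) hκ) ⟨hw, hl.v, hl.d, hl.a, hl.b, hl.c⟩ hl)) hl

theorem IsLoc.fetchCon (A : PathAlg) (hG : IsGeo G) (he : IsNum e) (hp : IsPos p)
    (hk : IsNum k) (hs : ∀ i, IsWord (fun v => src v i)) (hl : IsLoc l) :
    IsLoc (fun v => fetchCon A (G v) (e v) (p v) (k v) (src v) (l v)) := by
  have := hp 1
  have := hs 1
  refine ⟨hl.x, hl.v, hl.d, ?_, ?_, ?_⟩
  · exact .ite (.eq hk (((((hp 1).mod (hG.u.mul hG.u)).div hG.u).mul hG.u).add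
      (hG.midClass he hp))) (hs 1) hl.a
  · exact .ite (.eq hk (((hG.midClass he hp).mul hG.u).add ((hp 1).mod hG.u))) (hs 1) hl.b
  · exact .ite (.eq he (.const 0)) (.mk' (.const _) (.const 0)) hl.c

theorem IsLoc.mulCon (A : PathAlg) (hG : IsGeo G) (he : IsNum e) (hp : IsPos p)
    (hk : IsNum k) (hs : ∀ i, IsWord (fun v => src v i)) (hl : IsLoc l) :
    IsLoc (fun v => mulCon A (G v) (e v) (p v) (k v) (src v) (l v)) := by
  unfold _root_.mulCon
  classical
  have hK := hG.midClass he hp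
  have hx : IsNum fun v => k v * (G v).u + _root_.midClass (G v) (e v) (p v) :=
    (hk.mul hG.u).add hK
  have hm : IsWt fun v => A.mul.eval (src v 2).w (src v 0).w := .op _ (hs 2).1 (hs 0).1
  exact .ite (.and (.lt hK hG.u) (.and (.lt hx hG.n) (.better A hm hl.c.1)))
    ⟨hl.x, hl.v, hl.d, hl.a, hl.b, .mk' hm (hx.add (.const 1))⟩ hl

theorem IsLoc.reduceCon (A : PathAlg) (hG : IsGeo G) (hp : IsPos p)
    (hk : IsNum k) (hs : ∀ i, IsWord (fun v => src v i)) (hl : IsLoc l) :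
    IsLoc (fun v => reduceCon A (G v) (p v) (k v) (src v) (l v)) := by
  unfold _root_.reduceCon
  classical
  exact .ite (.and (.eq (hk.mod (hG.u.mul hG.u)) (hp 1)) (.better A (hs 1).1 hl.d.1))
    ⟨hl.x, hl.v, hs 1, hl.a, hl.b, hl.c⟩ hl

theorem IsLoc.prodCon (A : PathAlg) (hG : IsGeo G) (hf : IsNum f) (hp : IsPos p)
    (hk : IsNum k) (hs : ∀ i, IsWord (fun v => src v i)) (hl : IsLoc l) :
    IsLoc (fun v => prodCon A (G v) (f v) (p v) (k v) (src v) (l v)) := by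
  unfold _root_.prodCon
  have h2 := hf.div (.const 2)
  exact .ite (.eq hf ((IsNum.const 2).mul hG.E)) (.reduceCon A hG hp hk hs hl)
    (.ite (.eq (hf.mod (.const 2)) (.const 0)) (.fetchCon A hG h2 hp hk hs hl)
      (.mulCon A hG h2 hp hk hs hl))

theorem IsLoc.roundCon (A : PathAlg) (hG : IsGeo G) (hq : IsNum q) (hρ : IsNum ρ) (hi : IsWt inp)
    (hp : IsPos p) (hk : IsNum k) (hs : ∀ i, IsWord (fun v => src v i)) (hl : IsLoc l) :
    IsLoc (fun v => roundCon A (G v) (q v) (ρ v) (inp v) (p v) (k v) (src v) (l v)) := by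
  unfold _root_.roundCon
  have h1 := hρ.sub (.const 1)
  have hR := (IsNum.const 31).add (hq.mul hG.period)
  have h2 := hρ.sub hR
  exact .ite (.eq hρ (.const 0)) ⟨.mk' hi (.const 0), hl.v, hl.d, hl.a, hl.b, hl.c⟩
    (.ite (.lt hρ (.const 31))
      (.inCon A hG (h1.div (.const 5)) (h1.mod (.const 5)) hp hk hs hl)
      (.ite (.lt hρ hR) (.prodCon A hG ((hρ.sub (.const 31)).mod hG.period) hp hk hs hl)
        (.outCon hG (h2.div (.const 5)) ((IsNum.const 4).sub (h2.mod (.const 5))) hp hk hs hl)))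

theorem IsWord.prodLoad (hG : IsGeo G) (hf : IsNum f) (i : Fin 3) (hl : IsLoc l) :
    IsWord (fun v => prodLoad (G v) (f v) i (l v)) := by
  unfold _root_.prodLoad
  exact .ite (.eq hf ((IsNum.const 2).mul hG.E)) hl.c
    (.ite (.eq (hf.mod (.const 2)) (.const 0)) hl.d (.ite (.const _) hl.a hl.b))

theorem IsWord.roundLoad (hG : IsGeo G) (hq : IsNum q) (hρ : IsNum ρ) (i : Fin 3) (hl : IsLoc l) :
    IsWord (fun v => roundLoad (G v) (q v) (ρ v) i (l v)) := by
  unfold _root_.roundLoad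
  have h1 := hρ.sub (.const 1)
  have hR := (IsNum.const 31).add (hq.mul hG.period)
  have h2 := hρ.sub hR
  exact .ite (.lt hρ (.const 31)) (.ite (.eq (h1.mod (.const 5)) (.const 0)) hl.x hl.v)
    (.ite (.lt hρ hR) (.prodLoad hG ((hρ.sub (.const 31)).mod hG.period) i hl)
      (.ite (.eq (h2.mod (.const 5)) (.const 0)) hl.d hl.v))

/-- A function of the view with values in `Cell` that is given by expressions. -/
structure IsCell (f : View a b → Cell) : Prop where
  loc : IsLoc (fun v => (f v).loc)
  left : ∀ i, IsWord (fun v => (f v).left i)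
  right : ∀ i, IsWord (fun v => (f v).right i)

/-- No control state is needed: the round and the step within it are the quotient and the remainder
of the clock by the length of a sweep, and everything else is arithmetic in the registers. -/
theorem IsCell.cellNext (A : PathAlg) {t : View a b → ℕ} {c : View a b → Cell}
    {up dn : View a b → Fin 3 → Word} (hG : IsGeo G) (hq : IsNum q) (ht : IsNum t)
    (hi : IsWt inp) (hp : IsPos p) (hc : IsCell c) (hu : ∀ i, IsWord (fun v => up v i))
    (hd : ∀ i, IsWord (fun v => dn v i)) :
    IsCell (fun v => cellNext A (G v) (q v) (t v) (inp v) (p v) (c v) (up v) (dn v)) := by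
  have h0 := hp 0
  have h1 := hp 1
  have h2 := hp 2
  have hlen := (IsNum.const 32).mul hG.s
  have hρ := ht.div hlen
  have hτ := ht.mod hlen
  have hsum : IsNum (fun v => (p v).sum) := (h0.add h1).add h2
  have hsum2 := hsum.add (.const 2)
  refine ⟨?_, fun i => ?_, fun i => ?_⟩
  · exact .ite (.and (.le hsum2 hτ) (.lt hτ (hsum2.add ((IsNum.const 8).mul hG.s))))
      (.roundCon A hG hq hρ hi hp (hτ.sub hsum2) hc.right hc.loc) hc.loc
  · exact .ite (.eq (hτ.add (hp i)) hsum) (.roundLoad hG hq hρ i hc.loc) (hu i)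
  · exact .ite (.eq (hp i) (.const 0)) (hc.left i) (hd i)

end Consume

end Expressible

end


noncomputable section

/-! ### The program

Each processor simulates `8 ^ 3` cells. -/

/-- The names of the words of a cell. -/
abbrev CellReg : Type := Fin 6 ⊕ Fin 3 ⊕ Fin 3

/-- The word of a cell with a given name. -/
def Cell.get (c : Cell) : CellReg → Word
  | .inl r => (![c.loc.x, c.loc.v, c.loc.d, c.loc.a, c.loc.b, c.loc.c] : Fin 6 → Word) r
  | .inr (.inl a) => c.left a
  | .inr (.inr a) => c.right a

/-- The cell with given words. -/
def Cell.ofWords (f : CellReg → Word) : Cell where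
  loc := ⟨f (.inl 0), f (.inl 1), f (.inl 2), f (.inl 3), f (.inl 4), f (.inl 5)⟩
  left a := f (.inr (.inl a))
  right a := f (.inr (.inr a))

theorem Cell.ofWords_get (c : Cell) : Cell.ofWords c.get = c := rfl

/-- The place of a cell within its processor. -/
abbrev Offset : Type := Fin 3 → Fin 8

/-- The names of the words of the cells of a processor. -/
abbrev DataReg : Type := Offset × CellReg

/-- The number of words of the cells of a processor. -/
def dataCard : ℕ := Fintype.card DataReg

/-- The numbering of the words of the cells of a processor. -/
def dataEquiv : DataReg ≃ Fin dataCard := Fintype.equivFin DataReg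

attribute [irreducible] dataCard dataEquiv

/-- The register that holds the number of a word. -/
def numIx (i : DataReg) : Fin (dataCard + 4 + 7) := ⟨dataEquiv i + 11, by omega⟩

/-- The register that holds the weight of a word. -/
def wtIx (i : DataReg) : Fin (dataCard + 1) := ⟨dataEquiv i + 1, by omega⟩

/-- The view of a processor that runs the program. -/
abbrev PView : Type := View (dataCard + 4 + 7) (dataCard + 1)

/-- The scalar registers; from number `7` on: the time, the side of the input cube, the number of
matrix products, and the `q`-th power of two minus one. -/
def scalar (r : ℕ) (hr : r < 11) (v : PView) : ℕ := (v none).num ⟨r, by omega⟩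

/-- A word of a cell in the view of a processor. -/
def viewWord (src : Option Dir) (i : DataReg) (v : PView) : Word :=
  ⟨(v src).wt (wtIx i), (v src).num (numIx i)⟩

/-- The parameters of the layout in the view of a processor. -/
def viewGeo (v : PView) : Geo :=
  ⟨scalar 0 (by norm_num) v, scalar 1 (by norm_num) v, scalar 8 (by norm_num) v⟩

/-- The position of a cell in the view of a processor. -/
def viewPos (o : Offset) (v : PView) : Pos :=
  fun a => 8 * scalar (a + 2) (by omega) v + o a

/-- The input of a cell in the view of a processor. -/
def viewInp (o : Offset) (v : PView) : EReal := if o = 0 then (v none).wt 0 else 0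

/-- The word that comes to a cell from the next higher cell. -/
def viewUp (o : Offset) (v : PView) (a : Fin 3) : Word :=
  if h : (o a : ℕ) + 1 < 8 then
    viewWord none (Function.update o a ⟨o a + 1, h⟩, .inr (.inl a)) v
  else viewWord (some (a, true)) (Function.update o a 0, .inr (.inl a)) v

/-- The word that comes to a cell from the next lower cell. -/
def viewDown (o : Offset) (v : PView) (a : Fin 3) : Word :=
  if 0 < (o a : ℕ) then
    viewWord none (Function.update o a ⟨o a - 1, by omega⟩, .inr (.inr a)) v
  else viewWord (some (a, false)) (Function.update o a 7, .inr (.inr a)) v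

/-- The new memory of a cell, in the view of a processor. -/
def viewNext (A : PathAlg) (o : Offset) (v : PView) : Cell :=
  cellNext A (viewGeo v) (scalar 9 (by norm_num) v) (scalar 7 (by norm_num) v) (viewInp o v)
    (viewPos o v) (Cell.ofWords fun r => viewWord none (o, r) v) (viewUp o v) (viewDown o v)

/-- The time at which the output is written. -/
def viewEnd (v : PView) : ℕ :=
  32 * (viewGeo v).s * rounds (viewGeo v) (scalar 9 (by norm_num) v)

/-- The new values of the number registers. -/
def numNextFun (A : PathAlg) (r : Fin (dataCard + 4 + 7)) (v : PView) : ℕ :=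
  if h : 11 ≤ (r : ℕ) then
    ((viewNext A (dataEquiv.symm ⟨r - 11, by omega⟩).1 v).get
      (dataEquiv.symm ⟨r - 11, by omega⟩).2).k
  else if (r : ℕ) = 5 then if viewEnd v ≤ scalar 7 (by norm_num) v then 1 else 0
  else if (r : ℕ) = 6 then
    if viewEnd v ≤ scalar 7 (by norm_num) v then (viewWord none (0, .inl 0) v).k else 0
  else if (r : ℕ) = 7 then scalar 7 (by norm_num) v + 1
  else if (r : ℕ) = 8 then
    if (viewGeo v).m * (viewGeo v).m * (viewGeo v).m < (viewGeo v).n * (viewGeo v).n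
    then (viewGeo v).m + 1 else (viewGeo v).m
  else if (r : ℕ) = 9 then
    if scalar 10 (by norm_num) v + 1 < (viewGeo v).n
    then scalar 9 (by norm_num) v + 1 else scalar 9 (by norm_num) v
  else if (r : ℕ) = 10 then
    if scalar 10 (by norm_num) v + 1 < (viewGeo v).n
    then 2 * scalar 10 (by norm_num) v + 1 else scalar 10 (by norm_num) v
  else (v none).num r

/-- The new values of the weight registers. -/
def wtNextFun (A : PathAlg) (r : Fin (dataCard + 1)) (v : PView) : EReal :=
  if h : 1 ≤ (r : ℕ) then
    ((viewNext A (dataEquiv.symm ⟨r - 1, by omega⟩).1 v).get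
      (dataEquiv.symm ⟨r - 1, by omega⟩).2).w
  else if viewEnd v ≤ scalar 7 (by norm_num) v then (viewWord none (0, .inl 0) v).w
  else (v none).wt r

theorem isNum_scalar (r : ℕ) (hr : r < 11) : IsNum (scalar r hr) := IsNum.reg none _

theorem isWord_viewWord (src : Option Dir) (i : DataReg) : IsWord (viewWord src i) :=
  ⟨IsWt.reg src _, IsNum.reg src _⟩

theorem isGeo_viewGeo : IsGeo viewGeo :=
  ⟨isNum_scalar 0 (by norm_num), isNum_scalar 1 (by norm_num), isNum_scalar 8 (by norm_num)⟩

theorem isNum_viewEnd : IsNum viewEnd :=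
  .mul (.mul (.const 32) isGeo_viewGeo.s) (isGeo_viewGeo.rounds (isNum_scalar 9 _))

theorem isCell_viewNext (A : PathAlg) (o : Offset) : IsCell (viewNext A o) := by
  refine IsCell.cellNext A isGeo_viewGeo (isNum_scalar 9 _) (isNum_scalar 7 _) ?_ ?_ ?_ ?_ ?_
  · unfold viewInp
    split_ifs
    · exact IsWt.reg none 0
    · exact IsWt.zero
  · exact fun a => .add (.mul (.const 8) (isNum_scalar _ _)) (.const _)
  · exact ⟨⟨isWord_viewWord _ _, isWord_viewWord _ _, isWord_viewWord _ _, isWord_viewWord _ _,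
      isWord_viewWord _ _, isWord_viewWord _ _⟩, fun _ => isWord_viewWord _ _,
      fun _ => isWord_viewWord _ _⟩
  · intro a
    unfold viewUp
    split_ifs <;> exact isWord_viewWord _ _
  · intro a
    unfold viewDown
    split_ifs <;> exact isWord_viewWord _ _

theorem IsCell.get {a b : ℕ} {f : View a b → Cell} (hf : IsCell f) (r : CellReg) :
    IsWord (fun v => (f v).get r) := by
  rcases r with r | a | a
  · fin_cases r
    exacts [hf.loc.x, hf.loc.v, hf.loc.d, hf.loc.a, hf.loc.b, hf.loc.c]
  · exact hf.left a
  · exact hf.right a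

theorem isNum_numNextFun (A : PathAlg) (r : Fin (dataCard + 4 + 7)) : IsNum (numNextFun A r) := by
  have hd : IsCond (fun v => viewEnd v ≤ scalar 7 (by norm_num) v) :=
    .le isNum_viewEnd (isNum_scalar 7 _)
  have hG := isGeo_viewGeo
  have hc : IsCond (fun v => scalar 10 (by norm_num) v + 1 < (viewGeo v).n) :=
    .lt (.add (isNum_scalar 10 _) (.const 1)) hG.n
  unfold numNextFun
  split_ifs
  · exact ((isCell_viewNext A _).get _).2
  · exact .ite hd (.const 1) (.const 0)
  · exact .ite hd (isWord_viewWord _ _).2 (.const 0)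
  · exact .add (isNum_scalar 7 _) (.const 1)
  · exact .ite (.lt (.mul (.mul hG.m hG.m) hG.m) (.mul hG.n hG.n)) (.add hG.m (.const 1)) hG.m
  · exact .ite hc (.add (isNum_scalar 9 _) (.const 1)) (isNum_scalar 9 _)
  · exact .ite hc (.add (.mul (.const 2) (isNum_scalar 10 _)) (.const 1)) (isNum_scalar 10 _)
  · exact .reg none r

theorem isWt_wtNextFun (A : PathAlg) (r : Fin (dataCard + 1)) : IsWt (wtNextFun A r) := by
  have hd : IsCond (fun v => viewEnd v ≤ scalar 7 (by norm_num) v) :=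
    .le isNum_viewEnd (isNum_scalar 7 _)
  unfold wtNextFun
  split_ifs
  · exact ((isCell_viewNext A _).get _).1
  · exact .ite hd (isWord_viewWord _ _).1 (.reg none r)

/-- The program for a path problem. -/
def pathProgram (A : PathAlg) : MeshProgram :=
  programOf (dataCard + 4) dataCard 40 (numNextFun A) (wtNextFun A) (isNum_numNextFun A)
    (isWt_wtNextFun A)

/-- The memories that a processor sees. -/
def meshView {a b s : ℕ} (σ : Proc s → LocalState a b) (P : Proc s) : View a b
  | none => σ P
  | some d => (neighbor P d).elim (LocalState.blank a b) σ

/-- The memories of the processors. -/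
abbrev MeshState (s : ℕ) : Type := Proc s → LocalState (dataCard + 4 + 7) (dataCard + 1)

/-- One step of the program, if words have `W` values. -/
def meshStep (A : PathAlg) (W : ℕ) {s : ℕ} (σ : MeshState s) : MeshState s := fun P =>
  { num := fun r => numNextFun A r (meshView σ P) % W
    wt := fun r => wtNextFun A r (meshView σ P) }

theorem programOf_view {ne we wl : ℕ} {F : Fin (ne + 7) → View (ne + 7) (we + 1) → ℕ}
    {G : Fin (we + 1) → View (ne + 7) (we + 1) → EReal} (hF : ∀ r, IsNum (F r))
    (hG : ∀ r, IsWt (G r)) {s : ℕ} (σ : Proc s → LocalState (ne + 7) (we + 1)) (p : Proc s) :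
    (programOf ne we wl F G hF hG).view σ p = meshView σ p := by
  funext d
  rcases d with _ | d
  · rfl
  · simp only [MeshProgram.view, meshView]
    cases neighbor p d <;> rfl

/-- After this only the functions of the view matter, no longer the expressions chosen for them. -/
theorem pathProgram_step (A : PathAlg) {s : ℕ} (σ : MeshState s) :
    (pathProgram A).step σ = meshStep A ((pathProgram A).wordSize s) σ := by
  funext P
  have hv := programOf_view (wl := 40) (isNum_numNextFun A) (isWt_wtNextFun A) σ P
  refine (LocalState.mk.injEq _ _ _ _).mpr ⟨funext fun r => ?_, funext fun r => ?_⟩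
  · exact (programOf_step_num (isNum_numNextFun A) (isWt_wtNextFun A) σ P r).trans
      (congrArg (fun v => numNextFun A r v % (pathProgram A).wordSize s) hv)
  · exact (programOf_step_wt (isNum_numNextFun A) (isWt_wtNextFun A) σ P r).trans
      (congrArg (wtNextFun A r) hv)

/-! ### The run of the program in terms of cells -/

/-- The side of the input cube as far as it has been computed at time `t`. -/
def mAt (n : ℕ) : ℕ → ℕ
  | 0 => 0
  | t + 1 => if mAt n t * mAt n t * mAt n t < n * n then mAt n t + 1 else mAt n t

/-- The power of two, minus one, that has been reached at time `t`. -/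
def powAt (n : ℕ) : ℕ → ℕ
  | 0 => 0
  | t + 1 => if powAt n t + 1 < n then 2 * powAt n t + 1 else powAt n t

/-- The number of matrix products as far as it has been computed at time `t`. -/
def prodAt (n : ℕ) : ℕ → ℕ
  | 0 => 0
  | t + 1 => if powAt n t + 1 < n then prodAt n t + 1 else prodAt n t

/-- The parameters of the layout as far as they have been computed at time `t`. -/
def geoAt (n s t : ℕ) : Geo := ⟨n, s, mAt n t⟩

/-- The cell all of whose words are `0`. -/
def Cell.blank : Cell := Cell.ofWords fun _ => Word.blank

/-- The memories of the cells at time `t`. -/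
def cellRun (A : PathAlg) (n s : ℕ) (inp : Pos → EReal) : ℕ → Pos → Cell
  | 0, _ => Cell.blank
  | t + 1, p =>
    cellNext A (geoAt n s t) (prodAt n t) t (inp p) p (cellRun A n s inp t p)
      (upWord (8 * s) (cellRun A n s inp t) p) (downWord (cellRun A n s inp t) p)

/-- The position of a cell of a processor. -/
def cellPos {s : ℕ} (P : Proc s) (o : Offset) : Pos := fun a => 8 * (P a : ℕ) + o a

/-- The memories `σ` of the processors agree with the memories of the cells at time `t`. -/
structure Simulates (A : PathAlg) (n s : ℕ) (inp : Pos → EReal) (inp' : Proc s → EReal) (t : ℕ)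
    (σ : MeshState s) : Prop where
  n_eq : ∀ P, (σ P).num ⟨0, by omega⟩ = n
  s_eq : ∀ P, (σ P).num ⟨1, by omega⟩ = s
  pos_eq : ∀ P (a : Fin 3), (σ P).num ⟨a + 2, by omega⟩ = P a
  flag_eq : ∀ P, (σ P).num ⟨5, by omega⟩ = 0
  t_eq : ∀ P, (σ P).num ⟨7, by omega⟩ = t
  m_eq : ∀ P, (σ P).num ⟨8, by omega⟩ = mAt n t
  q_eq : ∀ P, (σ P).num ⟨9, by omega⟩ = prodAt n t
  pow_eq : ∀ P, (σ P).num ⟨10, by omega⟩ = powAt n t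
  inp_eq : ∀ P, (σ P).wt 0 = inp' P
  data_eq : ∀ P o r, (⟨(σ P).wt (wtIx (o, r)), (σ P).num (numIx (o, r))⟩ : Word) =
    (cellRun A n s inp t (cellPos P o)).get r

/-! ### Processors simulate cells -/

section Simulation

variable {A : PathAlg} {n s : ℕ} {inp : Pos → EReal} {inp' : Proc s → EReal} {t : ℕ}
  {σ : MeshState s} {W : ℕ}

theorem Simulates.viewWord_none (h : Simulates A n s inp inp' t σ) (P : Proc s) (i : DataReg) :
    viewWord none i (meshView σ P) =
      (cellRun A n s inp t (cellPos P i.1)).get i.2 := h.data_eq P i.1 i.2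

theorem Simulates.viewUp (h : Simulates A n s inp inp' t σ) (P : Proc s) (o : Offset) :
    viewUp o (meshView σ P) =
      upWord (8 * s) (cellRun A n s inp t) (cellPos P o) := by
  funext a
  have hP := (P a).2
  rw [_root_.viewUp, upWord]
  split_ifs with h1 h2 h2
  · rw [h.viewWord_none]
    have : cellPos P (Function.update o a ⟨o a + 1, h1⟩) =
        Function.update (cellPos P o) a (cellPos P o a + 1) := by
      funext b
      by_cases hb : b = a
      · subst hb; simp [cellPos]; omega
      · simp [cellPos, hb]
    rw [this]
    rfl
  · simp only [cellPos] at h2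
    omega
  -- The cell lies on a face of its processor, and the next cell has offset `0` in the neighboring
  -- one.
  · simp only [cellPos] at h2
    have hs : (P a : ℕ) + 1 < s := by omega
    have hn : neighbor P (a, true) = some (Function.update P a ⟨(P a : ℕ) + 1, hs⟩) := by
      simp [neighbor, hs]
    have hv : viewWord (some (a, true)) (Function.update o a 0, .inr (.inl a))
        (meshView σ P) = (cellRun A n s inp t (cellPos
          (Function.update P a ⟨(P a : ℕ) + 1, hs⟩) (Function.update o a 0))).left a := by
      rw [viewWord]
      simp only [meshView, hn]
      exact h.data_eq _ _ _
    rw [hv]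
    congr 2
    funext b
    by_cases hb : b = a
    · subst hb; simp [cellPos]; omega
    · simp [cellPos, hb]
  -- At the boundary of the mesh the blank memory supplies the blank word.
  · simp only [cellPos] at h2
    have hs : ¬ (P a : ℕ) + 1 < s := by omega
    have hn : neighbor P (a, true) = none := by simp [neighbor, hs]
    rw [viewWord]
    simp only [meshView, hn]
    rfl

theorem Simulates.viewDown (h : Simulates A n s inp inp' t σ) (P : Proc s) (o : Offset) :
    viewDown o (meshView σ P) = downWord (cellRun A n s inp t) (cellPos P o) := by
  funext a
  have hP := (P a).2
  rw [_root_.viewDown, downWord]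
  split_ifs with h1 h2 h2
  · rw [h.viewWord_none]
    have : cellPos P (Function.update o a ⟨o a - 1, by omega⟩) =
        Function.update (cellPos P o) a (cellPos P o a - 1) := by
      funext b
      by_cases hb : b = a
      · subst hb; simp [cellPos]; omega
      · simp [cellPos, hb]
    rw [this]
    rfl
  · simp only [cellPos] at h2
    omega
  · simp only [cellPos] at h2
    have hs : 0 < (P a : ℕ) := by omega
    have hn : neighbor P (a, false) = some (Function.update P a ⟨(P a : ℕ) - 1, by omega⟩) := by
      simp [neighbor, hs]
    have hv : viewWord (some (a, false)) (Function.update o a 7, .inr (.inr a))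
        (meshView σ P) = (cellRun A n s inp t (cellPos
          (Function.update P a ⟨(P a : ℕ) - 1, by omega⟩) (Function.update o a 7))).right a := by
      rw [viewWord]
      simp only [meshView, hn]
      exact h.data_eq _ _ _
    rw [hv]
    congr 2
    funext b
    by_cases hb : b = a
    · subst hb; simp [cellPos]; omega
    · simp [cellPos, hb]
  · simp only [cellPos] at h2
    have hs : ¬ 0 < (P a : ℕ) := by omega
    have hn : neighbor P (a, false) = none := by simp [neighbor]; omega
    rw [viewWord]
    simp only [meshView, hn]
    rfl

theorem Simulates.viewGeo (h : Simulates A n s inp inp' t σ) (P : Proc s) :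
    viewGeo (meshView σ P) = geoAt n s t := by
  rw [_root_.viewGeo, geoAt]
  congr 1
  exacts [h.n_eq P, h.s_eq P, h.m_eq P]

theorem Simulates.viewNext (h : Simulates A n s inp inp' t σ)
    (hinp : ∀ P o, inp (cellPos P o) = if o = 0 then inp' P else 0) (P : Proc s) (o : Offset) :
    viewNext A o (meshView σ P) = cellRun A n s inp (t + 1) (cellPos P o) := by
  have h1 : viewPos o (meshView σ P) = cellPos P o := by
    funext a
    exact congrArg (8 * · + (o a : ℕ)) (h.pos_eq P a)
  have h2 : viewInp o (meshView σ P) = inp (cellPos P o) := by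
    rw [hinp, viewInp]
    split_ifs
    · exact h.inp_eq P
    · rfl
  have h3 : (Cell.ofWords fun r => viewWord none (o, r) (meshView σ P)) =
      cellRun A n s inp t (cellPos P o) := by
    simp only [h.viewWord_none]
    exact Cell.ofWords_get _
  have h4 : scalar 9 (by norm_num) (meshView σ P) = prodAt n t := h.q_eq P
  have h5 : scalar 7 (by norm_num) (meshView σ P) = t := h.t_eq P
  rw [_root_.viewNext, h.viewGeo, h.viewUp, h.viewDown, h1, h2, h3, h4, h5]
  rfl

theorem Simulates.viewEnd (h : Simulates A n s inp inp' t σ) (P : Proc s) :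
    viewEnd (meshView σ P) = 32 * s * rounds (geoAt n s t) (prodAt n t) := by
  have h4 : scalar 9 (by norm_num) (meshView σ P) = prodAt n t := h.q_eq P
  rw [_root_.viewEnd, h.viewGeo, h4]
  rfl

theorem meshStep_num (W : ℕ) (P : Proc s) (r : Fin (dataCard + 4 + 7)) :
    (meshStep A W σ P).num r = numNextFun A r (meshView σ P) % W := rfl

theorem meshStep_wt (W : ℕ) (P : Proc s) (r : Fin (dataCard + 1)) :
    (meshStep A W σ P).wt r = wtNextFun A r (meshView σ P) := rfl

/-- The bounds by `W` make the reduction modulo the word size ineffective. As long as the end time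
is not reached, the flag stays `0` and the input stays in weight register `0`. -/
theorem Simulates.step (h : Simulates A n s inp inp' t σ)
    (hinp : ∀ P o, inp (cellPos P o) = if o = 0 then inp' P else 0)
    (hend : t < 32 * s * rounds (geoAt n s t) (prodAt n t))
    (hn : n < W) (hs : s < W)
    (ht : t + 1 < W)
    (hm : mAt n (t + 1) < W)
    (hq : prodAt n (t + 1) < W)
    (hpow : powAt n (t + 1) < W)
    (hk : ∀ p r, ((cellRun A n s inp (t + 1) p).get r).k < W) :
    Simulates A n s inp inp' (t + 1) (meshStep A W σ) := by
  have hend' : ∀ P, ¬ _root_.viewEnd (meshView σ P) ≤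
      scalar 7 (by norm_num) (meshView σ P) := by
    intro P
    have h5 : scalar 7 (by norm_num) (meshView σ P) = t := h.t_eq P
    rw [h.viewEnd, h5]
    omega
  have h10 : ∀ P, scalar 10 (by norm_num) (meshView σ P) = powAt n t := h.pow_eq
  have h9 : ∀ P, scalar 9 (by norm_num) (meshView σ P) = prodAt n t := h.q_eq
  have h7 : ∀ P, scalar 7 (by norm_num) (meshView σ P) = t := h.t_eq
  constructor
  · intro P
    rw [meshStep_num]
    simp only [numNextFun]
    norm_num
    change (σ P).num ⟨0, by omega⟩ % _ = n
    rw [h.n_eq, Nat.mod_eq_of_lt hn]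
  · intro P
    rw [meshStep_num]
    simp only [numNextFun]
    norm_num
    change (σ P).num ⟨1, by omega⟩ % _ = s
    rw [h.s_eq, Nat.mod_eq_of_lt hs]
  · intro P a
    have hP := (P a).2
    rw [meshStep_num]
    have : numNextFun A ⟨a + 2, by omega⟩ (meshView σ P) =
        (σ P).num ⟨a + 2, by omega⟩ := by
      simp only [numNextFun]
      rw [dif_neg (by omega), if_neg (by omega), if_neg (by omega), if_neg (by omega),
        if_neg (by omega), if_neg (by omega), if_neg (by omega)]
      rfl
    rw [this, h.pos_eq, Nat.mod_eq_of_lt (by omega)]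
  · intro P
    rw [meshStep_num]
    simp [numNextFun, hend' P]
  · intro P
    rw [meshStep_num]
    simp only [numNextFun]
    norm_num
    rw [h7, Nat.mod_eq_of_lt ht]
  · intro P
    rw [meshStep_num]
    simp only [numNextFun]
    norm_num
    rw [h.viewGeo]
    exact Nat.mod_eq_of_lt hm
  · intro P
    rw [meshStep_num]
    simp only [numNextFun]
    norm_num
    rw [h.viewGeo, h10, h9]
    exact Nat.mod_eq_of_lt hq
  · intro P
    rw [meshStep_num]
    simp only [numNextFun]
    norm_num
    rw [h.viewGeo, h10]
    exact Nat.mod_eq_of_lt hpow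
  · intro P
    rw [meshStep_wt]
    simp only [wtNextFun]
    rw [dif_neg (by simp), if_neg (hend' P)]
    exact h.inp_eq P
  · intro P o r
    rw [meshStep_num, meshStep_wt]
    have e : ∀ (i : DataReg), dataEquiv.symm ⟨(dataEquiv i : ℕ), (dataEquiv i).2⟩ = i :=
      fun i => dataEquiv.symm_apply_apply i
    simp only [numNextFun, wtNextFun, numIx, wtIx, Nat.le_add_left, dif_pos, Nat.add_sub_cancel, e]
    rw [h.viewNext hinp, Nat.mod_eq_of_lt (hk _ _)]

/-- The step in which the output is written. -/
theorem Simulates.last (h : Simulates A n s inp inp' t σ)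
    (hend : 32 * s * rounds (geoAt n s t) (prodAt n t) ≤ t)
    (hn : 1 < W)
    (hk : ∀ p r, ((cellRun A n s inp t p).get r).k < W) (P : Proc s) :
    (meshStep A W σ P).num ⟨5, by omega⟩ = 1 ∧
      (meshStep A W σ P).num ⟨6, by omega⟩ =
        (cellRun A n s inp t (cellPos P 0)).loc.x.k ∧
      (meshStep A W σ P).wt 0 = (cellRun A n s inp t (cellPos P 0)).loc.x.w := by
  have hend' : _root_.viewEnd (meshView σ P) ≤
      scalar 7 (by norm_num) (meshView σ P) := by
    have h5 : scalar 7 (by norm_num) (meshView σ P) = t := h.t_eq P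
    rw [h.viewEnd, h5]
    omega
  refine ⟨?_, ?_, ?_⟩
  · rw [meshStep_num]
    simp only [numNextFun]
    norm_num
    rw [if_pos hend', Nat.mod_eq_of_lt hn]
  · rw [meshStep_num]
    simp only [numNextFun]
    norm_num
    rw [if_pos hend', h.viewWord_none]
    exact Nat.mod_eq_of_lt (hk (cellPos P 0) (.inl 0))
  · rw [meshStep_wt]
    simp only [wtNextFun]
    rw [dif_neg (by simp), if_pos hend', h.viewWord_none]
    rfl

end Simulation

end


noncomputable section

/-! ### The rounds -/

theorem iter_proj {β γ : Type*} {f : ℕ → β → β} {g : ℕ → γ → γ} (π : β → γ)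
    (h : ∀ k l, π (f k l) = g k (π l)) (S : ℕ) (l : β) : π (iter f S l) = iter g S (π l) := by
  induction S with
  | zero => rfl
  | succ S ih => simp only [iter, h, ih]

theorem iter_const {β γ : Type*} {f : ℕ → β → β} (π : β → γ) (h : ∀ k l, π (f k l) = π l) (S : ℕ)
    (l : β) : π (iter f S l) = π l := by
  induction S with
  | zero => rfl
  | succ S ih => simp only [iter, h, ih]

/-- `lam ρ p` is the memory of the cell `p` before the round `ρ`. -/
def IsRun (A : PathAlg) (G : Geo) (q : ℕ) (inp : Pos → EReal) (lam : ℕ → Pos → Loc) : Prop :=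
  ∀ ρ p, (∀ a, p a < 8 * G.s) →
    lam (ρ + 1) p = iter (fun k => roundCon A G q ρ (inp p) p k
      fun a => roundLoad G q ρ a (lam ρ (Function.update p a k))) (8 * G.s) (lam ρ p)

/-- The parameters `m` and `q` are still being counted up during round `0`. This does no harm,
because that round only copies the input and uses neither of them. -/
theorem isRun_cellRun (A : PathAlg) {n s m q : ℕ} (inp : Pos → EReal)
    (hm : ∀ t, 32 * s ≤ t → mAt n t = m) (hq : ∀ t, 32 * s ≤ t → prodAt n t = q) :
    IsRun A ⟨n, s, m⟩ q inp fun ρ p => (cellRun A n s inp (32 * s * ρ) p).loc := by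
  intro ρ p hp
  have h : ∀ τ < 4 * (8 * s), ∀ p : Pos, (∀ a, p a < 8 * s) →
      cellRun A n s inp (32 * s * ρ + (τ + 1)) p =
        sweepStep (8 * s) τ (roundLoad ⟨n, s, m⟩ q ρ)
          (fun p => roundCon A ⟨n, s, m⟩ q ρ (inp p) p) (cellRun A n s inp (32 * s * ρ + τ)) p := by
    intro τ hτ p hp
    have hs : 0 < 32 * s := by have := hp 0; omega
    have e1 : (32 * s * ρ + τ) / (32 * s) = ρ := by
      rw [mul_comm, mul_add_div_of_lt (by omega)]
    have e2 : (32 * s * ρ + τ) % (32 * s) = τ := by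
      rw [Nat.mul_add_mod_self_left, Nat.mod_eq_of_lt (by omega)]
    rw [← add_assoc]
    simp only [cellRun, cellNext, sweepStep, geoAt, e1, e2]
    rcases Nat.eq_zero_or_pos ρ with h0 | h0
    · subst h0
      rfl
    · have : 32 * s ≤ 32 * s * ρ + τ :=
        (Nat.le_mul_of_pos_right _ h0).trans (Nat.le_add_right _ _)
      rw [hm _ this, hq _ this]
  have := sweep_loc (σ := fun τ => cellRun A n s inp (32 * s * ρ + τ)) h hp
  simp only [add_zero] at this
  rw [show 32 * s * ρ + 4 * (8 * s) = 32 * s * (ρ + 1) by ring] at this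
  exact this

section Run

variable {A : PathAlg} {G : Geo} {q : ℕ} {inp : Pos → EReal} {lam : ℕ → Pos → Loc}

theorem IsRun.init (hr : IsRun A G q inp lam) (hG : G.Valid) {p : Pos}
    (hp : ∀ a, p a < 8 * G.s) : (lam 1 p).x = ⟨inp p, 0⟩ := by
  rw [hr 0 p hp]
  have hs := hG.s_pos
  obtain ⟨S, hS⟩ : ∃ S, 8 * G.s = S + 1 := ⟨8 * G.s - 1, by omega⟩
  rw [hS]
  rfl

/-! #### Routing the input -/

theorem pick_eq {a : ℕ} (ha : a < 3) (src : Fin 3 → Word) : pick a src = src ⟨a, ha⟩ := by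
  interval_cases a <;> rfl

/-- In particular, at both ends of a route the position alone determines the entry. The cell there
can compute the true slot and ignore the passes for other slots. -/
theorem Geo.decI_congr {st : ℕ} (h : st = 0 ∨ 3 ≤ st) (κ κ' : ℕ) (p : Pos) :
    G.decI st κ p = G.decI st κ' p := by
  rcases h with rfl | h
  · rfl
  · simp only [decI, if_neg (show ¬ st < 1 by omega), if_neg (show ¬ st < 3 by omega)]

theorem Geo.decJ_congr {st : ℕ} (h : st = 0 ∨ 3 ≤ st) (κ κ' : ℕ) (p : Pos) :
    G.decJ st κ p = G.decJ st κ' p := by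
  rcases h with rfl | h
  · rfl
  · simp only [decJ, if_neg (show ¬ st < 1 by omega), if_neg (show ¬ st < 3 by omega)]

theorem IsRun.in_step (hr : IsRun A G q inp lam) {κ st : ℕ} (hκ : κ < 6) (hst : st < 5) {p : Pos}
    (hp : ∀ a, p a < 8 * G.s) :
    lam (1 + (5 * κ + st) + 1) p = iter (fun k => inCon A G κ st p k fun a =>
      (if st = 0 then (lam (1 + (5 * κ + st)) (Function.update p a k)).x
        else (lam (1 + (5 * κ + st)) (Function.update p a k)).v)) (8 * G.s)
      (lam (1 + (5 * κ + st)) p) := by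
  rw [hr _ p hp]
  have e1 : (1 + (5 * κ + st) - 1) / 5 = κ := by omega
  have e2 : (1 + (5 * κ + st) - 1) % 5 = st := by omega
  congr 1
  funext k l
  simp only [roundCon, roundLoad, if_neg (show ¬ 1 + (5 * κ + st) = 0 by omega),
    if_pos (show 1 + (5 * κ + st) < 31 by omega), e1, e2]

theorem IsRun.in_x (hr : IsRun A G q inp lam) {r : ℕ} (h : r < 30) {p : Pos}
    (hp : ∀ a, p a < 8 * G.s) : (lam (1 + r + 1) p).x = (lam (1 + r) p).x := by
  rw [show r = 5 * (r / 5) + r % 5 by omega, hr.in_step (by omega) (by omega) hp]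
  refine iter_const Loc.x (fun k l => ?_) _ _
  rw [inCon]
  split_ifs <;> rfl

theorem IsRun.in_x_eq (hr : IsRun A G q inp lam) (hG : G.Valid) {r : ℕ} (h : r ≤ 30) {p : Pos}
    (hp : ∀ a, p a < 8 * G.s) : (lam (1 + r) p).x = ⟨inp p, 0⟩ := by
  induction r with
  | zero => exact hr.init hG hp
  | succ r ih => rw [← add_assoc, hr.in_x (by omega) hp, ih (by omega)]

/-- Words are pulled, not pushed: in the pass of its slot, the cell at the next position decodes the
entry, computes where it was before and picks the word from there. Cells that are on no route may
pick up meaningless words, but the route does not read them. -/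
theorem IsRun.in_v (hr : IsRun A G q inp lam) (hG : G.Valid) {i j : ℕ} (hi : i < G.n)
    (hj : j < G.n) {st : ℕ} (hst : st < 5) :
    (if st = 0 then (lam (1 + (5 * G.slot i j + st)) (G.pos st i j)).x
      else (lam (1 + (5 * G.slot i j + st)) (G.pos st i j)).v) = ⟨inp (G.pos 0 i j), 0⟩ := by
  have hκ := hG.slot_lt (i := i) hj
  induction st with
  | zero => exact hr.in_x_eq hG (by omega) (hG.pos_lt 0 hi hj)
  | succ st ih =>
    rw [if_neg (by omega), show 1 + (5 * G.slot i j + (st + 1)) = 1 + (5 * G.slot i j + st) + 1 by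
      omega, hr.in_step hκ (by omega) (hG.pos_lt (st + 1) hi hj), iter_single
      (G.coord st i j (Geo.axis st))]
    · rw [if_pos, inCon, hG.decI_pos hj, hG.decJ_pos hj, if_pos rfl, if_pos (by omega)]
      · simp only [pick_eq (Geo.axis_lt st)]
        rw [Geo.pos_succ (by omega)]
        exact ih (by omega)
      · rw [Geo.coord_eq_pos _ _ _ (Geo.axis_lt st)]
        exact hG.pos_lt st hi hj _
    · intro k l hk
      rw [inCon, hG.decI_pos hj, hG.decJ_pos hj, if_neg hk]

theorem IsRun.in_d_eq (hr : IsRun A G q inp lam) {r : ℕ} (h : r < 30) (h4 : r % 5 < 4) {p : Pos}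
    (hp : ∀ a, p a < 8 * G.s) : (lam (1 + r + 1) p).d = (lam (1 + r) p).d := by
  rw [show r = 5 * (r / 5) + r % 5 by omega, hr.in_step (by omega) (by omega) hp]
  refine iter_const Loc.d (fun k l => ?_) _ _
  rw [inCon, if_pos h4]
  split_ifs <;> rfl

theorem IsRun.in_d (hr : IsRun A G q inp lam) (hG : G.Valid) {i j : ℕ} (hi : i < G.n)
    (hj : j < G.n) : (lam 31 (G.pos 5 i j)).d = A.conv i j ⟨inp (G.pos 0 i j), 0⟩ := by
  have hκ := hG.slot_lt (i := i) hj
  have hp := hG.pos_lt 5 hi hj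
  have main : ∀ r ≤ 30, 5 * G.slot i j + 5 ≤ r →
      (lam (1 + r) (G.pos 5 i j)).d = A.conv i j ⟨inp (G.pos 0 i j), 0⟩ := by
    intro r
    induction r with
    | zero => intro _ h; omega
    | succ r ih =>
      intro h30 h5
      rw [← add_assoc]
      by_cases h4 : r % 5 < 4
      · rw [hr.in_d_eq (by omega) h4 hp]
        exact ih (by omega) (by omega)
      · obtain ⟨κ, rfl⟩ : ∃ κ, r = 5 * κ + 4 := ⟨r / 5, by omega⟩
        rw [hr.in_step (by omega) (by norm_num) hp]
        rcases eq_or_ne κ (G.slot i j) with rfl | hne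
        · rw [iter_single (G.coord 4 i j (Geo.axis 4))]
          · rw [if_pos, inCon, hG.decI_pos hj, hG.decJ_pos hj, if_pos rfl, if_neg (by omega),
              if_pos rfl]
            · simp only [pick_eq (Geo.axis_lt 4)]
              rw [Geo.pos_succ (by omega)]
              have := hr.in_v hG hi hj (st := 4) (by norm_num)
              rw [← this]
            · rw [Geo.coord_eq_pos _ _ _ (Geo.axis_lt 4)]
              exact hG.pos_lt 4 hi hj _
          · intro k l hk
            rw [inCon, hG.decI_pos hj, hG.decJ_pos hj, if_neg hk]
        · rw [iter_const Loc.d, ih (by omega) (by omega)]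
          intro k l
          rw [inCon, Geo.decI_congr (.inr (by norm_num)) κ (G.slot i j),
            Geo.decJ_congr (.inr (by norm_num)) κ (G.slot i j), hG.decI_pos hj, hG.decJ_pos hj,
            if_neg (by norm_num : ¬ 4 < 4), if_neg hne.symm, ite_self]
  exact main 30 le_rfl (by omega)

/-! #### Routing the output -/

theorem IsRun.out_step (hr : IsRun A G q inp lam) {κ st : ℕ} (hst : st < 5) {p : Pos}
    (hp : ∀ a, p a < 8 * G.s) :
    lam (31 + q * G.period + (5 * κ + (4 - st)) + 1) p = iter (fun k => outCon G κ st p k fun a =>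
      (if st = 4 then
          (lam (31 + q * G.period + (5 * κ + (4 - st))) (Function.update p a k)).d
        else (lam (31 + q * G.period + (5 * κ + (4 - st))) (Function.update p a k)).v)) (8 * G.s)
      (lam (31 + q * G.period + (5 * κ + (4 - st))) p) := by
  rw [hr _ p hp]
  have e0 : 31 + q * G.period + (5 * κ + (4 - st)) - (31 + q * G.period) = 5 * κ + (4 - st) := by
    omega
  have e1 : (5 * κ + (4 - st)) / 5 = κ := by omega
  have e2 : 4 - (5 * κ + (4 - st)) % 5 = st := by omega
  have e3 : (5 * κ + (4 - st)) % 5 = 0 ↔ st = 4 := by omega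
  congr 1
  funext k l
  simp only [roundCon, roundLoad, e0, e1, e2, e3,
    if_neg (show ¬ 31 + q * G.period + (5 * κ + (4 - st)) = 0 by omega),
    if_neg (show ¬ 31 + q * G.period + (5 * κ + (4 - st)) < 31 by omega),
    if_neg (show ¬ 31 + q * G.period + (5 * κ + (4 - st)) < 31 + q * G.period by omega)]

theorem IsRun.out_d (hr : IsRun A G q inp lam) (r : ℕ) {p : Pos}
    (hp : ∀ a, p a < 8 * G.s) :
    (lam (31 + q * G.period + r) p).d = (lam (31 + q * G.period) p).d := by
  induction r with
  | zero => rfl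
  | succ r ih =>
    rw [← add_assoc, ← ih, show r = 5 * (r / 5) + (4 - (4 - r % 5)) by omega,
      hr.out_step (by omega) hp]
    refine iter_const Loc.d (fun k l => ?_) _ _
    rw [outCon]
    split_ifs <;> rfl

theorem IsRun.out_v (hr : IsRun A G q inp lam) (hG : G.Valid) {i j : ℕ} (hi : i < G.n)
    (hj : j < G.n) {st : ℕ} (hst : st < 5) :
    (if st = 0 then
        (lam (31 + q * G.period + (5 * G.slot i j + st)) (G.pos (5 - st) i j)).d
      else (lam (31 + q * G.period + (5 * G.slot i j + st)) (G.pos (5 - st) i j)).v) =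
      (lam (31 + q * G.period) (G.pos 5 i j)).d := by
  induction st with
  | zero => exact hr.out_d _ (hG.pos_lt 5 hi hj)
  | succ st ih =>
    -- `st` counts the moves already made, and `c` is the stage of the route that is now undone.
    obtain ⟨c, hc, rfl⟩ : ∃ c, (c < 5 ∧ 0 < c) ∧ st = 4 - c := ⟨4 - st, by omega⟩
    rw [if_neg (by omega), show 31 + q * G.period + (5 * G.slot i j + (4 - c + 1)) =
      31 + q * G.period + (5 * G.slot i j + (4 - c)) + 1 by omega,
    show 5 - (4 - c + 1) = c by omega,
      hr.out_step (by omega) (hG.pos_lt c hi hj), iter_single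
      (G.coord (c + 1) i j (Geo.axis c))]
    · rw [if_pos, outCon, hG.decI_pos hj, hG.decJ_pos hj, if_pos rfl, if_pos (by omega)]
      · simp only [pick_eq (Geo.axis_lt c)]
        rw [Geo.pos_pred (by omega), ← ih (by omega), show 5 - (4 - c) = c + 1 by omega]
        simp only [show (4 - c = 0) ↔ c = 4 by omega]
      · rw [Geo.coord_eq_pos _ _ _ (Geo.axis_lt c)]
        exact hG.pos_lt (c + 1) hi hj _
    · intro k l hk
      rw [outCon, hG.decI_pos hj, hG.decJ_pos hj, if_neg hk]

theorem IsRun.out_x_eq (hr : IsRun A G q inp lam) {r : ℕ} (h4 : r % 5 < 4) {p : Pos}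
    (hp : ∀ a, p a < 8 * G.s) :
    (lam (31 + q * G.period + r + 1) p).x = (lam (31 + q * G.period + r) p).x := by
  rw [show r = 5 * (r / 5) + (4 - (4 - r % 5)) by omega, hr.out_step (by omega) hp]
  refine iter_const Loc.x (fun k l => ?_) _ _
  rw [outCon, if_pos (show 0 < 4 - r % 5 by omega)]
  split_ifs <;> rfl

theorem IsRun.out_x (hr : IsRun A G q inp lam) (hG : G.Valid) {i j : ℕ} (hi : i < G.n)
    (hj : j < G.n) :
    (lam (rounds G q) (G.pos 0 i j)).x = (lam (31 + q * G.period) (G.pos 5 i j)).d := by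
  have hκ := hG.slot_lt (i := i) hj
  have hp := hG.pos_lt 0 hi hj
  have main : ∀ r, 5 * G.slot i j + 5 ≤ r →
      (lam (31 + q * G.period + r) (G.pos 0 i j)).x =
        (lam (31 + q * G.period) (G.pos 5 i j)).d := by
    intro r
    induction r with
    | zero => intro h; omega
    | succ r ih =>
      intro h5
      rw [← add_assoc]
      by_cases h4 : r % 5 < 4
      · rw [hr.out_x_eq h4 hp]
        exact ih (by omega)
      · obtain ⟨κ, rfl⟩ : ∃ κ, r = 5 * κ + (4 - 0) := ⟨r / 5, by omega⟩
        rw [hr.out_step (by norm_num) hp]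
        rcases eq_or_ne κ (G.slot i j) with rfl | hne
        · rw [iter_single (G.coord (0 + 1) i j (Geo.axis 0))]
          · rw [if_pos, outCon, hG.decI_pos hj, hG.decJ_pos hj, if_pos rfl, if_neg (by omega),
              if_pos rfl]
            · simp only [pick_eq (Geo.axis_lt 0)]
              rw [Geo.pos_pred (by omega)]
              exact hr.out_v hG hi hj (st := 4) (by norm_num)
            · rw [Geo.coord_eq_pos _ _ _ (Geo.axis_lt 0)]
              exact hG.pos_lt 1 hi hj _
          · intro k l hk
            rw [outCon, hG.decI_pos hj, hG.decJ_pos hj, if_neg hk]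
        · rw [iter_const Loc.x, ih (by omega)]
          intro k l
          rw [outCon, Geo.decI_congr (.inl rfl) κ (G.slot i j),
            Geo.decJ_congr (.inl rfl) κ (G.slot i j), hG.decI_pos hj, hG.decJ_pos hj,
            if_neg (by norm_num : ¬ 0 < 0), if_neg hne.symm, ite_self]
  have := main 30 (by omega)
  rwa [show 31 + q * G.period + 30 = rounds G q by rw [rounds]; omega] at this

end Run

end


noncomputable section

/-! ### The matrix products -/

namespace PathAlg

variable {A : PathAlg}

theorem Better.trans {x y z : EReal} (h : A.Better x y) (h' : A.Better y z) : A.Better x z := by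
  unfold Better at *
  split_ifs at *
  · exact h'.trans h
  · exact h.trans h'

theorem Better.irrefl (x : EReal) : ¬ A.Better x x := by
  unfold Better
  split_ifs <;> exact lt_irrefl x

theorem Better.not_of_not {x y z : EReal} (h : ¬ A.Better x y) (hz : A.Better z y) :
    ¬ A.Better x z := fun hx => h (hx.trans hz)

/-- The word `c` is the word `c₀` or comes from an improvement of it by a candidate. -/
def Improves (A : PathAlg) (n : ℕ) (cand : ℕ → EReal) (c₀ c : Word) : Prop :=
  c = c₀ ∨ ∃ k < n, c = ⟨cand k, k + 1⟩ ∧ A.Better (cand k) c₀.w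

theorem Improves.step {n : ℕ} {cand : ℕ → EReal} {c₀ c : Word} (h : A.Improves n cand c₀ c) {k : ℕ}
    (hk : k < n) (hb : A.Better (cand k) c.w) : A.Improves n cand c₀ ⟨cand k, k + 1⟩ := by
  refine .inr ⟨k, hk, rfl, ?_⟩
  rcases h with rfl | ⟨k', _, rfl, h'⟩
  · exact hb
  · exact hb.trans h'

end PathAlg

section Product

variable {A : PathAlg} {G : Geo} {q : ℕ} {inp : Pos → EReal} {lam : ℕ → Pos → Loc}

/-- The matrix entry `(i, j)` after `φ` products. -/
def entry (G : Geo) (lam : ℕ → Pos → Loc) (φ i j : ℕ) : Word :=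
  (lam (31 + φ * G.period) (G.pos 5 i j)).d

/-- The candidates for the entry `(i, j)` of the product. -/
def candidate (A : PathAlg) (G : Geo) (lam : ℕ → Pos → Loc) (φ i j k : ℕ) : EReal :=
  A.mul.eval (entry G lam φ i k).w (entry G lam φ k j).w

theorem IsRun.prod_step (hr : IsRun A G q inp lam) {φ f : ℕ} (hφ : φ < q) (hf : f < G.period)
    {p : Pos} (hp : ∀ a, p a < 8 * G.s) :
    lam (31 + φ * G.period + f + 1) p = iter (fun k => prodCon A G f p k fun a =>
      prodLoad G f a (lam (31 + φ * G.period + f) (Function.update p a k))) (8 * G.s)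
      (lam (31 + φ * G.period + f) p) := by
  rw [hr _ p hp]
  have h1 : (φ + 1) * G.period ≤ q * G.period := Nat.mul_le_mul_right _ hφ
  rw [add_mul] at h1
  have e : (31 + φ * G.period + f - 31) % G.period = f := by
    rw [show 31 + φ * G.period + f - 31 = φ * G.period + f by omega, Nat.mul_add_mod_self_right,
      Nat.mod_eq_of_lt hf]
  congr 1
  funext k l
  simp only [roundCon, roundLoad, if_neg (show ¬ 31 + φ * G.period + f = 0 by omega),
    if_neg (show ¬ 31 + φ * G.period + f < 31 by omega),
    if_pos (show 31 + φ * G.period + f < 31 + q * G.period by omega), e]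

/-- The matrix is overwritten only in the last sweep of a product, so all rounds fetch their factors
from the same matrix. -/
theorem IsRun.prod_d (hr : IsRun A G q inp lam) {φ f : ℕ} (hφ : φ < q) (hf : f ≤ 2 * G.E)
    {p : Pos} (hp : ∀ a, p a < 8 * G.s) :
    (lam (31 + φ * G.period + f) p).d = (lam (31 + φ * G.period) p).d := by
  induction f with
  | zero => rfl
  | succ f ih =>
    rw [← add_assoc, ← ih (by omega), hr.prod_step hφ (by rw [Geo.period]; omega) hp]
    refine iter_const Loc.d (fun k l => ?_) _ _
    rw [prodCon, if_neg (by omega)]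
    split_ifs
    · rfl
    · rw [mulCon]
      split_ifs <;> rfl

/-! ### Fetching factors, multiplying blocks and combining the layers -/

theorem IsRun.fetch_step (hr : IsRun A G q inp lam) {φ e : ℕ} (hφ : φ < q) (he : e < G.E)
    {p : Pos} (hp : ∀ a, p a < 8 * G.s) :
    lam (31 + φ * G.period + 2 * e + 1) p = iter (fun k => fetchCon A G e p k fun a =>
      (lam (31 + φ * G.period + 2 * e) (Function.update p a k)).d) (8 * G.s)
      (lam (31 + φ * G.period + 2 * e) p) := by
  rw [hr.prod_step hφ (by rw [Geo.period]; omega) hp]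
  congr 1
  funext k l
  simp only [prodCon, prodLoad, if_neg (show ¬ 2 * e = 2 * G.E by omega),
    if_pos (show 2 * e % 2 = 0 by omega), show 2 * e / 2 = e by omega]

theorem update_lt {S : ℕ} {p : Pos} (hp : ∀ a, p a < S) {k : ℕ} (hk : k < S) (b : Fin 3) :
    ∀ a, Function.update p b k a < S := by
  intro a
  by_cases h : a = b
  · subst h; simpa using hk
  · simpa [h] using hp a

/-- A layer whose number is `I * u + J` modulo u² works for row class I and column class J. For the
middle class K its left factor is the block in layer `I * u + K`, and its right factor (`fetch_b`)
the one in layer `K * u + J`. -/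
theorem IsRun.fetch_a (hr : IsRun A G q inp lam) (hG : G.Valid) {φ e : ℕ} (hφ : φ < q)
    (he : e < G.E) {p : Pos} (hp : ∀ a, p a < 8 * G.s) (hK : midClass G e p < G.u) :
    (lam (31 + φ * G.period + 2 * e + 1) p).a = (lam (31 + φ * G.period)
      (Function.update p 1 (p 1 % (G.u * G.u) / G.u * G.u + midClass G e p))).d := by
  have hu := hG.u_pos
  have hI : p 1 % (G.u * G.u) / G.u < G.u := by
    rw [Nat.div_lt_iff_lt_mul hu]
    exact Nat.mod_lt _ (Nat.mul_pos hu hu)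
  have hc : p 1 % (G.u * G.u) / G.u * G.u + midClass G e p < 8 * G.s :=
    Geo.Valid.layer_lt hI hK (by have := hG.u_sq_le; omega)
  rw [hr.fetch_step hφ he hp, iter_proj Loc.a (g := fun k x =>
    if k = p 1 % (G.u * G.u) / G.u * G.u + midClass G e p then
      (lam (31 + φ * G.period + 2 * e) (Function.update p 1 k)).d else x),
    iter_single (p 1 % (G.u * G.u) / G.u * G.u + midClass G e p), if_pos hc, if_pos rfl,
    hr.prod_d hφ (by omega) (update_lt hp hc 1)]
  · intro k l hk
    rw [if_neg hk]
  · intro k l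
    simp only [fetchCon]

theorem IsRun.fetch_b (hr : IsRun A G q inp lam) (hG : G.Valid) {φ e : ℕ} (hφ : φ < q)
    (he : e < G.E) {p : Pos} (hp : ∀ a, p a < 8 * G.s) (hK : midClass G e p < G.u) :
    (lam (31 + φ * G.period + 2 * e + 1) p).b = (lam (31 + φ * G.period)
      (Function.update p 1 (midClass G e p * G.u + p 1 % G.u))).d := by
  have hu := hG.u_pos
  have hc : midClass G e p * G.u + p 1 % G.u < 8 * G.s :=
    Geo.Valid.layer_lt hK (Nat.mod_lt _ hu) (by have := hG.u_sq_le; omega)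
  rw [hr.fetch_step hφ he hp, iter_proj Loc.b (g := fun k x =>
    if k = midClass G e p * G.u + p 1 % G.u then
      (lam (31 + φ * G.period + 2 * e) (Function.update p 1 k)).d else x),
    iter_single (midClass G e p * G.u + p 1 % G.u), if_pos hc, if_pos rfl,
    hr.prod_d hφ (by omega) (update_lt hp hc 1)]
  · intro k l hk
    rw [if_neg hk]
  · intro k l
    simp only [fetchCon]

theorem IsRun.fetch_c (hr : IsRun A G q inp lam) (hG : G.Valid) {φ e : ℕ} (hφ : φ < q)
    (he : e < G.E) {p : Pos} (hp : ∀ a, p a < 8 * G.s) :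
    (lam (31 + φ * G.period + 2 * e + 1) p).c =
      if e = 0 then ⟨A.bad.eval, 0⟩ else (lam (31 + φ * G.period + 2 * e) p).c := by
  rw [hr.fetch_step hφ he hp]
  split_ifs with h0
  · have hs := hG.s_pos
    obtain ⟨S, hS⟩ : ∃ S, 8 * G.s = S + 1 := ⟨8 * G.s - 1, by omega⟩
    rw [hS]
    simp only [iter, fetchCon, h0, if_true]
  · refine iter_const Loc.c (fun k l => ?_) _ _
    simp only [fetchCon, if_neg h0]

theorem IsRun.mul_step (hr : IsRun A G q inp lam) {φ e : ℕ} (hφ : φ < q) (he : e < G.E)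
    {p : Pos} (hp : ∀ a, p a < 8 * G.s) :
    lam (31 + φ * G.period + 2 * (e + 1)) p = iter (fun k => mulCon A G e p k fun a =>
      if a = 2 then (lam (31 + φ * G.period + 2 * e + 1) (Function.update p a k)).a
      else (lam (31 + φ * G.period + 2 * e + 1) (Function.update p a k)).b) (8 * G.s)
      (lam (31 + φ * G.period + 2 * e + 1) p) := by
  rw [show 31 + φ * G.period + 2 * (e + 1) = 31 + φ * G.period + (2 * e + 1) + 1 by ring,
    hr.prod_step hφ (by rw [Geo.period]; omega) hp]
  congr 1
  funext k l
  simp only [prodCon, prodLoad, if_neg (show ¬ 2 * e + 1 = 2 * G.E by omega),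
    if_neg (show ¬ (2 * e + 1) % 2 = 0 by omega), show (2 * e + 1) / 2 = e by omega]
  rfl

theorem mulCon_eq {e k : ℕ} {p : Pos} {src : Fin 3 → Word} {l : Loc} {v : EReal}
    (h : A.mul.eval (src 2).w (src 0).w = v) : mulCon A G e p k src l =
      open Classical in
      if midClass G e p < G.u ∧ k * G.u + midClass G e p < G.n ∧ A.Better v l.c.w then
        { l with c := ⟨v, k * G.u + midClass G e p + 1⟩ }
      else l := by
  subst h
  rfl

/-- The cell that computes a part of the entry `(i, j)` in the layer `z`. -/
def layerPos (G : Geo) (i j z : ℕ) : Pos := ![i / G.u, z, j / G.u]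

theorem midClass_update {e k : ℕ} {p : Pos} {b : Fin 3} (hb : b ≠ 1) :
    midClass G e (Function.update p b k) = midClass G e p := by
  rw [midClass, midClass, Function.update_of_ne hb.symm]

theorem layerPos_lt (hG : G.Valid) {i j z : ℕ} (hi : i < G.n) (hj : j < G.n) (hz : z < 8 * G.s) :
    ∀ a, layerPos G i j z a < 8 * G.s := by
  have h1 := hG.div_u_lt hi
  have h2 := hG.div_u_lt hj
  intro a
  fin_cases a
  · simp [layerPos]; omega
  · simpa [layerPos]
  · simp [layerPos]; omega

/-- The simultaneous arrival on axes 2 and 0 pairs `(i, k * u + K)` with `(k * u + K, j)`. The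
middle index may exceed the range of vertices here; `mulCon` rejects such candidates. -/
theorem IsRun.mul_src (hr : IsRun A G q inp lam) (hG : G.Valid) {φ e : ℕ} (hφ : φ < q)
    (he : e < G.E) {i j z : ℕ} (hi : i < G.n) (hj : j < G.n) (hz : z < 8 * G.s)
    (hz' : z % (G.u * G.u) = i % G.u * G.u + j % G.u) {k : ℕ} (hk : k < 8 * G.s)
    (hK : midClass G e (layerPos G i j z) < G.u) :
    A.mul.eval
      (lam (31 + φ * G.period + 2 * e + 1) (Function.update (layerPos G i j z) 2 k)).a.w
      (lam (31 + φ * G.period + 2 * e + 1) (Function.update (layerPos G i j z) 0 k)).b.w =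
      candidate A G lam φ i j (k * G.u + midClass G e (layerPos G i j z)) := by
  have hu := hG.u_pos
  have hp := layerPos_lt hG hi hj hz
  have hj' : z % G.u = j % G.u := by
    rw [← Nat.mod_mul_right_mod z G.u G.u, hz', Nat.mul_add_mod_self_right, Nat.mod_mod]
  rw [candidate, entry, entry]
  congr 2
  · rw [hr.fetch_a hG hφ he (update_lt hp hk 2)]
    · rw [midClass_update (by decide)]
      generalize midClass G e (layerPos G i j z) = K at *
      congr 2
      funext a
      fin_cases a
      · simp [layerPos, Geo.pos, Geo.coord0]
      · simp [layerPos, Geo.pos, Geo.coord1, hz', mul_add_div_of_lt (Nat.mod_lt j hu),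
          Nat.mod_eq_of_lt hK]
      · simp [layerPos, Geo.pos, Geo.coord2]
        rw [mul_add_div_of_lt hK]
    · rwa [midClass_update (by decide)]
  · rw [hr.fetch_b hG hφ he (update_lt hp hk 0)]
    · rw [midClass_update (by decide)]
      generalize midClass G e (layerPos G i j z) = K at *
      congr 2
      funext a
      fin_cases a
      · simp [layerPos, Geo.pos, Geo.coord0]
        rw [mul_add_div_of_lt hK]
      · simp [layerPos, Geo.pos, Geo.coord1, hj', Nat.mod_eq_of_lt hK]
      · simp [layerPos, Geo.pos, Geo.coord2]
    · rwa [midClass_update (by decide)]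

/-- The word `c` is the best candidate over the middle classes treated so far by this layer. The
case `e = 0` is exempt because `c` may hold a leftover until the first fetch resets it. -/
theorem IsRun.mul_c (hr : IsRun A G q inp lam) (hG : G.Valid) {φ : ℕ} (hφ : φ < q)
    {i j z : ℕ} (hi : i < G.n) (hj : j < G.n) (hz : z < 8 * G.s)
    (hz' : z % (G.u * G.u) = i % G.u * G.u + j % G.u) {e : ℕ} (he : e ≤ G.E) :
    e = 0 ∨ (A.Improves G.n (candidate A G lam φ i j) ⟨A.bad.eval, 0⟩
        (lam (31 + φ * G.period + 2 * e) (layerPos G i j z)).c ∧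
      ∀ e' < e, ∀ k < G.n, k % G.u = midClass G e' (layerPos G i j z) →
        ¬ A.Better (candidate A G lam φ i j k)
          (lam (31 + φ * G.period + 2 * e) (layerPos G i j z)).c.w) := by
  induction e with
  | zero => exact .inl rfl
  | succ e ih =>
    have hu := hG.u_pos
    have hp := layerPos_lt hG hi hj hz
    have h1 : A.Improves G.n (candidate A G lam φ i j) ⟨A.bad.eval, 0⟩
          (lam (31 + φ * G.period + 2 * e + 1) (layerPos G i j z)).c ∧
        ∀ e' < e, ∀ k < G.n, k % G.u = midClass G e' (layerPos G i j z) →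
          ¬ A.Better (candidate A G lam φ i j k)
            (lam (31 + φ * G.period + 2 * e + 1) (layerPos G i j z)).c.w := by
      rw [hr.fetch_c hG hφ (by omega) hp]
      rcases eq_or_ne e 0 with h0 | h0
      · rw [if_pos h0]
        exact ⟨.inl rfl, fun e' he' => by omega⟩
      · rw [if_neg h0]
        exact (ih (by omega)).resolve_left h0
    refine .inr ?_
    rw [hr.mul_step hφ (by omega) hp]
    have key := iter_induction
      (f := fun k => mulCon A G e (layerPos G i j z) k fun a =>
        if a = 2 then (lam (31 + φ * G.period + 2 * e + 1)
          (Function.update (layerPos G i j z) a k)).a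
        else (lam (31 + φ * G.period + 2 * e + 1) (Function.update (layerPos G i j z) a k)).b)
      (S := 8 * G.s) (l := lam (31 + φ * G.period + 2 * e + 1) (layerPos G i j z))
      (C := fun m l => A.Improves G.n (candidate A G lam φ i j) ⟨A.bad.eval, 0⟩ l.c ∧
        (∀ e' < e, ∀ k < G.n, k % G.u = midClass G e' (layerPos G i j z) →
          ¬ A.Better (candidate A G lam φ i j k) l.c.w) ∧
        ∀ k < G.n, k % G.u = midClass G e (layerPos G i j z) → k / G.u < m →
          ¬ A.Better (candidate A G lam φ i j k) l.c.w)
      ⟨h1.1, h1.2, fun k _ _ h => absurd h (Nat.not_lt_zero _)⟩ ?_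
    · refine ⟨key.1, fun e' he' k hk hk' => ?_⟩
      rcases Nat.lt_succ_iff_lt_or_eq.1 he' with h | rfl
      · exact key.2.1 e' h k hk hk'
      · exact key.2.2 k hk hk' (by have := hG.div_u_lt hk; generalize k / G.u = x at *; omega)
    · rintro m hm l ⟨hl1, hl2, hl3⟩
      by_cases hK : midClass G e (layerPos G i j z) < G.u
      · rw [mulCon_eq (v := candidate A G lam φ i j (m * G.u + midClass G e (layerPos G i j z)))
          (hr.mul_src hG hφ (by omega) hi hj hz hz' hm hK)]
        have cases' : ∀ k < G.n, k % G.u = midClass G e (layerPos G i j z) → k / G.u < m + 1 →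
            k / G.u < m ∨ k = m * G.u + midClass G e (layerPos G i j z) := by
          intro k _ h2 h3
          rcases Nat.lt_succ_iff_lt_or_eq.1 h3 with h4 | h4
          · exact .inl h4
          · right
            rw [← h2, ← h4, Nat.div_add_mod']
        split_ifs with hc
        · refine ⟨hl1.step hc.2.1 hc.2.2, fun e' he' k hk hk' => (hl2 e' he' k hk hk').imp ?_,
            fun k hk hk' hkm => ?_⟩
          · exact fun h => h.trans hc.2.2
          · rcases cases' k hk hk' hkm with h | rfl
            · exact PathAlg.Better.not_of_not (hl3 k hk hk' h) hc.2.2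
            · exact PathAlg.Better.irrefl _
        · refine ⟨hl1, hl2, fun k hk hk' hkm => ?_⟩
          rcases cases' k hk hk' hkm with h | rfl
          · exact hl3 k hk hk' h
          · exact fun h => hc ⟨hK, hk, h⟩
      -- When u is not a multiple of `width`, some layers get a class beyond u in the last round;
      -- they stay idle, and no residue is missed.
      · rw [mulCon, if_neg (fun h => hK h.1)]
        refine ⟨hl1, hl2, fun k hk hk' _ => ?_⟩
        exact absurd (hk' ▸ Nat.mod_lt k hu) hK

theorem IsRun.reduce_step (hr : IsRun A G q inp lam) {φ : ℕ} (hφ : φ < q)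
    {p : Pos} (hp : ∀ a, p a < 8 * G.s) :
    lam (31 + (φ + 1) * G.period) p = iter (fun k => reduceCon A G p k fun a =>
      (lam (31 + φ * G.period + 2 * G.E) (Function.update p a k)).c) (8 * G.s)
      (lam (31 + φ * G.period + 2 * G.E) p) := by
  rw [show 31 + (φ + 1) * G.period = 31 + φ * G.period + 2 * G.E + 1 by rw [Geo.period]; ring,
    hr.prod_step hφ (by rw [Geo.period]; omega) hp]
  congr 1
  funext k l
  simp only [prodCon, prodLoad, if_true]

theorem reduceCon_eq {k : ℕ} {p : Pos} {src : Fin 3 → Word} {l : Loc} {x : Word}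
    (h : src 1 = x) : reduceCon A G p k src l =
      open Classical in
      if k % (G.u * G.u) = p 1 ∧ A.Better x.w l.d.w then { l with d := x } else l := by
  subst h
  rfl

/-- What a matrix product does to an entry. -/
theorem IsRun.entry_succ (hr : IsRun A G q inp lam) (hG : G.Valid)
    (hbad : ∀ x, ¬ A.Better A.bad.eval x) {φ : ℕ} (hφ : φ < q) {i j : ℕ} (hi : i < G.n)
    (hj : j < G.n) :
    A.Improves G.n (candidate A G lam φ i j) (entry G lam φ i j) (entry G lam (φ + 1) i j) ∧
      ∀ k < G.n, ¬ A.Better (candidate A G lam φ i j k) (entry G lam (φ + 1) i j).w := by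
  have hu := hG.u_pos
  have hw := hG.two_le_width
  have hE := hG.u_le_E_mul
  have hE0 : G.E ≠ 0 := by
    intro h
    rw [h] at hE
    omega
  have hp := hG.pos_lt 5 hi hj
  have hp1 : G.pos 5 i j 1 = i % G.u * G.u + j % G.u := rfl
  have hlt : i % G.u * G.u + j % G.u < G.u * G.u := by
    have : (i % G.u + 1) * G.u ≤ G.u * G.u := Nat.mul_le_mul_right _ (Nat.mod_lt i hu)
    have := Nat.mod_lt j hu
    nlinarith
  have hupd : ∀ k, Function.update (G.pos 5 i j) 1 k = layerPos G i j k := by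
    intro k
    funext a
    fin_cases a <;> simp [Geo.pos, layerPos, Geo.coord0, Geo.coord2]
  have hd : (lam (31 + φ * G.period + 2 * G.E) (G.pos 5 i j)).d = entry G lam φ i j :=
    hr.prod_d hφ le_rfl hp
  rw [show entry G lam (φ + 1) i j = (lam (31 + (φ + 1) * G.period) (G.pos 5 i j)).d from rfl,
    hr.reduce_step hφ hp]
  have key := iter_induction
    (f := fun k => reduceCon A G (G.pos 5 i j) k fun a =>
      (lam (31 + φ * G.period + 2 * G.E) (Function.update (G.pos 5 i j) a k)).c)
    (S := 8 * G.s) (l := lam (31 + φ * G.period + 2 * G.E) (G.pos 5 i j))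
    (C := fun m l => A.Improves G.n (candidate A G lam φ i j) (entry G lam φ i j) l.d ∧
      ∀ z < m, z % (G.u * G.u) = i % G.u * G.u + j % G.u → ∀ e < G.E, ∀ k < G.n,
        k % G.u = midClass G e (layerPos G i j z) →
          ¬ A.Better (candidate A G lam φ i j k) l.d.w)
    ⟨.inl hd, fun z hz => by omega⟩ ?_
  · refine ⟨key.1, fun k hk => ?_⟩
    -- The class K = `k % u` is treated by copy `K % width` of the layers, in round `K / width`.
    have hz : k % G.u % G.width * (G.u * G.u) + (i % G.u * G.u + j % G.u) < 8 * G.s := by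
      have h1 : k % G.u % G.width < G.width := Nat.mod_lt _ (by omega)
      have h2 : (k % G.u % G.width + 1) * (G.u * G.u) ≤ G.width * (G.u * G.u) :=
        Nat.mul_le_mul_right _ h1
      have h3 : G.width * (G.u * G.u) ≤ 8 * G.s := Nat.div_mul_le_self _ _
      rw [add_mul] at h2
      omega
    refine key.2 _ hz ?_ (k % G.u / G.width) ?_ k hk ?_
    · rw [Nat.mul_add_mod_self_right, Nat.mod_eq_of_lt hlt]
    · rw [Nat.div_lt_iff_lt_mul (by omega)]
      exact (Nat.mod_lt k hu).trans_le hE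
    · simp only [midClass, layerPos, Matrix.cons_val_one, Matrix.cons_val_zero]
      rw [mul_add_div_of_lt hlt, Nat.div_add_mod']
  · rintro m hm l ⟨hl1, hl2⟩
    rw [reduceCon_eq (x := (lam (31 + φ * G.period + 2 * G.E) (layerPos G i j m)).c)
      (by rw [hupd]), hp1]
    by_cases hz : m % (G.u * G.u) = i % G.u * G.u + j % G.u
    · have hc := (hr.mul_c hG hφ hi hj hm hz le_rfl).resolve_left hE0
      split_ifs with h
      · refine ⟨?_, fun z hz' hzz e he k hk hk' => ?_⟩
        · rcases hc.1 with h0 | ⟨k, hk, h0, _⟩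
          -- A layer that found no candidate still holds the bad value, which cannot win, so the
          -- vertex recorded in a winning word is genuine.
          · rw [h0] at h
            exact absurd h.2 (hbad _)
          · rw [h0] at h ⊢
            exact hl1.step hk h.2
        · rcases Nat.lt_succ_iff_lt_or_eq.1 hz' with hzm | rfl
          · exact PathAlg.Better.not_of_not (hl2 z hzm hzz e he k hk hk') h.2
          · exact hc.2 e he k hk hk'
      · refine ⟨hl1, fun z hz' hzz e he k hk hk' => ?_⟩
        rcases Nat.lt_succ_iff_lt_or_eq.1 hz' with hzm | rfl
        · exact hl2 z hzm hzz e he k hk hk'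
        · intro hb
          have h1 : ¬ A.Better (lam (31 + φ * G.period + 2 * G.E) (layerPos G i j z)).c.w l.d.w :=
            fun h' => h ⟨hz, h'⟩
          have h2 := hc.2 e he k hk hk'
          revert hb h1 h2
          unfold PathAlg.Better
          split_ifs
          · intro a b c
            exact b (a.trans_le (not_lt.1 c))
          · intro a b c
            exact b ((not_lt.1 c).trans_lt a)
    · rw [if_neg (fun h => hz h.1)]
      refine ⟨hl1, fun z hz' hzz => ?_⟩
      rcases Nat.lt_succ_iff_lt_or_eq.1 hz' with hzm | rfl
      · exact hl2 z hzm hzz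
      · exact absurd hzz hz

end Product

end


noncomputable section

/-! ### The size of the numbers -/

/-- The numbers of all words are at most `n`. -/
structure Loc.Bounded (n : ℕ) (l : Loc) : Prop where
  x : l.x.k ≤ n
  v : l.v.k ≤ n
  d : l.d.k ≤ n
  a : l.a.k ≤ n
  b : l.b.k ≤ n
  c : l.c.k ≤ n

/-- The numbers of all words are at most `n`. -/
structure Cell.Bounded (n : ℕ) (c : Cell) : Prop where
  loc : c.loc.Bounded n
  left : ∀ a, (c.left a).k ≤ n
  right : ∀ a, (c.right a).k ≤ n

section Bounded

variable {A : PathAlg} {G : Geo} {κ st e f k q ρ : ℕ} {p : Pos} {src : Fin 3 → Word} {l : Loc}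
  {inp : EReal}

theorem pick_le {n a : ℕ} (hs : ∀ i, (src i).k ≤ n) : (pick a src).k ≤ n := by
  unfold pick
  split_ifs <;> exact hs _

theorem PathAlg.conv_le {n i j : ℕ} {x : Word} (hx : x.k ≤ n) : (A.conv i j x).k ≤ n := by
  unfold PathAlg.conv
  split_ifs
  · exact Nat.zero_le _
  · exact Nat.zero_le _
  · exact hx

theorem Loc.Bounded.inCon {n : ℕ} (hl : l.Bounded n) (hs : ∀ i, (src i).k ≤ n) :
    (inCon A G κ st p k src l).Bounded n := by
  unfold _root_.inCon
  split_ifs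
  · exact ⟨hl.x, pick_le hs, hl.d, hl.a, hl.b, hl.c⟩
  · exact ⟨hl.x, hl.v, PathAlg.conv_le (pick_le hs), hl.a, hl.b, hl.c⟩
  · exact hl
  · exact hl

theorem Loc.Bounded.outCon {n : ℕ} (hl : l.Bounded n) (hs : ∀ i, (src i).k ≤ n) :
    (outCon G κ st p k src l).Bounded n := by
  unfold _root_.outCon
  split_ifs
  · exact ⟨hl.x, pick_le hs, hl.d, hl.a, hl.b, hl.c⟩
  · exact ⟨pick_le hs, hl.v, hl.d, hl.a, hl.b, hl.c⟩
  · exact hl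
  · exact hl

/-- The only new number is a middle index plus one, and `mulCon` has tested that index against `n`.
-/
theorem Loc.Bounded.prodCon (hl : l.Bounded G.n) (hs : ∀ i, (src i).k ≤ G.n) :
    (prodCon A G f p k src l).Bounded G.n := by
  unfold _root_.prodCon
  split_ifs
  · unfold reduceCon
    split_ifs
    · exact ⟨hl.x, hl.v, hs 1, hl.a, hl.b, hl.c⟩
    · exact hl
  · refine ⟨hl.x, hl.v, hl.d, ?_, ?_, ?_⟩ <;> unfold fetchCon <;> dsimp only <;> split_ifs
    exacts [hs 1, hl.a, hs 1, hl.b, Nat.zero_le _, hl.c]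
  · unfold mulCon
    split_ifs with h
    · exact ⟨hl.x, hl.v, hl.d, hl.a, hl.b, h.2.1⟩
    · exact hl

theorem Loc.Bounded.roundCon (hl : l.Bounded G.n) (hs : ∀ i, (src i).k ≤ G.n) :
    (roundCon A G q ρ inp p k src l).Bounded G.n := by
  unfold _root_.roundCon
  split_ifs
  · exact ⟨Nat.zero_le _, hl.v, hl.d, hl.a, hl.b, hl.c⟩
  · exact hl.inCon hs
  · exact hl.prodCon hs
  · exact hl.outCon hs

theorem Loc.Bounded.roundLoad {n : ℕ} (hl : l.Bounded n) (a : Fin 3) :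
    (roundLoad G q ρ a l).k ≤ n := by
  unfold _root_.roundLoad prodLoad
  split_ifs
  exacts [hl.x, hl.v, hl.c, hl.d, hl.a, hl.b, hl.d, hl.v]

end Bounded

theorem cellRun_bounded (A : PathAlg) (n s : ℕ) (inp : Pos → EReal) (t : ℕ) (p : Pos) :
    (cellRun A n s inp t p).Bounded n := by
  induction t generalizing p with
  | zero =>
    exact ⟨⟨Nat.zero_le _, Nat.zero_le _, Nat.zero_le _, Nat.zero_le _, Nat.zero_le _,
      Nat.zero_le _⟩, fun _ => Nat.zero_le _, fun _ => Nat.zero_le _⟩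
  | succ t ih =>
    refine ⟨?_, fun a => ?_, fun a => ?_⟩ <;> simp only [cellRun, cellNext, sweepCell]
    · split_ifs
      · exact Loc.Bounded.roundCon (G := geoAt n s t) (ih p).loc (ih p).right
      · exact (ih p).loc
    · split_ifs
      · exact (ih p).loc.roundLoad a
      · unfold upWord
        split_ifs
        · exact (ih _).left a
        · exact Nat.zero_le _
    · split_ifs
      · exact (ih p).left a
      · unfold downWord
        split_ifs
        · exact (ih _).right a
        · exact Nat.zero_le _

theorem Cell.Bounded.get {n : ℕ} {c : Cell} (h : c.Bounded n) (r : CellReg) : (c.get r).k ≤ n := by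
  rcases r with r | a | a
  · fin_cases r
    exacts [h.loc.x, h.loc.v, h.loc.d, h.loc.a, h.loc.b, h.loc.c]
  · exact h.left a
  · exact h.right a

/-! ### The computed parameters -/

/-- The side of the cube that holds the input. -/
def inputSide (n : ℕ) : ℕ := ⌈(n : ℝ) ^ (2 / 3 : ℝ)⌉₊

theorem rpow_two_thirds_pow_three (n : ℕ) : ((n : ℝ) ^ (2 / 3 : ℝ)) ^ 3 = (n : ℝ) ^ 2 := by
  rw [← Real.rpow_natCast, ← Real.rpow_mul (Nat.cast_nonneg n), ← Real.rpow_natCast]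
  norm_num

/-- The rounded power ⌈n^(2/3)⌉ can thus be found by counting upwards with integer tests. -/
theorem lt_inputSide_iff {n k : ℕ} : k < inputSide n ↔ k * k * k < n * n := by
  have h0 : (0 : ℝ) ≤ (n : ℝ) ^ (2 / 3 : ℝ) := Real.rpow_nonneg (Nat.cast_nonneg n) _
  rw [inputSide, Nat.lt_ceil, ← pow_lt_pow_iff_left₀ (Nat.cast_nonneg k) h0 (n := 3) (by norm_num),
    rpow_two_thirds_pow_three]
  norm_cast
  rw [show k ^ 3 = k * k * k by ring, show n ^ 2 = n * n by ring]

theorem sq_le_inputSide (n : ℕ) :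
    n * n ≤ inputSide n * inputSide n * inputSide n :=
  not_lt.1 fun h => lt_irrefl _ (lt_inputSide_iff.2 h)

theorem inputSide_le (n : ℕ) : inputSide n ≤ n := by
  by_contra h
  push Not at h
  have := lt_inputSide_iff.1 h
  rcases Nat.eq_zero_or_pos n with rfl | hn
  · omega
  · exact absurd this (not_lt.2 (Nat.le_mul_of_pos_right _ hn))

theorem mAt_eq (n t : ℕ) : mAt n t = min t (inputSide n) := by
  induction t with
  | zero => simp [mAt]
  | succ t ih =>
    rw [mAt]
    split_ifs with h
    · have := lt_inputSide_iff.2 h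
      omega
    · have : ¬ mAt n t < inputSide n := fun h' => h (lt_inputSide_iff.1 h')
      omega

/-- Registers start at `0`, so the power of two is stored less one. -/
theorem powAt_succ (n t : ℕ) : powAt n t + 1 = 2 ^ prodAt n t := by
  induction t with
  | zero => rfl
  | succ t ih =>
    rw [powAt, prodAt]
    split_ifs
    · rw [pow_succ, ← ih]
      ring
    · exact ih

theorem prodAt_eq (n t : ℕ) : prodAt n t = min t (Nat.clog 2 n) := by
  induction t with
  | zero => simp [prodAt]
  | succ t ih =>
    rw [prodAt, powAt_succ]
    split_ifs with h
    · have := (Nat.lt_clog_iff_pow_lt one_lt_two).2 h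
      omega
    · have : ¬ prodAt n t < Nat.clog 2 n := fun h' =>
        h ((Nat.lt_clog_iff_pow_lt one_lt_two).1 h')
      omega

theorem powAt_le (n t : ℕ) : powAt n t ≤ 2 * n := by
  induction t with
  | zero => exact Nat.zero_le _
  | succ t ih =>
    rw [powAt]
    split_ifs <;> omega

/-- The parameters of the layout. -/
def meshGeo (n s : ℕ) : Geo := ⟨n, s, inputSide n⟩

theorem meshGeo_valid {n s : ℕ} (hn : 1 ≤ n) (hs : inputSide n ≤ s) : (meshGeo n s).Valid :=
  ⟨hn, sq_le_inputSide n, inputSide_le n, hs⟩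

/-- The number of products is therefore found well within the `32 * s` steps of round `0`. -/
theorem clog_le {n s : ℕ} (hn : n ≤ s * s) : Nat.clog 2 n ≤ 2 * s := by
  refine Nat.clog_le_of_le_pow (hn.trans ?_)
  have := (Nat.lt_two_pow_self (n := s)).le
  calc s * s ≤ 2 ^ s * 2 ^ s := Nat.mul_le_mul this this
    _ = 2 ^ (2 * s) := by rw [← pow_add, two_mul]

theorem Geo.Valid.E_le {G : Geo} (h : G.Valid) : G.E ≤ G.u := by
  have h1 := h.two_le_width
  have h2 := h.u_pos
  rw [Geo.E, ← Nat.lt_succ_iff, Nat.div_lt_iff_lt_mul (by omega), Nat.succ_mul]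
  have h3 : G.u * 1 ≤ G.u * G.width := Nat.mul_le_mul_left _ (by omega)
  omega

/-- The time at which the output is written. -/
def endTime (n s : ℕ) : ℕ := 32 * s * rounds (meshGeo n s) (Nat.clog 2 n)

theorem n_le_sq {n s : ℕ} (hn : 1 ≤ n) (hs : inputSide n ≤ s) : n ≤ s * s :=
  (meshGeo_valid hn hs).n_le.trans (Nat.mul_le_mul hs hs)

/-- A crude bound, needed only to see that the clock fits into a word. -/
theorem endTime_le {n s : ℕ} (hn : 1 ≤ n) (hs : inputSide n ≤ s) : endTime n s ≤ 4096 * s ^ 4 := by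
  have hG := meshGeo_valid hn hs
  have h1 := clog_le (n_le_sq hn hs)
  have h2 := hG.E_le.trans (hG.u_le_m.trans hs)
  have hs1 : 1 ≤ s := hG.s_pos
  have h3 : rounds (meshGeo n s) (Nat.clog 2 n) ≤ 61 + 2 * s * (2 * s + 1) := by
    rw [rounds, Geo.period]
    gcongr
  have h4 : s ≤ s ^ 4 := Nat.le_self_pow (by norm_num) s
  have h5 : s * (s * s) ≤ s ^ 4 := by
    rw [show s * (s * s) = s ^ 3 by ring]
    exact Nat.pow_le_pow_right hs1 (by norm_num)
  have h6 : s * s ≤ s ^ 4 := by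
    rw [show s * s = s ^ 2 by ring]
    exact Nat.pow_le_pow_right hs1 (by norm_num)
  calc endTime n s ≤ 32 * s * (61 + 2 * s * (2 * s + 1)) := Nat.mul_le_mul_left _ h3
    _ = 1952 * s + 128 * (s * (s * s)) + 64 * (s * s) := by ring
    _ ≤ 4096 * s ^ 4 := by omega

/-- With b = 2^(⌊log₂ s³⌋ + 1) one has b > s and b ≥ 2, so b¹⁷ already exceeds 2¹³s⁴; the length
factor 40 is generous. -/
theorem lt_wordSize (A : PathAlg) (s : ℕ) :
    8192 * s ^ 4 < (pathProgram A).wordSize s := by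
  have h1 : s < 2 ^ (Nat.log 2 (s ^ 3) + 1) :=
    (Nat.le_self_pow (by norm_num) s).trans_lt (Nat.lt_pow_succ_log_self one_lt_two _)
  have h2 : 2 ≤ 2 ^ (Nat.log 2 (s ^ 3) + 1) := by
    rw [pow_succ]
    have := Nat.one_le_two_pow (n := Nat.log 2 (s ^ 3))
    omega
  rw [MeshProgram.wordSize, show (pathProgram A).wordLen = 40 from rfl, mul_comm 40, pow_mul]
  generalize 2 ^ (Nat.log 2 (s ^ 3) + 1) = b at *
  calc 8192 * s ^ 4 < 8192 * b ^ 4 :=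
        Nat.mul_lt_mul_of_pos_left (Nat.pow_lt_pow_left h1 (by norm_num)) (by norm_num)
    _ = 2 ^ 13 * b ^ 4 := by norm_num
    _ ≤ b ^ 13 * b ^ 4 := Nat.mul_le_mul_right _ (Nat.pow_le_pow_left h2 13)
    _ = b ^ 17 := by rw [← pow_add]
    _ ≤ b ^ 40 := Nat.pow_le_pow_right (by omega) (by norm_num)

/-! ### The output of the program -/

section Output

variable {n s : ℕ}

/-- The input at a processor. -/
def procInput (X : Fin n → Fin n → EReal) (P : Proc s) : EReal :=
  match entryAt n P with
  | some (i, j) => X i j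
  | none => 0

open Classical in
/-- The input at a cell. -/
def cellInput (s : ℕ) (X : Fin n → Fin n → EReal) (p : Pos) : EReal :=
  if h : ∀ a, p a / 8 < s then
    if ∀ a, p a % 8 = 0 then procInput X (fun a => ⟨p a / 8, h a⟩ : Proc s) else 0
  else 0

theorem cellInput_cellPos (X : Fin n → Fin n → EReal) (P : Proc s) (o : Offset) :
    cellInput s X (cellPos P o) = if o = 0 then procInput X P else 0 := by
  have h1 : ∀ a, cellPos P o a / 8 = P a := by
    intro a
    simp only [cellPos]
    omega
  have h2 : ∀ a, cellPos P o a % 8 = o a := by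
    intro a
    simp only [cellPos]
    omega
  have h3 : (∀ a, (o a : ℕ) = 0) ↔ o = 0 := by
    constructor
    · exact fun h => funext fun a => Fin.ext (h a)
    · rintro rfl a
      rfl
  rw [cellInput, dif_pos (fun a => by rw [h1]; exact (P a).2)]
  simp only [h1, h2, h3]

/-- The memories of a mesh that runs `pathProgram A`. -/
def pathRun (A : PathAlg) (s : ℕ) (X : Fin n → Fin n → EReal) (t : ℕ) : MeshState s :=
  (pathProgram A).run s X t

theorem pathRun_succ (A : PathAlg) (X : Fin n → Fin n → EReal) (t : ℕ) :
    pathRun A s X (t + 1) = meshStep A ((pathProgram A).wordSize s) (pathRun A s X t) :=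
  (Function.iterate_succ_apply' (pathProgram A).step t _).trans (pathProgram_step A _)

theorem init_num_eq_zero (Q : MeshProgram) (X : Fin n → Fin n → EReal) (P : Proc s)
    (r : Fin (Q.numExtra + 7)) (hr : 5 ≤ (r : ℕ)) : (Q.init s X P).num r = 0 := by
  obtain ⟨k, hk⟩ : ∃ k, (r : ℕ) = k + 5 := ⟨r - 5, by omega⟩
  simp only [MeshProgram.init, hk]

theorem init_wt_eq_zero (Q : MeshProgram) (X : Fin n → Fin n → EReal) (P : Proc s)
    (r : Fin (Q.wtExtra + 1)) (hr : r ≠ 0) : (Q.init s X P).wt r = 0 := if_neg hr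

theorem simulates_init (A : PathAlg) (X : Fin n → Fin n → EReal) :
    Simulates A n s (cellInput s X) (procInput X) 0 (pathRun A s X 0) := by
  have hz : ∀ P (r : Fin (dataCard + 4 + 7)), 5 ≤ (r : ℕ) → (pathRun A s X 0 P).num r = 0 :=
    fun P r hr => init_num_eq_zero (pathProgram A) X P r hr
  refine ⟨fun P => rfl, fun P => rfl, fun P a => ?_, fun P => hz _ _ le_rfl,
    fun P => hz _ _ (by norm_num), fun P => hz _ _ (by norm_num),
    fun P => hz _ _ (by norm_num), fun P => hz _ _ (by norm_num), fun P => ?_, fun P o r => ?_⟩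
  · fin_cases a <;> rfl
  · rfl
  · have h1 : (cellRun A n s (cellInput s X) 0 (cellPos P o)).get r = Word.blank := by
      rcases r with r | a | a
      · fin_cases r <;> rfl
      · rfl
      · rfl
    rw [h1]
    refine Word.ext ?_ (hz P (numIx (o, r)) (show 5 ≤ (dataEquiv (o, r) : ℕ) + 11 by omega))
    exact init_wt_eq_zero (pathProgram A) X P (wtIx (o, r))
      (fun h => Nat.succ_ne_zero _ (congrArg Fin.val h))

theorem simulates_run (A : PathAlg) (hn : 1 ≤ n) (hs : inputSide n ≤ s)
    (X : Fin n → Fin n → EReal) (t : ℕ) (ht : t ≤ endTime n s) :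
    Simulates A n s (cellInput s X) (procInput X) t (pathRun A s X t) := by
  have hG := meshGeo_valid hn hs
  have hs1 : 1 ≤ s := hG.s_pos
  have hW := lt_wordSize A s
  have hE := endTime_le hn hs
  have hns : n ≤ s * s := n_le_sq hn hs
  have h4 : s * s ≤ s ^ 4 := by
    rw [show s * s = s ^ 2 by ring]
    exact Nat.pow_le_pow_right hs1 (by norm_num)
  have h5 : s ≤ s ^ 4 := Nat.le_self_pow (by norm_num) s
  have hq : Nat.clog 2 n ≤ 2 * s := clog_le hns
  have hm : inputSide n ≤ n := inputSide_le n
  induction t with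
  | zero => exact simulates_init A X
  | succ t ih =>
    rw [pathRun_succ]
    refine (ih (by omega)).step (W := (pathProgram A).wordSize s)
      (fun P o => cellInput_cellPos X P o) ?_ (by omega) (by omega)
      (by omega) (by rw [mAt_eq]; omega) (by rw [prodAt_eq]; omega)
      (by have := powAt_le n (t + 1); omega)
      (fun p r => ((cellRun_bounded A n s _ _ p).get r).trans_lt (by omega))
    -- While the parameters are being counted, the end time is computed from provisional values. It
    -- is never below `32 * s * 61`, so the program cannot stop too early.
    rcases lt_or_ge t (32 * s) with h' | h'
    · refine h'.trans_le (Nat.le_mul_of_pos_right _ ?_)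
      rw [rounds]
      omega
    · rw [geoAt, mAt_eq, prodAt_eq, min_eq_right (by omega), min_eq_right (by omega)]
      exact ht

/-- The flags are raised by the clock alone, in the same step in which the results are written. This
makes the running time independent of the entries of the input. -/
theorem outputs_of_run (A : PathAlg) (hn : 1 ≤ n) (hs : inputSide n ≤ s)
    (X : Fin n → Fin n → EReal) (D : Fin n → Fin n → EReal) (mid : Fin n → Fin n → ℕ)
    (h : ∀ i j, ∃ P : Proc s, entryAt n P = some (i, j) ∧
      (cellRun A n s (cellInput s X) (endTime n s) (cellPos P 0)).loc.x = ⟨D i j, mid i j⟩) :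
    (pathProgram A).Outputs s X (endTime n s + 1) D mid := by
  have hG := meshGeo_valid hn hs
  have hs1 : 1 ≤ s := hG.s_pos
  have hns : n ≤ s * s := n_le_sq hn hs
  have hm : inputSide n ≤ s := hs
  have hq : Nat.clog 2 n ≤ 2 * s := clog_le hns
  have h4 : s * s ≤ s ^ 4 := by
    rw [show s * s = s ^ 2 by ring]
    exact Nat.pow_le_pow_right hs1 (by norm_num)
  have hW := lt_wordSize A s
  have hT : 32 * s ≤ endTime n s := by
    refine Nat.le_mul_of_pos_right _ ?_
    rw [rounds]
    omega
  have last := (simulates_run A hn hs X (endTime n s) le_rfl).last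
    (W := (pathProgram A).wordSize s)
    (by
      rw [geoAt, mAt_eq, prodAt_eq, min_eq_right (by omega), min_eq_right (by omega)]
      exact le_rfl) (by omega)
    (fun p r => ((cellRun_bounded A n s _ _ p).get r).trans_lt (by omega))
  rw [← pathRun_succ] at last
  have e5 : (5 : Fin (dataCard + 4 + 7)) = ⟨5, by omega⟩ :=
    Fin.ext (Nat.mod_eq_of_lt (show 5 < dataCard + 4 + 7 by omega))
  have e6 : (6 : Fin (dataCard + 4 + 7)) = ⟨6, by omega⟩ :=
    Fin.ext (Nat.mod_eq_of_lt (show 6 < dataCard + 4 + 7 by omega))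
  have h5 : ∀ t (P : Proc s), ((pathProgram A).run s X t P).num 5 =
      (pathRun A s X t P).num ⟨5, by omega⟩ :=
    fun t P => congrArg (pathRun A s X t P).num e5
  have h6 : ∀ t (P : Proc s), ((pathProgram A).run s X t P).num 6 =
      (pathRun A s X t P).num ⟨6, by omega⟩ :=
    fun t P => congrArg (pathRun A s X t P).num e6
  refine ⟨⟨fun P => ?_, fun t ht hH => ?_⟩, fun i j => ?_⟩
  · exact ne_of_eq_of_ne ((h5 _ P).trans (last P).1) one_ne_zero
  · have := (simulates_run A hn hs X t (by omega)).flag_eq (fun _ => ⟨0, by omega⟩)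
    exact hH _ ((h5 _ _).trans this)
  · obtain ⟨P, hP, hx⟩ := h i j
    refine ⟨P, hP, ?_, ?_⟩
    · exact (last P).2.2.trans (congrArg Word.w hx)
    · exact ((h6 _ P).trans (last P).2.1).trans (congrArg Word.k hx)

/-- The processor that holds the entry `(i, j)` of the input. -/
theorem exists_proc (hn : 1 ≤ n) (hs : inputSide n ≤ s) (i j : Fin n) :
    ∃ P : Proc s, entryAt n P = some (i, j) ∧ cellPos P 0 = (meshGeo n s).pos 0 i j := by
  have hG := meshGeo_valid hn hs
  have hm : 1 ≤ inputSide n := hG.m_pos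
  obtain ⟨x, hx⟩ : ∃ x, x = (i : ℕ) * n + j := ⟨_, rfl⟩
  have hxlt : x < n * n := by
    have h1 : ((i : ℕ) + 1) * n ≤ n * n := Nat.mul_le_mul_right _ i.2
    have := j.2
    rw [add_mul] at h1
    omega
  have h0 : x / (inputSide n * inputSide n) < inputSide n := by
    rw [Nat.div_lt_iff_lt_mul (Nat.mul_pos hm hm), ← mul_assoc]
    exact hxlt.trans_le (sq_le_inputSide n)
  have h1 : x / inputSide n % inputSide n < inputSide n := Nat.mod_lt _ hm
  have h2 : x % inputSide n < inputSide n := Nat.mod_lt _ hm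
  have e : (x / (inputSide n * inputSide n) * inputSide n + x / inputSide n % inputSide n) *
      inputSide n + x % inputSide n = x := by
    rw [← Nat.div_div_eq_div_mul, Nat.div_add_mod', Nat.div_add_mod']
  have e1 : x / n = i := by rw [hx, mul_add_div_of_lt j.2]
  have e2 : x % n = j := by rw [hx, Nat.mul_add_mod_self_right, Nat.mod_eq_of_lt j.2]
  refine ⟨![⟨_, h0.trans_le hs⟩, ⟨_, h1.trans_le hs⟩, ⟨_, h2.trans_le hs⟩], ?_, ?_⟩
  · unfold entryAt
    refine (dif_pos ⟨⟨h0, h1, h2⟩, e.trans_lt hxlt⟩).trans ?_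
    refine congrArg some (Prod.ext ?_ ?_)
    · exact Fin.ext ((congrArg (· / n) e).trans e1)
    · exact Fin.ext ((congrArg (· % n) e).trans e2)
  · subst hx
    funext a
    fin_cases a <;> simp [cellPos, Geo.pos, Geo.coord0, Geo.coord1, Geo.coord2, meshGeo]

/-- The output of the program is the result of repeated products, beginning with the converted
input. -/
theorem exists_entries (A : PathAlg) (hbad : ∀ x, ¬ A.Better A.bad.eval x) (hn : 1 ≤ n)
    (hs : inputSide n ≤ s) (X : Fin n → Fin n → EReal) :
    ∃ ent : ℕ → ℕ → ℕ → Word,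
      (∀ i j : Fin n, ent 0 i j = A.conv i j ⟨X i j, 0⟩) ∧
      (∀ φ < Nat.clog 2 n, ∀ i < n, ∀ j < n,
        A.Improves n (fun k => A.mul.eval (ent φ i k).w (ent φ k j).w) (ent φ i j)
          (ent (φ + 1) i j) ∧
        ∀ k < n, ¬ A.Better (A.mul.eval (ent φ i k).w (ent φ k j).w) (ent (φ + 1) i j).w) ∧
      (pathProgram A).Outputs s X (endTime n s + 1) (fun i j => (ent (Nat.clog 2 n) i j).w)
        (fun i j => (ent (Nat.clog 2 n) i j).k) := by
  have hG := meshGeo_valid hn hs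
  have hs1 : 1 ≤ s := hG.s_pos
  have hns : n ≤ s * s := n_le_sq hn hs
  have hq : Nat.clog 2 n ≤ 2 * s := clog_le hns
  have hr : IsRun A (meshGeo n s) (Nat.clog 2 n) (cellInput s X)
      fun ρ p => (cellRun A n s (cellInput s X) (32 * s * ρ) p).loc :=
    isRun_cellRun A (m := inputSide n) (cellInput s X) (fun t ht => by rw [mAt_eq]; omega)
      (fun t ht => by rw [prodAt_eq]; omega)
  refine ⟨entry (meshGeo n s) fun ρ p => (cellRun A n s (cellInput s X) (32 * s * ρ) p).loc,
    fun i j => ?_, fun φ hφ i hi j hj => hr.entry_succ hG hbad hφ hi hj, ?_⟩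
  · have h1 := hr.in_d hG i.2 j.2
    obtain ⟨P, hP, hpos⟩ := exists_proc hn hs i j
    rw [← hpos, cellInput_cellPos, if_pos rfl, procInput, hP] at h1
    rw [← h1, entry, zero_mul, add_zero]
  · refine outputs_of_run A hn hs X _ _ fun i j => ?_
    obtain ⟨P, hP, hpos⟩ := exists_proc hn hs i j
    refine ⟨P, hP, ?_⟩
    rw [hpos]
    exact hr.out_x hG i.2 j.2

end Output

end


noncomputable section

/-! ### Optimal paths -/

theorem WtOp.eval_assoc (op : WtOp) (x y z : EReal) :
    op.eval (op.eval x y) z = op.eval x (op.eval y z) := by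
  cases op
  · exact add_assoc x y z
  · exact inf_assoc x y z
  · exact sup_assoc x y z

theorem WtOp.eval_mono (op : WtOp) {x x' y y' : EReal} (hx : x ≤ x') (hy : y ≤ y') :
    op.eval x y ≤ op.eval x' y' := by
  cases op
  · exact add_le_add hx hy
  · exact inf_le_inf hx hy
  · exact sup_le_sup hx hy

namespace PathAlg

variable {A : PathAlg}

/-- The value `x` is at least as good as `y`. -/
def AsGood (A : PathAlg) (x y : EReal) : Prop := ¬ A.Better y x

theorem asGood_iff {x y : EReal} : A.AsGood x y ↔ if A.rev then y ≤ x else x ≤ y := by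
  unfold AsGood Better
  split_ifs <;> exact not_lt

theorem AsGood.refl (x : EReal) : A.AsGood x x := Better.irrefl x

theorem AsGood.trans {x y z : EReal} (h : A.AsGood x y) (h' : A.AsGood y z) : A.AsGood x z := by
  rw [asGood_iff] at *
  split_ifs at *
  · exact h'.trans h
  · exact h.trans h'

theorem AsGood.antisymm {x y : EReal} (h : A.AsGood x y) (h' : A.AsGood y x) : x = y := by
  rw [asGood_iff] at *
  split_ifs at *
  · exact le_antisymm h' h
  · exact le_antisymm h h'

theorem AsGood.mul {x x' y y' : EReal} (hx : A.AsGood x x') (hy : A.AsGood y y') :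
    A.AsGood (A.mul.eval x y) (A.mul.eval x' y') := by
  rw [asGood_iff] at *
  split_ifs at * <;> exact WtOp.eval_mono _ hx hy

end PathAlg

/-! ### Cutting and splitting paths -/

namespace DiPath

variable {n : ℕ} {G : WDigraph n}

/-- The number of edges of a path. -/
def edges : {i j : Fin n} → DiPath G i j → ℕ
  | _, _, nil _ => 0
  | _, _, cons _ _ p => p.edges + 1

/-- The vertices of a path. -/
def support : {i j : Fin n} → DiPath G i j → List (Fin n)
  | _, _, nil i => [i]
  | i, _, cons _ _ p => i :: p.support

theorem length_support {i j : Fin n} (p : DiPath G i j) : p.support.length = p.edges + 1 := by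
  induction p with
  | nil => rfl
  | cons c h p ih => simp [support, edges, ih]

theorem exists_append_of_mem {i j v : Fin n} (p : DiPath G i j) (hv : v ∈ p.support) :
    ∃ (a : DiPath G i v) (r : DiPath G v j), p = a.append r ∧ r.support <:+ p.support := by
  induction p with
  | nil i =>
    obtain rfl : v = i := by simpa [support] using hv
    exact ⟨nil v, nil v, rfl, List.suffix_refl _⟩
  | @cons i k j c h p ih =>
    rcases List.mem_cons.1 hv with rfl | hv'
    · exact ⟨nil v, cons c h p, rfl, List.suffix_refl _⟩
    · obtain ⟨a, r, e, hs⟩ := ih hv'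
      exact ⟨cons c h a, r, by rw [e]; rfl, hs.trans (List.suffix_cons _ _)⟩

theorem exists_append_of_edges_le {i j : Fin n} (p : DiPath G i j) {a b : ℕ}
    (h : p.edges ≤ a + b) : ∃ (k : Fin n) (p₁ : DiPath G i k) (p₂ : DiPath G k j),
      p = p₁.append p₂ ∧ p₁.edges ≤ a ∧ p₂.edges ≤ b := by
  induction p generalizing a with
  | nil i => exact ⟨i, nil i, nil i, rfl, Nat.zero_le _, Nat.zero_le _⟩
  | @cons i k j c hc p ih =>
    rcases a with - | a
    · exact ⟨i, nil i, cons c hc p, rfl, Nat.zero_le _, by simpa using h⟩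
    · obtain ⟨k', p₁, p₂, e, h1, h2⟩ := ih (a := a) (by simp only [edges] at h; omega)
      exact ⟨k', cons c hc p₁, p₂, by rw [e]; rfl, by simpa [edges] using h1, h2⟩

/-- The value of a path. -/
def val (A : PathAlg) : {i j : Fin n} → DiPath G i j → EReal
  | _, _, nil _ => A.unit.eval
  | _, _, cons c _ p => A.mul.eval c (p.val A)

end DiPath

open DiPath

/-- The properties of `A` that make repeated products find optimal paths in `G`. -/
structure PathAlg.Suits (A : PathAlg) {n : ℕ} (G : WDigraph n) : Prop where
  unit_mul : ∀ x, A.mul.eval A.unit.eval x = x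
  mul_unit : ∀ x, A.mul.eval x A.unit.eval = x
  bad_mul : ∀ {i j} (p : DiPath G i j), A.mul.eval A.bad.eval (p.val A) = A.bad.eval
  mul_bad : ∀ {i j} (p : DiPath G i j), A.mul.eval (p.val A) A.bad.eval = A.bad.eval
  bad_mul_bad : A.mul.eval A.bad.eval A.bad.eval = A.bad.eval
  not_better : ∀ x, ¬ A.Better A.bad.eval x
  closed : ∀ {i} (p : DiPath G i i), A.AsGood A.unit.eval (p.val A)
  val_ne_bad : ∀ {i j} (p : DiPath G i j), p.val A ≠ A.bad.eval

/-- The matrices `ent φ` come from the edges of `G` by repeated products. -/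
structure IsClosure (A : PathAlg) {n : ℕ} (G : WDigraph n) (q : ℕ)
    (ent : ℕ → Fin n → Fin n → Word) : Prop where
  diag : ∀ i, ent 0 i i = ⟨A.unit.eval, 0⟩
  edge : ∀ i j, i ≠ j → ent 0 i j = ⟨(G i j).elim A.bad.eval (fun c => (c : EReal)), 0⟩
  improves : ∀ φ < q, ∀ i j, ent (φ + 1) i j = ent φ i j ∨
    ∃ k : Fin n, ent (φ + 1) i j = ⟨A.mul.eval (ent φ i k).w (ent φ k j).w, k + 1⟩ ∧
      A.Better (A.mul.eval (ent φ i k).w (ent φ k j).w) (ent φ i j).w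
  asGood : ∀ φ < q, ∀ i j k,
    A.AsGood (ent (φ + 1) i j).w (A.mul.eval (ent φ i k).w (ent φ k j).w)

/-! ### Repeated squaring finds optimal paths -/

section Closure

variable {A : PathAlg} {n : ℕ} {G : WDigraph n} {q : ℕ} {ent : ℕ → Fin n → Fin n → Word}

theorem PathAlg.Suits.val_append (hA : A.Suits G) {i k j : Fin n} (p : DiPath G i k)
    (p' : DiPath G k j) : (p.append p').val A = A.mul.eval (p.val A) (p'.val A) := by
  induction p with
  | nil => exact (hA.unit_mul _).symm
  | cons c h p ih => rw [append, val, val, ih, WtOp.eval_assoc]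

theorem PathAlg.Suits.bad_of_asGood (hA : A.Suits G) {x : EReal} (h : A.AsGood A.bad.eval x) :
    x = A.bad.eval := (h.antisymm (hA.not_better x)).symm

/-- Every path can be replaced by one without repeated vertices. -/
theorem PathAlg.Suits.exists_nodup (hA : A.Suits G) {i j : Fin n} (p : DiPath G i j) :
    ∃ p' : DiPath G i j, p'.support.Nodup ∧ A.AsGood (p'.val A) (p.val A) := by
  induction p with
  | nil i => exact ⟨nil i, List.nodup_singleton i, .refl _⟩
  | @cons i k j c h p ih =>
    obtain ⟨p', hp', hv⟩ := ih
    have hv' : A.AsGood ((cons c h p').val A) ((cons c h p).val A) :=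
      PathAlg.AsGood.mul (.refl _) hv
    by_cases hi : i ∈ p'.support
    -- The first vertex recurs. The closed part before `r` has a value no better than that of the
    -- empty path, so it can be dropped.
    · obtain ⟨a, r, rfl, hs⟩ := p'.exists_append_of_mem hi
      refine ⟨r, hp'.sublist hs.sublist, ?_⟩
      have h1 : (cons c h (a.append r)).val A = A.mul.eval ((cons c h a).val A) (r.val A) :=
        hA.val_append (cons c h a) r
      have h2 := PathAlg.AsGood.mul (hA.closed (cons c h a)) (.refl (r.val A))
      rw [hA.unit_mul, ← h1] at h2
      exact h2.trans hv'
    · exact ⟨cons c h p', List.nodup_cons.2 ⟨hi, hp'⟩, hv'⟩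

theorem PathAlg.Suits.exists_edges_lt (hA : A.Suits G) {i j : Fin n} (p : DiPath G i j) :
    ∃ p' : DiPath G i j, p'.edges < n ∧ A.AsGood (p'.val A) (p.val A) := by
  obtain ⟨p', hp', hv⟩ := hA.exists_nodup p
  refine ⟨p', ?_, hv⟩
  have := hp'.length_le_card
  rwa [length_support, Fintype.card_fin] at this

/-- One half of correctness: no entry is better than what a path achieves. The other half is
`asGood_path`. -/
theorem IsClosure.sound (h : IsClosure A G q ent) (hA : A.Suits G) {φ : ℕ} (hφ : φ ≤ q)
    (i j : Fin n) : (ent φ i j).w = A.bad.eval ∨ ∃ p : DiPath G i j, p.val A = (ent φ i j).w := by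
  induction φ generalizing i j with
  | zero =>
    by_cases hij : i = j
    · subst hij
      rw [h.diag]
      exact .inr ⟨nil i, rfl⟩
    · rw [h.edge i j hij]
      rcases hG : G i j with - | c
      · exact .inl rfl
      · exact .inr ⟨cons c hG (nil j), hA.mul_unit _⟩
  | succ φ ih =>
    rcases h.improves φ (by omega) i j with e | ⟨k, e, -⟩
    · rw [e]
      exact ih (by omega) i j
    · rw [e]
      rcases ih (by omega) i k with e1 | ⟨p, e1⟩ <;> rcases ih (by omega) k j with e2 | ⟨p', e2⟩
      · exact .inl (by simp only [e1, e2, hA.bad_mul_bad])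
      · exact .inl (by simp only [e1, ← e2, hA.bad_mul])
      · exact .inl (by simp only [← e1, e2, hA.mul_bad])
      · exact .inr ⟨p.append p', by rw [hA.val_append, e1, e2]⟩

/-- A path with at most 2^(φ+1) edges is cut into two with at most 2^φ edges each, and the product
offers their middle vertex as a candidate. -/
theorem IsClosure.asGood_path (h : IsClosure A G q ent) (hA : A.Suits G) {φ : ℕ} (hφ : φ ≤ q)
    {i j : Fin n} (p : DiPath G i j) (hp : p.edges ≤ 2 ^ φ) :
    A.AsGood (ent φ i j).w (p.val A) := by
  induction φ generalizing i j with
  | zero =>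
    cases p with
    | nil =>
      rw [h.diag]
      exact .refl _
    | cons c hc p =>
      cases p with
      | nil =>
        by_cases hij : i = j
        -- The diagonal ignores loops, and no loop is better than the empty path.
        · subst hij
          rw [h.diag]
          exact hA.closed _
        · rw [h.edge i j hij, hc, val, val, hA.mul_unit]
          exact .refl _
      | cons c' hc' p => simp [edges] at hp
  | succ φ ih =>
    rw [pow_succ, mul_two] at hp
    obtain ⟨k, p₁, p₂, rfl, h1, h2⟩ := p.exists_append_of_edges_le hp
    rw [hA.val_append]
    exact (h.asGood φ (by omega) i j k).trans
      (PathAlg.AsGood.mul (ih (by omega) p₁ h1) (ih (by omega) p₂ h2))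

/-- The last matrix has the optimal values. -/
theorem IsClosure.optimal (h : IsClosure A G q ent) (hA : A.Suits G) (hq : n ≤ 2 ^ q)
    {i j : Fin n} (p : DiPath G i j) : A.AsGood (ent q i j).w (p.val A) := by
  obtain ⟨p', hp', hv⟩ := hA.exists_edges_lt p
  exact (h.asGood_path hA le_rfl p' (by omega)).trans hv

theorem IsClosure.ne_bad (h : IsClosure A G q ent) (hA : A.Suits G) (hq : n ≤ 2 ^ q)
    {i j : Fin n} (p : DiPath G i j) : (ent q i j).w ≠ A.bad.eval := fun e =>
  hA.val_ne_bad p (hA.bad_of_asGood (e ▸ h.optimal hA hq p))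

/-- Since words change only by strict improvement, an entry that has reached its final value keeps
its recorded vertex as well; this is `eq_last`. -/
theorem IsClosure.eq_or_better (h : IsClosure A G q ent) {φ ψ : ℕ} (hφ : φ ≤ ψ) (hψ : ψ ≤ q)
    (i j : Fin n) : ent ψ i j = ent φ i j ∨ A.Better (ent ψ i j).w (ent φ i j).w := by
  induction ψ, hφ using Nat.le_induction with
  | base => exact .inl rfl
  | succ ψ hφ ih =>
    rcases h.improves ψ (by omega) i j with e | ⟨k, e, hb⟩
    · rw [e]
      exact ih (by omega)
    · right
      rw [e]
      rcases ih (by omega) with e' | hb'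
      · rwa [← e']
      · exact hb.trans hb'

theorem IsClosure.eq_last (h : IsClosure A G q ent) {φ : ℕ} (hφ : φ ≤ q) {i j : Fin n}
    (e : (ent φ i j).w = (ent q i j).w) : ent q i j = ent φ i j :=
  (h.eq_or_better hφ le_rfl i j).resolve_right (by rw [e]; exact PathAlg.Better.irrefl _)

theorem IsClosure.diag_last (h : IsClosure A G q ent) (hA : A.Suits G) (i : Fin n) :
    ent q i i = ⟨A.unit.eval, 0⟩ := by
  rw [← h.diag i]
  refine (h.eq_or_better (Nat.zero_le q) le_rfl i i).resolve_right fun hb => ?_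
  rw [h.diag] at hb
  rcases h.sound hA le_rfl i i with e | ⟨p, e⟩
  · rw [e] at hb
    exact hA.not_better _ hb
  · rw [← e] at hb
    exact hA.closed p hb

/-- The table describes an optimal path, if the splitting of paths is well-founded. -/
theorem IsClosure.exists_fromTable (h : IsClosure A G q ent) (hA : A.Suits G) (hq : n ≤ 2 ^ q)
    (μ : Fin n → Fin n → ℕ)
    (hμ : ∀ {i k j} (p : DiPath G i k) (p' : DiPath G k j),
      (p.append p').val A = (ent q i j).w →
      (μ i k < μ i j ∨ μ i k ≤ μ i j ∧ p.val A = (ent q i k).w) ∧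
      (μ k j < μ i j ∨ μ k j ≤ μ i j ∧ p'.val A = (ent q k j).w))
    {i j : Fin n} (hij : (ent q i j).w ≠ A.bad.eval) :
    ∃ p : DiPath G i j, FromTable (fun i j => (ent q i j).k) p ∧ p.val A = (ent q i j).w := by
  -- The induction is lexicographic: on the measure `μ`, then on a stage `φ` at which the entry has
  -- its final value. A half whose value was already final at stage `φ` goes down in `φ`; one that
  -- improves later must have smaller `μ` and may start again from `q`.
  have key : ∀ (c φ : ℕ) (i j : Fin n), μ i j ≤ c → φ ≤ q → (ent φ i j).w = (ent q i j).w →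
      (ent q i j).w ≠ A.bad.eval →
      ∃ p : DiPath G i j, FromTable (fun i j => (ent q i j).k) p ∧ p.val A = (ent q i j).w := by
    intro c
    induction c using Nat.strong_induction_on with
    | _ c ihc =>
      intro φ
      induction φ with
      | zero =>
        intro i j _ hφ e hb
        by_cases hij : i = j
        · subst hij
          exact ⟨nil i, .nil i, by rw [h.diag_last hA]; rfl⟩
        · have e' := h.eq_last hφ e
          rw [h.edge i j hij] at e'
          rcases hG : G i j with - | c
          · rw [hG] at e'
            exact absurd (congrArg Word.w e') hb
          · rw [hG] at e'
            refine ⟨cons c hG (nil j), .edge c hG hij ?_, ?_⟩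
            · rw [e']
            · rw [e']
              exact hA.mul_unit _
      | succ φ ih =>
        intro i j hc hφ e hb
        by_cases hij : i = j
        · subst hij
          exact ⟨nil i, .nil i, by rw [h.diag_last hA]; rfl⟩
        rcases h.improves φ (by omega) i j with e1 | ⟨k, e1, -⟩
        · exact ih i j hc (by omega) (by rw [← e, e1]) hb
        · have e' := (h.eq_last hφ e).trans e1
          have hw : A.mul.eval (ent φ i k).w (ent φ k j).w = (ent q i j).w := by rw [e']
          obtain ⟨p, hp⟩ : ∃ p : DiPath G i k, p.val A = (ent φ i k).w := by
            refine (h.sound hA (by omega) i k).resolve_left fun h1 => hb ?_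
            rw [← hw, h1]
            rcases h.sound hA (by omega : φ ≤ q) k j with h2 | ⟨p', h2⟩
            · rw [h2, hA.bad_mul_bad]
            · rw [← h2, hA.bad_mul]
          obtain ⟨p', hp'⟩ : ∃ p' : DiPath G k j, p'.val A = (ent φ k j).w := by
            refine (h.sound hA (by omega) k j).resolve_left fun h1 => hb ?_
            rw [← hw, h1, ← hp, hA.mul_bad]
          have hv : (p.append p').val A = (ent q i j).w := by rw [hA.val_append, hp, hp', hw]
          obtain ⟨h1, h2⟩ := hμ p p' hv
          have part : ∀ {a b : Fin n} (r : DiPath G a b), r.val A = (ent φ a b).w →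
              (μ a b < μ i j ∨ μ a b ≤ μ i j ∧ r.val A = (ent q a b).w) →
              ∃ p : DiPath G a b, FromTable (fun i j => (ent q i j).k) p ∧
                p.val A = (ent q a b).w := by
            rintro a b r hr (hlt | ⟨hle, hr'⟩)
            · exact ihc (μ a b) (by omega) q a b le_rfl le_rfl rfl (h.ne_bad hA hq r)
            · exact ih a b (by omega) (by omega) (by rw [← hr, hr']) (h.ne_bad hA hq r)
          obtain ⟨r, hr, er⟩ := part p hp h1
          obtain ⟨r', hr', er'⟩ := part p' hp' h2
          refine ⟨r.append r', .split hij (congrArg Word.k e') hr hr', ?_⟩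
          -- The table may give better halves than `p` and `p'`, so the new path is at least as good
          -- as the old one, and optimality forces equal values.
          refine PathAlg.AsGood.antisymm ?_ (h.optimal hA hq _)
          rw [← hv, hA.val_append, hA.val_append, er, er']
          exact PathAlg.AsGood.mul (h.optimal hA hq p) (h.optimal hA hq p')
  exact key (μ i j) q i j le_rfl le_rfl rfl hij

end Closure

/-! ### Shortest paths -/

/-- The operations for shortest paths. -/
def shortestAlg (adj : Bool) : PathAlg := ⟨.add, false, .top, .zero, adj⟩

section Shortest

variable {n : ℕ} {G : WDigraph n} {adj : Bool}

theorem val_shortest {i j : Fin n} (p : DiPath G i j) :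
    p.val (shortestAlg adj) = (p.length : EReal) := by
  induction p with
  | nil => exact EReal.coe_zero.symm
  | cons c h p ih =>
    rw [val, ih, DiPath.length, EReal.coe_add]
    rfl

theorem asGood_shortest {x y : EReal} : (shortestAlg adj).AsGood x y ↔ x ≤ y :=
  PathAlg.asGood_iff

theorem suits_shortest (hG : G.NoNegativeCycle) : (shortestAlg adj).Suits G where
  unit_mul x := zero_add x
  mul_unit x := add_zero x
  bad_mul p := by
    rw [val_shortest]
    exact EReal.top_add_coe _
  mul_bad p := by
    rw [val_shortest]
    exact EReal.coe_add_top _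
  bad_mul_bad := rfl
  not_better x := asGood_shortest.2 le_top
  closed p := by
    rw [asGood_shortest, val_shortest]
    exact EReal.coe_nonneg.2 (hG _ p)
  val_ne_bad p := by
    rw [val_shortest]
    exact EReal.coe_ne_top _

/-- If two paths compose to a shortest one, each of them is shortest, because finite lengths can be
cancelled. The values of the halves are thus already final, and the measure can be constant. -/
theorem isAPSP_of_isClosure (hG : G.NoNegativeCycle) {q : ℕ} (hq : n ≤ 2 ^ q)
    {ent : ℕ → Fin n → Fin n → Word} (h : IsClosure (shortestAlg adj) G q ent) :
    IsAPSP G (fun i j => (ent q i j).w) (fun i j => (ent q i j).k) := by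
  have hA := suits_shortest (adj := adj) hG
  have hne : ∀ {i j} (p : DiPath G i j), ∃ p' : DiPath G i j,
      p'.val (shortestAlg adj) = (ent q i j).w := fun {i j} p =>
    (h.sound hA le_rfl i j).resolve_left (h.ne_bad hA hq p)
  intro i j
  by_cases hb : (ent q i j).w = (shortestAlg adj).bad.eval
  · exact .inr ⟨⟨fun p => h.ne_bad hA hq p hb⟩, hb⟩
  · obtain ⟨p, hp, hv⟩ := h.exists_fromTable hA hq (fun _ _ => 0) (fun {i k j} p p' e => by
      obtain ⟨r, hr⟩ := hne p
      obtain ⟨r', hr'⟩ := hne p'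
      have h1 := h.optimal hA hq p
      have h2 := h.optimal hA hq p'
      have h3 := h.optimal hA hq (r.append r')
      rw [← e] at h3
      rw [← hr] at h1 ⊢
      rw [← hr'] at h2 ⊢
      rw [hA.val_append, hA.val_append] at h3
      simp only [asGood_shortest, val_shortest] at *
      have h3' : ((p.length + p'.length : ℝ) : EReal) ≤ ((r.length + r'.length : ℝ) : EReal) := by
        rw [EReal.coe_add, EReal.coe_add]
        exact h3
      rw [EReal.coe_le_coe_iff] at h1 h2 h3'
      rw [EReal.coe_eq_coe_iff, EReal.coe_eq_coe_iff]
      exact ⟨.inr ⟨le_rfl, by linarith⟩, .inr ⟨le_rfl, by linarith⟩⟩) hb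
    refine .inl ⟨p, hp, fun p' => ?_, ?_⟩
    · have := h.optimal hA hq p'
      rw [asGood_shortest, ← hv, val_shortest, val_shortest] at this
      exact EReal.coe_le_coe_iff.1 this
    · dsimp only
      rw [← hv, val_shortest]

end Shortest

/-! ### Widest paths -/

/-- The operations for widest paths. -/
def widestAlg (adj : Bool) : PathAlg := ⟨.min, true, .bot, .top, adj⟩

section Widest

variable {n : ℕ} {G : WDigraph n} {adj : Bool}

theorem val_widest {i j : Fin n} (p : DiPath G i j) : p.val (widestAlg adj) = p.width := by
  induction p with
  | nil => rfl
  | cons c h p ih =>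
    rw [val, ih, DiPath.width]
    rfl

theorem asGood_widest {x y : EReal} : (widestAlg adj).AsGood x y ↔ y ≤ x :=
  PathAlg.asGood_iff

theorem DiPath.width_ne_bot {i j : Fin n} (p : DiPath G i j) : p.width ≠ ⊥ := by
  induction p with
  | nil => exact top_ne_bot
  | cons c h p ih =>
    rw [width, ← bot_lt_iff_ne_bot, lt_inf_iff]
    exact ⟨EReal.bot_lt_coe c, bot_lt_iff_ne_bot.2 ih⟩

theorem suits_widest (adj : Bool) (G : WDigraph n) : (widestAlg adj).Suits G where
  unit_mul x := top_inf_eq x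
  mul_unit x := inf_top_eq x
  bad_mul p := bot_inf_eq _
  mul_bad p := inf_bot_eq _
  bad_mul_bad := inf_bot_eq _
  not_better x := asGood_widest.2 bot_le
  closed p := asGood_widest.2 le_top
  val_ne_bad p := by
    rw [val_widest]
    exact p.width_ne_bot

/-- Minima cannot be cancelled: a half of a widest path need not be widest. Then, however, the final
width of the half exceeds that of the whole, and fewer pairs are strictly wider, so the number of
these pairs serves as measure. -/
theorem isAPBP_of_isClosure {q : ℕ} (hq : n ≤ 2 ^ q)
    {ent : ℕ → Fin n → Fin n → Word} (h : IsClosure (widestAlg adj) G q ent) :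
    IsAPBP G (fun i j => (ent q i j).w) (fun i j => (ent q i j).k) := by
  classical
  have hA := suits_widest adj G
  have hle : ∀ {i j} (p : DiPath G i j), p.width ≤ (ent q i j).w := fun {i j} p => by
    have := h.optimal hA hq p
    rwa [asGood_widest, val_widest] at this
  let wider (i j : Fin n) : Finset (Fin n × Fin n) :=
    Finset.univ.filter fun x => (ent q i j).w < (ent q x.1 x.2).w
  have part : ∀ {a b i j : Fin n} (r : DiPath G a b), (ent q i j).w ≤ r.width →
      (wider a b).card < (wider i j).card ∨
        (wider a b).card ≤ (wider i j).card ∧ r.width = (ent q a b).w := by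
    intro a b i j r hr
    have hsub : wider a b ⊆ wider i j := fun x hx => by
      simp only [wider, Finset.mem_filter, Finset.mem_univ, true_and] at hx ⊢
      exact (hr.trans (hle r)).trans_lt hx
    rcases (hr.trans (hle r)).lt_or_eq with hlt | heq
    -- The inclusion is strict because of the pair `(a, b)` itself.
    · refine .inl (Finset.card_lt_card (Finset.ssubset_iff_of_subset hsub |>.2 ⟨(a, b), ?_, ?_⟩))
      · simpa [wider] using hlt
      · simp [wider]
    · exact .inr ⟨Finset.card_le_card hsub, (hle r).antisymm (heq ▸ hr)⟩
  intro i j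
  by_cases hb : (ent q i j).w = (widestAlg adj).bad.eval
  · exact .inr ⟨⟨fun p => h.ne_bad hA hq p hb⟩, hb⟩
  · obtain ⟨p, hp, hv⟩ := h.exists_fromTable hA hq (fun i j => (wider i j).card)
      (fun {i k j} p p' e => by
        rw [hA.val_append, val_widest, val_widest] at e
        rw [val_widest, val_widest]
        exact ⟨part p (e ▸ inf_le_left), part p' (e ▸ inf_le_right)⟩) hb
    rw [val_widest] at hv
    exact .inl ⟨p, hp, fun p' => hv ▸ hle p', hv.symm⟩

end Widest

/-! ### The program solves the path problems -/

theorem exists_isClosure (A : PathAlg) {n s : ℕ} (hn : 1 ≤ n) (hs : inputSide n ≤ s)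
    {G : WDigraph n} (hA : A.Suits G) (X : Fin n → Fin n → EReal)
    (hX : ∀ i j : Fin n, i ≠ j → A.conv i j ⟨X i j, 0⟩ =
      ⟨(G i j).elim A.bad.eval (fun c => (c : EReal)), 0⟩) :
    ∃ ent, IsClosure A G (Nat.clog 2 n) ent ∧
      (pathProgram A).Outputs s X (endTime n s + 1) (fun i j => (ent (Nat.clog 2 n) i j).w)
        (fun i j => (ent (Nat.clog 2 n) i j).k) := by
  obtain ⟨ent, h0, h1, h2⟩ := exists_entries A hA.not_better hn hs X
  refine ⟨fun φ i j => ent φ i j, ⟨fun i => ?_, fun i j hij => ?_, fun φ hφ i j => ?_,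
    fun φ hφ i j k => (h1 φ hφ i i.2 j j.2).2 k k.2⟩, h2⟩
  · rw [h0, PathAlg.conv, if_pos rfl]
  · rw [h0, hX i j hij]
  · rcases (h1 φ hφ i i.2 j j.2).1 with e | ⟨k, hk, e, hb⟩
    · exact .inl e
    · exact .inr ⟨⟨k, hk⟩, e, hb⟩

theorem conv_weightMatrix {A : PathAlg} {n : ℕ} (hadj : A.adj = false) (G : WDigraph n)
    {i j : Fin n} (hij : i ≠ j) : A.conv i j ⟨G.weightMatrix A.bad.eval i j, 0⟩ =
      ⟨(G i j).elim A.bad.eval (fun c => (c : EReal)), 0⟩ := by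
  rw [PathAlg.conv, if_neg (fun h => hij (Fin.ext h)), if_neg (by simp [hadj])]
  rfl

theorem conv_adjacencyMatrix {A : PathAlg} {n : ℕ} (hadj : A.adj = true) (G : Digraph (Fin n))
    {i j : Fin n} (hij : i ≠ j) : A.conv i j ⟨adjacencyMatrix G i j, 0⟩ =
      ⟨(WDigraph.ofDigraph G i j).elim A.bad.eval (fun c => (c : EReal)), 0⟩ := by
  rw [PathAlg.conv, if_neg (fun h => hij (Fin.ext h)), adjacencyMatrix, WDigraph.ofDigraph]
  by_cases h : G.Adj i j
  · simp [h]
  · simp [h, hadj]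

theorem ofDigraph_noNegativeCycle {n : ℕ} (G : Digraph (Fin n)) :
    (WDigraph.ofDigraph G).NoNegativeCycle := by
  have h : ∀ {i j : Fin n} (p : DiPath (WDigraph.ofDigraph G) i j), 0 ≤ p.length := by
    intro i j p
    induction p with
    | nil => exact le_rfl
    | cons c h p ih =>
      have hc : 0 ≤ c := by
        unfold WDigraph.ofDigraph at h
        split_ifs at h
        rw [← Option.some.inj h]
        exact zero_le_one
      exact add_nonneg hc ih
  exact fun i p => h p

/-- The running time on meshes of size `n ^ α`. -/
def runTime (α : ℝ) (n : ℕ) : ℕ := if n = 0 then 0 else endTime n (meshSide α n) + 1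

theorem inputSide_le_meshSide {α : ℝ} (hα : 2 ≤ α) {n : ℕ} (hn : 1 ≤ n) :
    inputSide n ≤ meshSide α n :=
  Nat.ceil_mono (Real.rpow_le_rpow_of_exponent_le (by exact_mod_cast hn) (by linarith))

/-- For `n = 0` the mesh has no processors, so it counts as halted at time `0`. -/
theorem outputs_zero {α : ℝ} (hα : 2 ≤ α) (P : MeshProgram) (X : Fin 0 → Fin 0 → EReal)
    (D : Fin 0 → Fin 0 → EReal) (mid : Fin 0 → Fin 0 → ℕ) :
    P.Outputs (meshSide α 0) X 0 D mid := by
  have h : meshSide α 0 = 0 := by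
    rw [meshSide, Nat.cast_zero, Real.zero_rpow (by linarith), Nat.ceil_zero]
  rw [h]
  exact ⟨⟨fun p => (p 0).elim0, fun t ht => absurd ht (Nat.not_lt_zero t)⟩, fun i => i.elim0⟩

theorem exists_outputs {α : ℝ} (hα : 2 ≤ α) (A : PathAlg) {n : ℕ} {G : WDigraph n}
    (hA : A.Suits G) (X : Fin n → Fin n → EReal)
    (hX : ∀ i j : Fin n, i ≠ j → A.conv i j ⟨X i j, 0⟩ =
      ⟨(G i j).elim A.bad.eval (fun c => (c : EReal)), 0⟩)
    {Sol : (Fin n → Fin n → EReal) → (Fin n → Fin n → ℕ) → Prop}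
    (hSol : ∀ q, n ≤ 2 ^ q → ∀ ent, IsClosure A G q ent →
      Sol (fun i j => (ent q i j).w) (fun i j => (ent q i j).k))
    (h0 : n = 0 → ∀ D mid, Sol D mid) :
    ∃ D mid, (pathProgram A).Outputs (meshSide α n) X (runTime α n) D mid ∧ Sol D mid := by
  rcases Nat.eq_zero_or_pos n with rfl | hn
  · exact ⟨fun _ _ => 0, fun _ _ => 0, outputs_zero hα _ _ _ _, h0 rfl _ _⟩
  · obtain ⟨ent, h1, h2⟩ := exists_isClosure A hn (inputSide_le_meshSide hα hn) hA X hX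
    rw [runTime, if_neg (by omega)]
    exact ⟨_, _, h2, hSol _ (Nat.le_pow_clog one_lt_two n) ent h1⟩

section Solves

variable {α : ℝ}

theorem solvesWeightedAPSP (hα : 2 ≤ α) :
    SolvesWeightedAPSP α (pathProgram (shortestAlg false)) (runTime α) := fun _ G hG =>
  exists_outputs hα _ (suits_shortest hG) _ (fun _ _ => conv_weightMatrix rfl G)
    (fun _ hq _ h => isAPSP_of_isClosure hG hq h) (by rintro rfl _ _ i; exact i.elim0)

theorem solvesUnweightedAPSP (hα : 2 ≤ α) :
    SolvesUnweightedAPSP α (pathProgram (shortestAlg true)) (runTime α) := fun _ G =>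
  exists_outputs hα _ (suits_shortest (ofDigraph_noNegativeCycle G)) _
    (fun _ _ => conv_adjacencyMatrix rfl G)
    (fun _ hq _ h => isAPSP_of_isClosure (ofDigraph_noNegativeCycle G) hq h)
    (by rintro rfl _ _ i; exact i.elim0)

theorem solvesWeightedAPBP (hα : 2 ≤ α) :
    SolvesWeightedAPBP α (pathProgram (widestAlg false)) (runTime α) := fun _ G =>
  exists_outputs hα _ (suits_widest false G) _ (fun _ _ => conv_weightMatrix rfl G)
    (fun _ hq _ h => isAPBP_of_isClosure hq h) (by rintro rfl _ _ i; exact i.elim0)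

theorem solvesUnweightedAPBP (hα : 2 ≤ α) :
    SolvesUnweightedAPBP α (pathProgram (widestAlg true)) (runTime α) := fun _ G =>
  exists_outputs hα _ (suits_widest true _) _ (fun _ _ => conv_adjacencyMatrix rfl G)
    (fun _ hq _ h => isAPBP_of_isClosure hq h) (by rintro rfl _ _ i; exact i.elim0)

end Solves

end


noncomputable section

/-! ### The running time -/

/-- A round can treat at most `width * u²` ≤ 8s of the u³ block products. -/
theorem Geo.Valid.u_pow_le {G : Geo} (h : G.Valid) : G.u ^ 3 ≤ 8 * (G.s * G.E) := by
  have h1 := h.u_le_E_mul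
  have h2 : G.width * (G.u * G.u) ≤ 8 * G.s := Nat.div_mul_le_self _ _
  calc G.u ^ 3 = G.u * (G.u * G.u) := by ring
    _ ≤ G.E * G.width * (G.u * G.u) := Nat.mul_le_mul_right _ h1
    _ = G.E * (G.width * (G.u * G.u)) := by ring
    _ ≤ G.E * (8 * G.s) := Nat.mul_le_mul_left _ h2
    _ = 8 * (G.s * G.E) := by ring

theorem Geo.Valid.mul_E_le {G : Geo} (h : G.Valid) : 4 * (G.s * G.E) ≤ G.u ^ 3 + 4 * G.s := by
  have hu := h.u_pos
  have hw := h.two_le_width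
  have h1 : G.E * G.width ≤ G.u + G.width := (Nat.div_mul_le_self _ _).trans (Nat.sub_le _ _)
  have h2 : 8 * G.s < G.u * G.u * (G.width + 1) :=
    Nat.lt_mul_div_succ (8 * G.s) (Nat.mul_pos hu hu)
  -- As `width` is positive, rounding it down loses at most a factor of two.
  have h3 : 4 * G.s ≤ G.u * G.u * G.width := by nlinarith [Nat.mul_pos hu hu]
  refine Nat.le_of_mul_le_mul_right (c := G.width) ?_ (by omega)
  calc 4 * (G.s * G.E) * G.width = 4 * G.s * (G.E * G.width) := by ring
    _ ≤ 4 * G.s * (G.u + G.width) := Nat.mul_le_mul_left _ h1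
    _ = 4 * G.s * G.u + 4 * G.s * G.width := by ring
    _ ≤ G.u * G.u * G.width * G.u + 4 * G.s * G.width :=
      Nat.add_le_add_right (Nat.mul_le_mul_right _ h3) _
    _ = (G.u ^ 3 + 4 * G.s) * G.width := by ring

theorem log_le_clog {n : ℕ} (hn : 2 ≤ n) : Real.log n ≤ Nat.clog 2 n := by
  have h1 : (n : ℝ) ≤ 2 ^ Nat.clog 2 n := by exact_mod_cast Nat.le_pow_clog one_lt_two n
  have h2 := Real.log_le_log (by positivity) h1
  rw [Real.log_pow] at h2
  have h3 : Real.log 2 ≤ 1 := (Real.log_le_sub_one_of_pos two_pos).trans (by norm_num)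
  exact h2.trans (mul_le_of_le_one_right (Nat.cast_nonneg _) h3)

theorem half_le_log {n : ℕ} (hn : 2 ≤ n) : 1 / 2 ≤ Real.log n := by
  have h1 := Real.log_two_gt_d9
  have h2 : Real.log 2 ≤ Real.log n := Real.log_le_log two_pos (by exact_mod_cast hn)
  linarith

/-- The factor 4 absorbs both 1/log 2 and the rounding, as 1 ≤ 2 log n. -/
theorem clog_le_log {n : ℕ} (hn : 2 ≤ n) : (Nat.clog 2 n : ℝ) ≤ 4 * Real.log n := by
  have h1 : (2 : ℝ) ^ (Nat.clog 2 n).pred ≤ n := by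
    exact_mod_cast (Nat.pow_pred_clog_lt_self one_lt_two (by omega)).le
  have h2 := Real.log_le_log (by positivity) h1
  rw [Real.log_pow] at h2
  have h3 := Real.log_two_gt_d9
  have h4 := half_le_log hn
  have h5 : (Nat.clog 2 n : ℝ) ≤ (Nat.clog 2 n).pred + 1 := by
    exact_mod_cast (by rw [Nat.pred_eq_sub_one]; omega : Nat.clog 2 n ≤ (Nat.clog 2 n).pred + 1)
  have h6 : (0 : ℝ) ≤ (Nat.clog 2 n).pred := Nat.cast_nonneg _
  nlinarith

/-! ### Upper and lower bounds for the running time -/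

section RunTime

variable {α : ℝ} {n : ℕ}

theorem meshSide_bounds (hα : 2 ≤ α) (hn : 1 ≤ n) :
    (n : ℝ) ^ (α / 3) ≤ meshSide α n ∧ (meshSide α n : ℝ) ≤ 2 * (n : ℝ) ^ (α / 3) := by
  have h1 : (1 : ℝ) ≤ (n : ℝ) ^ (α / 3) :=
    Real.one_le_rpow (by exact_mod_cast hn) (by linarith)
  refine ⟨Nat.le_ceil _, ?_⟩
  have := (Nat.ceil_lt_add_one (by linarith : (0 : ℝ) ≤ (n : ℝ) ^ (α / 3))).le
  rw [meshSide]
  linarith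

theorem rpow_mul_cube (hn : 1 ≤ n) :
    (n : ℝ) ^ (3 - α) * ((n : ℝ) ^ (α / 3)) ^ 3 = (n : ℝ) ^ 3 := by
  have h0 : (0 : ℝ) < n := by exact_mod_cast hn
  rw [← Real.rpow_natCast ((n : ℝ) ^ (α / 3)), ← Real.rpow_mul h0.le, ← Real.rpow_add h0,
    ← Real.rpow_natCast (n : ℝ)]
  congr 1
  push_cast
  ring

theorem runTime_eq (hn : 1 ≤ n) : runTime α n = 32 * (61 * meshSide α n + Nat.clog 2 n *
    (2 * (meshSide α n * (meshGeo n (meshSide α n)).E) + meshSide α n)) + 1 := by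
  rw [runTime, if_neg (by omega), endTime, rounds, Geo.period]
  ring

theorem le_runTime (hα : 2 ≤ α) (hn : 2 ≤ n) :
    (n : ℝ) ^ (3 - α) * Real.log n ≤ runTime α n := by
  have hn1 : 1 ≤ n := by omega
  obtain ⟨hx1, hx2⟩ := meshSide_bounds hα hn1
  have hG := meshGeo_valid hn1 (inputSide_le_meshSide hα hn1)
  have hx0 : (0 : ℝ) < (n : ℝ) ^ (α / 3) := Real.rpow_pos_of_pos (by exact_mod_cast hn1) _
  have hcube := rpow_mul_cube (α := α) hn1
  have hE : ((meshGeo n (meshSide α n)).u : ℝ) ^ 3 ≤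
      8 * (meshSide α n * (meshGeo n (meshSide α n)).E) := by
    exact_mod_cast hG.u_pow_le
  have hu : (n : ℝ) ≤ (meshGeo n (meshSide α n)).u * meshSide α n := by
    exact_mod_cast hG.n_le_u
  have hlog := log_le_clog hn
  have hlog0 := half_le_log hn
  have hy0 : (0 : ℝ) ≤ (n : ℝ) ^ (3 - α) := Real.rpow_nonneg (Nat.cast_nonneg n) _
  rw [runTime_eq hn1]
  push_cast
  generalize ((meshGeo n (meshSide α n)).u : ℝ) = u at *
  generalize (Nat.clog 2 n : ℝ) = q at *
  generalize ((meshGeo n (meshSide α n)).E : ℝ) = E at *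
  generalize (n : ℝ) ^ (3 - α) = y at *
  generalize (n : ℝ) ^ (α / 3) = x at *
  generalize (meshSide α n : ℝ) = s at *
  generalize Real.log n = L at *
  have h0 : (0 : ℝ) ≤ n := Nat.cast_nonneg n
  have hs0 : 0 < s := hx0.trans_le hx1
  have hu0 : 0 ≤ u := by
    by_contra h
    push Not at h
    have : (1 : ℝ) ≤ n := by exact_mod_cast hn1
    nlinarith
  have h1 : y * x ^ 3 ≤ 8 * u ^ 3 * x ^ 3 := by
    rw [hcube]
    calc (n : ℝ) ^ 3 ≤ (u * s) ^ 3 := pow_le_pow_left₀ h0 hu 3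
      _ = u ^ 3 * s ^ 3 := mul_pow _ _ _
      _ ≤ u ^ 3 * (2 * x) ^ 3 :=
        mul_le_mul_of_nonneg_left (pow_le_pow_left₀ hs0.le hx2 3) (pow_nonneg hu0 3)
      _ = 8 * u ^ 3 * x ^ 3 := by ring
  -- From n ≤ us and s ≤ 2x one gets n³ ≤ 8u³x³, hence y ≤ 8u³ ≤ 64sE. The running time contains the
  -- summand 64qsE.
  have h2 : y ≤ 64 * (s * E) := by
    have := le_of_mul_le_mul_right h1 (pow_pos hx0 3)
    linarith
  have h3 : y * L ≤ 64 * (s * E) * q := mul_le_mul h2 hlog (by linarith) (by linarith)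
  have h4 : 0 ≤ q * s := mul_nonneg (by linarith) hs0.le
  nlinarith

theorem runTime_le (hα : 2 ≤ α) (hα' : α ≤ 9 / 4) (hn : 2 ≤ n) :
    (runTime α n : ℝ) ≤ 10000 * ((n : ℝ) ^ (3 - α) * Real.log n) := by
  have hn1 : 1 ≤ n := by omega
  have hn1' : (1 : ℝ) ≤ n := by exact_mod_cast hn1
  obtain ⟨hx1, hx2⟩ := meshSide_bounds hα hn1
  have hG := meshGeo_valid hn1 (inputSide_le_meshSide hα hn1)
  have hx0 : (1 : ℝ) ≤ (n : ℝ) ^ (α / 3) := Real.one_le_rpow hn1' (by linarith)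
  have hxn : (n : ℝ) ^ (α / 3) ≤ n := by
    simpa using Real.rpow_le_rpow_of_exponent_le hn1' (by linarith : α / 3 ≤ 1)
  -- This is where α ≤ 9/4 is decisive: α/3 ≤ 3 - α. A single sweep, whose time is of the order of
  -- the side, then takes no longer than the bound for a product.
  have hxy : (n : ℝ) ^ (α / 3) ≤ (n : ℝ) ^ (3 - α) :=
    Real.rpow_le_rpow_of_exponent_le hn1' (by linarith)
  have hcube := rpow_mul_cube (α := α) hn1
  have hE : 4 * ((meshSide α n : ℝ) * (meshGeo n (meshSide α n)).E) ≤
      ((meshGeo n (meshSide α n)).u : ℝ) ^ 3 + 4 * meshSide α n := by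
    exact_mod_cast hG.mul_E_le
  have hu : ((meshGeo n (meshSide α n)).u : ℝ) * meshSide α n ≤ n + meshSide α n := by
    exact_mod_cast hG.u_lt.le
  have hlog := clog_le_log hn
  have hlog0 := half_le_log hn
  have hq0 : (0 : ℝ) ≤ Nat.clog 2 n := Nat.cast_nonneg _
  have hu0 : (0 : ℝ) ≤ (meshGeo n (meshSide α n)).u := Nat.cast_nonneg _
  rw [runTime_eq hn1]
  push_cast
  generalize ((meshGeo n (meshSide α n)).u : ℝ) = u at *
  generalize (Nat.clog 2 n : ℝ) = q at *
  generalize ((meshGeo n (meshSide α n)).E : ℝ) = E at *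
  generalize (n : ℝ) ^ (3 - α) = y at *
  generalize (n : ℝ) ^ (α / 3) = x at *
  generalize (meshSide α n : ℝ) = s at *
  generalize Real.log n = L at *
  -- The rounding in u = ⌈n/s⌉ costs at most another n, because x ≤ n.
  have h1 : u * x ≤ 2 * n := by
    have h2 : (u - 1) * s ≤ n := by linarith
    rcases le_total u 1 with h3 | h3
    · nlinarith
    · nlinarith
  have h2 : u ^ 3 ≤ 8 * y := by
    have h3 : u ^ 3 * x ^ 3 ≤ 8 * y * x ^ 3 := by
      calc u ^ 3 * x ^ 3 = (u * x) ^ 3 := (mul_pow _ _ _).symm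
        _ ≤ (2 * n) ^ 3 := pow_le_pow_left₀ (mul_nonneg hu0 (by linarith)) h1 3
        _ = 8 * (n : ℝ) ^ 3 := by ring
        _ = 8 * y * x ^ 3 := by rw [← hcube]; ring
    exact le_of_mul_le_mul_right h3 (pow_pos (by linarith) 3)
  -- With u³ ≤ 8y and s ≤ 2y one has sE ≤ 4y, and 2 · 4 + 2 = 10.
  have h3 : q * (2 * (s * E) + s) ≤ 4 * L * (10 * y) :=
    (mul_le_mul_of_nonneg_left (by linarith) hq0).trans
      (mul_le_mul_of_nonneg_right hlog (by linarith))
  have h4 : y ≤ 2 * (y * L) := by nlinarith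
  nlinarith

theorem isTheta_runTime (hα : 2 ≤ α) (hα' : α ≤ 9 / 4) :
    Asymptotics.IsTheta Filter.atTop (fun n => (runTime α n : ℝ))
      (fun n : ℕ => (n : ℝ) ^ (3 - α) * Real.log (n : ℝ)) := by
  have h0 : ∀ n : ℕ, 0 ≤ (n : ℝ) ^ (3 - α) * Real.log (n : ℝ) := fun n =>
    mul_nonneg (Real.rpow_nonneg (Nat.cast_nonneg n) _) (Real.log_natCast_nonneg n)
  constructor
  · refine Asymptotics.IsBigO.of_bound 10000 ?_
    filter_upwards [Filter.eventually_ge_atTop 2] with n hn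
    rw [Real.norm_of_nonneg (h0 n), Real.norm_of_nonneg (Nat.cast_nonneg _)]
    exact runTime_le hα hα' hn
  · refine Asymptotics.IsBigO.of_bound 1 ?_
    filter_upwards [Filter.eventually_ge_atTop 2] with n hn
    rw [Real.norm_of_nonneg (h0 n), Real.norm_of_nonneg (Nat.cast_nonneg _), one_mul]
    exact le_runTime hα hn

theorem pathProblemsSolvableInTheta (hα : 2 ≤ α) (hα' : α ≤ 9 / 4) :
    PathProblemsSolvableInTheta α (fun n : ℕ => (n : ℝ) ^ (3 - α) * Real.log (n : ℝ)) :=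
  ⟨⟨_, _, solvesWeightedAPSP hα, isTheta_runTime hα hα'⟩,
    ⟨_, _, solvesUnweightedAPSP hα, isTheta_runTime hα hα'⟩,
    ⟨_, _, solvesWeightedAPBP hα, isTheta_runTime hα hα'⟩,
    ⟨_, _, solvesUnweightedAPBP hα, isTheta_runTime hα hα'⟩⟩

end RunTime

end

theorem corollary1 :
    (∀ α : ℝ, 2 ≤ α → α ≤ 9 / 4 →
      PathProblemsSolvableInTheta α
        (fun n : ℕ => (n : ℝ) ^ (3 - α) * Real.log (n : ℝ))) ∧
    PathProblemsSolvableInTheta (9 / 4)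
      (fun n : ℕ => (n : ℝ) ^ (3 / 4 : ℝ) * Real.log (n : ℝ)) := by
  refine ⟨fun α hα hα' => pathProblemsSolvableInTheta hα hα', ?_⟩
  have h := pathProblemsSolvableInTheta (α := 9 / 4) (by norm_num) le_rfl
  rwa [show (3 - 9 / 4 : ℝ) = 3 / 4 by norm_num] at h
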